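/- **Setting.** Let $a,b,c$ be real polynomials and $\alpha>0$ with $a(x)\ge\alpha$ on $[0,1]$. Write $\langle\cdot,\cdot\rangle$, $\|\cdot\|$ for the inner product and norm of $L_2(0,1)$, and $\|g\|_{L_2(0,\infty;L_2(0,1))}=\big(\int_0^\infty\|g(\cdot,t)\|^2dt\big)^{1/2}$. *The set $\Xi$.* Let $Z_d(x)$, $Z_d(x,y)$ be the vectors of all monomials of degree at most $d$. For $d_1,d_2\in\mathbb N$ put $Z_1(x)=Z_{d_1}(x)$, $Z_2(x,y)=Z_{d_2}(x,y)$. For real $\epsilon_1\ge 0$ and $\epsilon_2$, polynomials $M(x),K_1(x,\xi),K_2(x,\xi)$ satisfy $\{M,K_1,K_2\}\in\Xi_{d_1,d_2,\epsilon_1,\epsilon_2}$ if there is a symmetric block matrix $U=(U_{ij})_{i,j=1}^3$ with $U\ge\mathrm{diag}(\epsilon_1I,0,0)$ and $(\theta_1+\theta_2)\lambda_{\max}(U)\le\epsilon_2$ such that on $[0,1]$ and $[0,1]^2$ $$M(x)=Z_1(x)^TU_{11}Z_1(x),\qquad K_2(x,\xi)=K_1(\xi,x),$$ $$K_1(x,\xi)=Z_1(x)^TU_{12}Z_2(x,\xi)+Z_2(\xi,x)^TU_{31}Z_1(\xi)+\int_0^\xi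 Z_2(\eta,x)^TU_{33}Z_2(\eta,\xi)d\eta+\int_\xi^xZ_2(\eta,x)^TU_{32}Z_2(\eta,\xi)d\eta+\int_x^1Z_2(\eta,x)^TU_{22}Z_2(\eta,\xi)d\eta,$$ where $\theta_1=\sup_{x\in[0,1]}Z_1(x)^TZ_1(x)$ and $\theta_2=\sup_{x,\xi\in[0,1]}\big|\int_0^\xi g\,d\eta+\int_x^1g\,d\eta\big|$ with $g=Z_2(\eta,x)^TZ_2(\eta,\xi)$. *The maps $\mathcal M_{\epsilon_1}$ and $\mathcal N_{\epsilon_1}$.* Subscripts $x,\xi$ denote partial derivatives; $K_{i,x}$ and $P_{i,x}$ are derivatives in the first argument. $\{T_0,\dots,T_6\}=\mathcal M_{\epsilon_1}(M,K_1,K_2)$ means $$T_0=(a_{xx}-b_x)M+bM_x+aM_{xx}+2cM-\tfrac{\pi^2}{2}\alpha\epsilon_1+2a(x)\big[\partial_x(K_1-K_2)(x,\xi)\big]_{\xi=x},$$ $$T_1(x,\xi)=a(x)K_{1,xx}+b(x)K_{1,x}+a(\xi)K_{1,\xi\xi}+b(\xi)K_{1,\xi}+(c(x)+c(\xi))K_1,\qquad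 T_2(x,\xi)=T_1(\xi,x),$$ $$T_3=(a_x(0)-b(0))M(0)+a(0)M_x(0)-\tfrac{\pi^2}{2}\alpha\epsilon_1,\qquad T_4(x)=2a(0)K_{2,x}(0,x)+\pi^2\alpha\epsilon_1,$$ $$T_5=(b(1)-a_x(1))M(1)+a(1)M_x(1),\qquad T_6=2a(1)M(1).$$ $\{Q_0,\dots,Q_8\}=\mathcal N_{\epsilon_1}(N,P_1,P_2)$ means $$Q_0=\partial_x\big[\partial_x(aN)-bN\big]+2\big[\partial_x\big(a(x)(P_1-P_2)(x,\xi)\big)\big]_{\xi=x}+2Nc-\tfrac{\pi^2}{2}\alpha\epsilon_1,$$ $$Q_1(x,\xi)=\partial_x\big[\partial_x(a(x)P_1)-b(x)P_1\big]+\partial_\xi\big[\partial_\xi(a(\xi)P_1)-b(\xi)P_1\big]+(c(x)+c(\xi))P_1,\qquad Q_2(x,\xi)=Q_1(\xi,x),$$ $$Q_3=(a_x(0)-b(0))N(0)+a(0)N_x(0)-\tfrac{\pi^2}{2}\alpha\epsilon_1,$$ $$Q_4(x)=2(a_x(0)-b(0))P_2(0,x)+2a(0)P_{2,x}(0,x)+\pi^2\alpha\epsilon_1,$$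 $$Q_5=(b(1)-a_x(1))N(1)-a(1)N_x(1),\qquad Q_6(x)=2(b(1)-a_x(1))P_1(1,x)-2a(1)P_{1,x}(1,x),$$ $$Q_7=2a(1)N(1),\qquad Q_8(x)=2a(1)P_1(1,x).$$ **Theorem.** Suppose there are scalars $0<\epsilon_1<\epsilon_2<\infty$, $\delta,\beta>0$, integers $d_1,d_2\ge0$ and polynomials with $\{M,K_1,K_2\},\{N,P_1,P_2\}\in\Xi_{d_1,d_2,\epsilon_1,\epsilon_2}$ such that, with $\{T_i\}=\mathcal M_{\epsilon_1}(M,K_1,K_2)$ and $\{Q_i\}=\mathcal N_{\epsilon_1}(N,P_1,P_2)$, $$\{-T_0-2\delta M,\,-T_1-2\delta K_1,\,-T_2-2\delta K_2\}\in\Xi_{d_1,d_2,0,\beta},$$ $$\{-Q_0-2\delta N,\,-Q_1-2\delta P_1,\,-Q_2-2\delta P_2\}\in\Xi_{d_1,d_2,0,\beta},$$ $$T_3\le0,\quad T_4\equiv0,\quad Q_3\le0,\quad Q_4\equiv0.$$ Let $(\mathcal Pz)(x)=M(x)z(x)+\int_0^xK_1(x,\xi)z(\xi)d\xi+\int_x^1K_2(x,\xi)z(\xi)d\xi$,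 and let $\mathcal S$ be the same operator with $N,P_1,P_2$ in place of $M,K_1,K_2$. Let $Z_1<0$ be any scalar with $T_5Z_1>-T_6M(1)$, let $$\mathcal F=\mathcal Z\mathcal P^{-1},\qquad \mathcal Zg=Z_1g_x(1)+\int_0^1K_1(1,x)g(x)dx,$$ let $O_2<0$ be any scalar with $Q_5+Q_7/O_2<0$, and let $O_1=\mathcal S^{-1}R_1$ with $R_1=-\frac12(O_2Q_6+Q_8)$. Then there is $\gamma>0$ such that for every $f\in L_2(0,\infty;L_2(0,1))$ and every classical solution $(w,\hat w)$ of $$w_t=aw_{xx}+bw_x+cw+f,\qquad w_x(0,t)=0,\quad w(1,t)=\mathcal F\hat w(\cdot,t),$$ $$\hat w_t=a\hat w_{xx}+b\hat w_x+c\hat w+O_1(x)\big(\hat w_x(1,t)-w_x(1,t)\big),$$ $$\hat w_x(0,t)=0,\quad \hat w(1,t)=\mathcal F\hat w(\cdot,t)+O_2\big(\hat w_x(1,t)-w_x(1,t)\big)$$ on $[0,1]\times(0,\infty)$ with zero initial data, $$\|w\|_{L_2(0,\infty;L_2(0,1))}\le\gamma\|f\|_{L_2(0,\infty;L_2(0,1))}.$$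 Here a classical solution means that $w,\hat w$ and their derivatives $\partial_t,\partial_x,\partial_x^2$ are continuous on $[0,1]\times(0,\infty)$ and the equations hold (the one containing $f$ almost everywhere); zero initial data means $\|w(\cdot,t)\|\to0$ and $\|\hat w(\cdot,t)\|\to0$ as $t\to0^+$. -/

import Mathlib

open MeasureTheory Set Filter Topology
open scoped Polynomial

noncomputable section

namespace ParabolicSOS

/-! ### Polynomials in two variables `(x, ξ)` -/

/-- Real polynomials in two variables; variable `0` is `x` (first argument), variable `1` is `ξ`. -/
abbrev Poly2 : Type := MvPolynomial (Fin 2) ℝ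

/-- The value `K(x, ξ)`. -/
def ev2 (K : Poly2) (x ξ : ℝ) : ℝ := MvPolynomial.eval ![x, ξ] K

/-- `∂K/∂x`, the derivative in the first argument. -/
def dX (K : Poly2) : Poly2 := MvPolynomial.pderiv 0 K

/-- `∂K/∂ξ`, the derivative in the second argument. -/
def dXi (K : Poly2) : Poly2 := MvPolynomial.pderiv 1 K

/-- The polynomial `(x, ξ) ↦ K(ξ, x)`. -/
def swap2 (K : Poly2) : Poly2 := MvPolynomial.rename (Equiv.swap (0 : Fin 2) 1) K

/-- A one-variable polynomial `p` seen as `(x, ξ) ↦ p(x)`. -/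
def inX (p : ℝ[X]) : Poly2 := Polynomial.aeval (MvPolynomial.X 0 : Poly2) p

/-- A one-variable polynomial `p` seen as `(x, ξ) ↦ p(ξ)`. -/
def inXi (p : ℝ[X]) : Poly2 := Polynomial.aeval (MvPolynomial.X 1 : Poly2) p

/-- The diagonal `x ↦ K(x, x)`. -/
def diag2 (K : Poly2) : ℝ[X] := MvPolynomial.aeval ![(Polynomial.X : ℝ[X]), Polynomial.X] K

/-- The section `x ↦ K(s, x)`, where the first argument is frozen at `s`. -/
def sec2 (s : ℝ) (K : Poly2) : ℝ[X] :=
  MvPolynomial.aeval ![(Polynomial.C s : ℝ[X]), Polynomial.X] K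

/-! ### The set `Ξ` of multipliers and kernels -/

/-- The vector of monomials `x ^ i` of degree at most `d`. -/
def monoVec1 (d : ℕ) (x : ℝ) : Fin (d + 1) → ℝ := fun i => x ^ (i : ℕ)

/-- Exponents `(i, j)` with `i + j ≤ d`. -/
abbrev MonoIdx (d : ℕ) : Type :=
  {p : Fin (d + 1) × Fin (d + 1) // (p.1 : ℕ) + (p.2 : ℕ) ≤ d}

/-- The vector of monomials `x ^ i * y ^ j` of total degree at most `d`. -/
def monoVec2 (d : ℕ) (x y : ℝ) : MonoIdx d → ℝ :=
  fun p => x ^ (p.1.1 : ℕ) * y ^ (p.1.2 : ℕ)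

/-- Indices of the three-by-three block matrix `U`. -/
abbrev BlockIdx (d₁ d₂ : ℕ) : Type := Fin (d₁ + 1) ⊕ (MonoIdx d₂ ⊕ MonoIdx d₂)

/-- First, second and third block of indices. -/
def blk1 {d₁ d₂ : ℕ} : Fin (d₁ + 1) → BlockIdx d₁ d₂ := Sum.inl
def blk2 {d₁ d₂ : ℕ} : MonoIdx d₂ → BlockIdx d₁ d₂ := fun j => Sum.inr (Sum.inl j)
def blk3 {d₁ d₂ : ℕ} : MonoIdx d₂ → BlockIdx d₁ d₂ := fun j => Sum.inr (Sum.inr j)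

/-- `uᵀ A v`. -/
def bil {m n : Type} [Fintype m] [Fintype n] (u : m → ℝ) (A : Matrix m n ℝ) (v : n → ℝ) : ℝ :=
  u ⬝ᵥ (A.mulVec v)

/-- `Z₁(x)ᵀ U₁₁ Z₁(x)`. -/
def multOf (d₁ d₂ : ℕ) (U : Matrix (BlockIdx d₁ d₂) (BlockIdx d₁ d₂) ℝ) (x : ℝ) : ℝ :=
  bil (monoVec1 d₁ x) (U.submatrix blk1 blk1) (monoVec1 d₁ x)

/-- The kernel (for `ξ ≤ x`) generated by `U`. -/
def kernOf (d₁ d₂ : ℕ) (U : Matrix (BlockIdx d₁ d₂) (BlockIdx d₁ d₂) ℝ) (x ξ : ℝ) : ℝ :=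
  bil (monoVec1 d₁ x) (U.submatrix blk1 blk2) (monoVec2 d₂ x ξ)
    + bil (monoVec2 d₂ ξ x) (U.submatrix blk3 blk1) (monoVec1 d₁ ξ)
    + (∫ η in (0 : ℝ)..ξ, bil (monoVec2 d₂ η x) (U.submatrix blk3 blk3) (monoVec2 d₂ η ξ))
    + (∫ η in ξ..x, bil (monoVec2 d₂ η x) (U.submatrix blk3 blk2) (monoVec2 d₂ η ξ))
    + (∫ η in x..(1 : ℝ), bil (monoVec2 d₂ η x) (U.submatrix blk2 blk2) (monoVec2 d₂ η ξ))

/-- `θ₁ = sup_{x ∈ [0,1]} Z₁(x)ᵀ Z₁(x)`. -/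
def theta1 (d₁ : ℕ) : ℝ := sSup ((fun x : ℝ => monoVec1 d₁ x ⬝ᵥ monoVec1 d₁ x) '' Icc 0 1)

/-- `θ₂ = sup_{x, ξ ∈ [0,1]} |∫_0^ξ g + ∫_x^1 g|` with `g(x, ξ, η) = Z₂(η,x)ᵀ Z₂(η,ξ)`. -/
def theta2 (d₂ : ℕ) : ℝ :=
  sSup ((fun p : ℝ × ℝ =>
    |(∫ η in (0 : ℝ)..p.2, monoVec2 d₂ η p.1 ⬝ᵥ monoVec2 d₂ η p.2)
      + ∫ η in p.1..(1 : ℝ), monoVec2 d₂ η p.1 ⬝ᵥ monoVec2 d₂ η p.2|) '' (Icc 0 1 ×ˢ Icc 0 1))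

/-- The largest eigenvalue of a real symmetric matrix. -/
def lamMax {n : Type} [Fintype n] [DecidableEq n] (U : Matrix n n ℝ) : ℝ :=
  sSup (spectrum ℝ U)

/-- `{M, K₁, K₂} ∈ Ξ_{d₁,d₂,ε₁,ε₂}`. -/
def InXi (d₁ d₂ : ℕ) (ε₁ ε₂ : ℝ) (M : ℝ[X]) (K₁ K₂ : Poly2) : Prop :=
  ∃ U : Matrix (BlockIdx d₁ d₂) (BlockIdx d₁ d₂) ℝ,
    U.IsSymm ∧
    (U - Matrix.fromBlocks (ε₁ • (1 : Matrix (Fin (d₁ + 1)) (Fin (d₁ + 1)) ℝ)) 0 0 0).PosSemidef ∧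
    (theta1 d₁ + theta2 d₂) * lamMax U ≤ ε₂ ∧
    (∀ x ∈ Icc (0 : ℝ) 1, M.eval x = multOf d₁ d₂ U x) ∧
    (∀ x ∈ Icc (0 : ℝ) 1, ∀ ξ ∈ Icc (0 : ℝ) 1, ev2 K₁ x ξ = kernOf d₁ d₂ U x ξ) ∧
    K₂ = swap2 K₁

/-! ### Multiplier-plus-semiseparable-kernel operators -/

/-- The kernel equal to `K₁` for `ξ ≤ x` and to `K₂` for `ξ > x`. -/
def semisepKernel (K₁ K₂ : Poly2) (x ξ : ℝ) : ℝ := if ξ ≤ x then ev2 K₁ x ξ else ev2 K₂ x ξ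

/-- `(𝒫 z)(x) = M(x) z(x) + ∫_0^1 K(x, ξ) z(ξ) dξ`. -/
def semisepOp (M : ℝ[X]) (K₁ K₂ : Poly2) (z : ℝ → ℝ) (x : ℝ) : ℝ :=
  M.eval x * z x + ∫ ξ in (0 : ℝ)..1, semisepKernel K₁ K₂ x ξ * z ξ

/-- The inverse `𝒫⁻¹ v` for `v` continuous on `[0,1]`. For `{M, K₁, K₂} ∈ Ξ` with `ε₁ > 0` the
operator `𝒫` is boundedly invertible on `L²(0,1)`; as `M > 0` and the kernel is continuous,
`𝒫⁻¹ v` has a (unique) continuous representative on `[0,1]` when `v` is continuous there.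
This definition returns that representative, so that its boundary values and boundary
derivatives make sense. Its values outside `[0,1]` are irrelevant. -/
def semisepInv (M : ℝ[X]) (K₁ K₂ : Poly2) (v : ℝ → ℝ) : ℝ → ℝ :=
  Classical.epsilon fun z : ℝ → ℝ =>
    ContinuousOn z (Icc 0 1) ∧ ∀ x ∈ Icc (0 : ℝ) 1, semisepOp M K₁ K₂ z x = v x

/-! ### The maps `ℳ_{ε₁}` and `𝒩_{ε₁}` -/

structure DualData where
  T0 : ℝ[X]
  T1 : Poly2
  T2 : Poly2
  T3 : ℝ
  T4 : ℝ[X]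
  T5 : ℝ
  T6 : ℝ

/-- `{T₀, …, T₆} = ℳ_{ε₁}(M, K₁, K₂)`. -/
def dualMap (a b c : ℝ[X]) (α ε₁ : ℝ) (M : ℝ[X]) (K₁ K₂ : Poly2) : DualData :=
  let T1 : Poly2 :=
    inX a * dX (dX K₁) + inX b * dX K₁ + inXi a * dXi (dXi K₁) + inXi b * dXi K₁
      + (inX c + inXi c) * K₁
  { T0 := (a.derivative.derivative - b.derivative) * M + b * M.derivative
        + a * M.derivative.derivative + 2 * c * M - Polynomial.C (Real.pi ^ 2 / 2 * α * ε₁)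
        + a * (2 * diag2 (dX (K₁ - K₂)))
    T1 := T1
    T2 := swap2 T1
    T3 := (a.derivative.eval 0 - b.eval 0) * M.eval 0 + a.eval 0 * M.derivative.eval 0
        - Real.pi ^ 2 / 2 * α * ε₁
    T4 := Polynomial.C (2 * a.eval 0) * sec2 0 (dX K₂) + Polynomial.C (Real.pi ^ 2 * α * ε₁)
    T5 := (b.eval 1 - a.derivative.eval 1) * M.eval 1 + a.eval 1 * M.derivative.eval 1
    T6 := 2 * a.eval 1 * M.eval 1 }

structure PrimalData where
  Q0 : ℝ[X]
  Q1 : Poly2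
  Q2 : Poly2
  Q3 : ℝ
  Q4 : ℝ[X]
  Q5 : ℝ
  Q6 : ℝ[X]
  Q7 : ℝ
  Q8 : ℝ[X]

/-- `{Q₀, …, Q₈} = 𝒩_{ε₁}(N, P₁, P₂)`. -/
def primalMap (a b c : ℝ[X]) (α ε₁ : ℝ) (N : ℝ[X]) (P₁ P₂ : Poly2) : PrimalData :=
  let Q1 : Poly2 :=
    dX (dX (inX a * P₁) - inX b * P₁) + dXi (dXi (inXi a * P₁) - inXi b * P₁)
      + (inX c + inXi c) * P₁
  { Q0 := ((a * N).derivative - b * N).derivative + 2 * diag2 (dX (inX a * (P₁ - P₂)))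
        + 2 * N * c - Polynomial.C (Real.pi ^ 2 / 2 * α * ε₁)
    Q1 := Q1
    Q2 := swap2 Q1
    Q3 := (a.derivative.eval 0 - b.eval 0) * N.eval 0 + a.eval 0 * N.derivative.eval 0
        - Real.pi ^ 2 / 2 * α * ε₁
    Q4 := Polynomial.C (2 * (a.derivative.eval 0 - b.eval 0)) * sec2 0 P₂
        + Polynomial.C (2 * a.eval 0) * sec2 0 (dX P₂) + Polynomial.C (Real.pi ^ 2 * α * ε₁)
    Q5 := (b.eval 1 - a.derivative.eval 1) * N.eval 1 - a.eval 1 * N.derivative.eval 1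
    Q6 := Polynomial.C (2 * (b.eval 1 - a.derivative.eval 1)) * sec2 1 P₁
        - Polynomial.C (2 * a.eval 1) * sec2 1 (dX P₁)
    Q7 := 2 * a.eval 1 * N.eval 1
    Q8 := Polynomial.C (2 * a.eval 1) * sec2 1 P₁ }

/-! ### Controller and observer gains -/

/-- The controller `ℱ = 𝒵 𝒫⁻¹`, with `𝒵 g = Z₁ g_x(1) + ∫_0^1 K₁(1, x) g(x) dx`. -/
def controller (M : ℝ[X]) (K₁ K₂ : Poly2) (Z₁ : ℝ) (v : ℝ → ℝ) : ℝ :=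
  Z₁ * derivWithin (semisepInv M K₁ K₂ v) (Icc 0 1) 1
    + ∫ x in (0 : ℝ)..1, ev2 K₁ 1 x * semisepInv M K₁ K₂ v x

/-- The observer gain `O₁ = 𝒮⁻¹ R₁` with `R₁ = -(O₂ Q₆ + Q₈) / 2`. -/
def observerGain (N : ℝ[X]) (P₁ P₂ : Poly2) (Q : PrimalData) (O₂ : ℝ) : ℝ → ℝ :=
  semisepInv N P₁ P₂ (fun x => -(1 / 2) * (O₂ * Q.Q6.eval x + Q.Q8.eval x))

/-! ### Classical solutions of the coupled system; functions are written `w x t` -/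

/-- `w_t(x, t)`. -/
def pt (w : ℝ → ℝ → ℝ) (x t : ℝ) : ℝ := deriv (fun s => w x s) t

/-- `w_x(x, t)`, one-sided at `x = 0` and `x = 1`. -/
def px (w : ℝ → ℝ → ℝ) (x t : ℝ) : ℝ := derivWithin (fun y => w y t) (Icc 0 1) x

/-- `w_xx(x, t)`. -/
def pxx (w : ℝ → ℝ → ℝ) (x t : ℝ) : ℝ := px (px w) x t

/-- `w` is once continuously differentiable in `t > 0` and twice in `x ∈ [0,1]`: the
derivatives exist, and `w, w_t, w_x, w_xx` are continuous on `[0,1] × (0,∞)`. -/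
structure IsC12 (w : ℝ → ℝ → ℝ) : Prop where
  diff_t : ∀ x ∈ Icc (0 : ℝ) 1, ∀ t, 0 < t → DifferentiableAt ℝ (fun s => w x s) t
  diff_x : ∀ t, 0 < t → DifferentiableOn ℝ (fun y => w y t) (Icc 0 1)
  diff_xx : ∀ t, 0 < t → DifferentiableOn ℝ (fun y => px w y t) (Icc 0 1)
  cont : ContinuousOn (Function.uncurry w) (Icc 0 1 ×ˢ Ioi 0)
  cont_t : ContinuousOn (Function.uncurry (pt w)) (Icc 0 1 ×ˢ Ioi 0)
  cont_x : ContinuousOn (Function.uncurry (px w)) (Icc 0 1 ×ˢ Ioi 0)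
  cont_xx : ContinuousOn (Function.uncurry (pxx w)) (Icc 0 1 ×ˢ Ioi 0)

/-- `a(x) w_xx + b(x) w_x + c(x) w`. -/
def genA (a b c : ℝ[X]) (w : ℝ → ℝ → ℝ) (x t : ℝ) : ℝ :=
  a.eval x * pxx w x t + b.eval x * px w x t + c.eval x * w x t

/-- Lebesgue measure on `[0,1] × (0,∞)`. -/
def spaceTime : Measure (ℝ × ℝ) :=
  (volume.restrict (Icc (0 : ℝ) 1)).prod (volume.restrict (Ioi (0 : ℝ)))

/-- `f ∈ L²(0,∞; L²(0,1))`. -/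
def MemL2L2 (f : ℝ → ℝ → ℝ) : Prop := MemLp (Function.uncurry f) 2 spaceTime

/-- The norm `(∫_0^∞ ∫_0^1 |g(x,t)|² dx dt)^{1/2}`, with value `∞` if the integral diverges. -/
def normL2L2 (g : ℝ → ℝ → ℝ) : ENNReal :=
  (∫⁻ t in Ioi (0 : ℝ), ∫⁻ x in Icc (0 : ℝ) 1, ‖g x t‖ₑ ^ 2) ^ (1 / 2 : ℝ)

/-- `(w, v)` is a classical solution of the plant (state `w`) coupled with the observer
(state `v`) under the feedback `u = F v` and observer gains `O₁`, `O₂`. As `f` is an `L²` function,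
the plant equation is required almost everywhere. -/
structure IsCoupledSolution (a b c : ℝ[X]) (F : (ℝ → ℝ) → ℝ) (O₁ : ℝ → ℝ) (O₂ : ℝ)
    (f w v : ℝ → ℝ → ℝ) : Prop where
  smooth_w : IsC12 w
  smooth_v : IsC12 v
  plant : ∀ᵐ p ∂spaceTime, pt w p.1 p.2 = genA a b c w p.1 p.2 + f p.1 p.2
  observer : ∀ x ∈ Icc (0 : ℝ) 1, ∀ t, 0 < t →
    pt v x t = genA a b c v x t + O₁ x * (px v 1 t - px w 1 t)
  plant_left : ∀ t, 0 < t → px w 0 t = 0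
  plant_right : ∀ t, 0 < t → w 1 t = F (fun x => v x t)
  observer_left : ∀ t, 0 < t → px v 0 t = 0
  observer_right : ∀ t, 0 < t → v 1 t = F (fun x => v x t) + O₂ * (px v 1 t - px w 1 t)

/-- Zero initial data, attained in `L²(0,1)` as `t → 0⁺`. -/
def ZeroInitial (w : ℝ → ℝ → ℝ) : Prop :=
  Tendsto (fun t => ∫ x in (0 : ℝ)..1, w x t ^ 2) (𝓝[>] 0) (𝓝 0)

end ParabolicSOS

end

namespace ParabolicSOS
/-! ### Evaluation of bivariate polynomials -/

/-! The proof is a Lyapunov argument that treats observer and controller separately. Write A = a∂ₓ²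
+ b∂ₓ + c, let v be the observer state, e = v − w, y = e_x(1) and z = 𝒫⁻¹v. The error solves e_t =
Ae + O₁y − f with e_x(0) = 0 and e(1) = O₂y, in which the controller has cancelled. The observer
state solves v_t = Av + O₁y and feels the error only through the scalar y. Two estimates carry the
theorem: d/dt⟨e, 𝒮e⟩ ≤ −κₑ(‖e‖² + y²) + Cₑ‖f‖² (`error_estimate`) and d/dt⟨v, 𝒫⁻¹v⟩ ≤ −κ_z‖z‖² + C_z
y² (`control_estimate`). A large multiple of the first absorbs the y² of the second. Since w = v − e
and ‖v‖ is controlled by ‖z‖, integrating the sum in time from zero initial data bounds ‖w‖ by ‖f‖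
(`lintegral_le_of_dissipation`).

Membership in Ξ is used through positivity: ⟨z, 𝒫z⟩ is the integral of a square form in U, hence at
least ε₁‖z‖² (`InXi.mul_integral_sq_le`). Lax–Milgram then inverts 𝒫 and 𝒮, and solving the operator
equation for its multiplier term gives a continuous inverse (`InXi.semisepInv_spec`). With ε₁ = 0
the same positivity turns the conditions on T₀, T₁, T₂ and Q₀, Q₁, Q₂ into decay at rate 2δ
(`InXi.integral_add_le`).

The dissipation lemmas are exact integrations by parts (`primal_dissipation`, `dual_dissipation`).
They leave the gradient term −2∫aN e_x², which `wirtinger` bounds by −(π²/2)αε₁‖e − e(0)‖².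
Expanding this square gives the π² corrections: the ‖e‖² part goes into Q₀, the e(0)² part into Q₃,
the cross term into Q₄. The sign of Q₃ and the vanishing of Q₄ then remove everything at x = 0, and
the gains settle the boundary terms at x = 1. The dual version does the same with v = 𝒫z written in
terms of z, so no formula for 𝒫⁻¹ is needed.

The time derivatives of both functionals come from a polarization identity
(`hasDerivAt_integral_mul`), which avoids differentiating 𝒫⁻¹v in time. -/

@[simp] lemma ev2_add (K L : Poly2) (x ξ : ℝ) : ev2 (K + L) x ξ = ev2 K x ξ + ev2 L x ξ := by
  simp [ev2]

@[simp] lemma ev2_sub (K L : Poly2) (x ξ : ℝ) : ev2 (K - L) x ξ = ev2 K x ξ - ev2 L x ξ := by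
  simp [ev2]

@[simp] lemma ev2_mul (K L : Poly2) (x ξ : ℝ) : ev2 (K * L) x ξ = ev2 K x ξ * ev2 L x ξ := by
  simp [ev2]

@[simp] lemma ev2_neg (K : Poly2) (x ξ : ℝ) : ev2 (-K) x ξ = -ev2 K x ξ := by
  simp [ev2]

@[simp] lemma ev2_smul (r : ℝ) (K : Poly2) (x ξ : ℝ) : ev2 (r • K) x ξ = r * ev2 K x ξ := by
  simp [ev2, MvPolynomial.smul_eval]

@[simp] lemma ev2_swap2 (K : Poly2) (x ξ : ℝ) : ev2 (swap2 K) x ξ = ev2 K ξ x := by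
  unfold ev2 swap2
  rw [MvPolynomial.eval_rename]
  congr 2
  funext i
  fin_cases i <;> simp

lemma ev2_inX (p : ℝ[X]) (x ξ : ℝ) : ev2 (inX p) x ξ = p.eval x := by
  unfold ev2 inX
  induction p using Polynomial.induction_on' with
  | add p q hp hq => simp [hp, hq]
  | monomial n r => simp [Polynomial.aeval_monomial, MvPolynomial.algebraMap_eq]

lemma ev2_inXi (p : ℝ[X]) (x ξ : ℝ) : ev2 (inXi p) x ξ = p.eval ξ := by
  unfold ev2 inXi
  induction p using Polynomial.induction_on' with
  | add p q hp hq => simp [hp, hq]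
  | monomial n r => simp [Polynomial.aeval_monomial, MvPolynomial.algebraMap_eq]

attribute [simp] ev2_inX ev2_inXi

@[simp] lemma eval_diag2 (K : Poly2) (x : ℝ) : (diag2 K).eval x = ev2 K x x := by
  unfold diag2 ev2
  rw [← Polynomial.coe_evalRingHom, MvPolynomial.aeval_def, MvPolynomial.hom_eval₂,
    MvPolynomial.eval, MvPolynomial.eval₂Hom]
  congr 1
  · ext; simp
  · ext i; fin_cases i <;> simp

@[simp] lemma eval_sec2 (s : ℝ) (K : Poly2) (x : ℝ) : (sec2 s K).eval x = ev2 K s x := by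
  unfold sec2 ev2
  rw [← Polynomial.coe_evalRingHom, MvPolynomial.aeval_def, MvPolynomial.hom_eval₂]
  congr 1
  · ext; simp
  · ext i; fin_cases i <;> simp

lemma continuous_ev2 (K : Poly2) : Continuous fun p : ℝ × ℝ => ev2 K p.1 p.2 := by
  unfold ev2
  refine (MvPolynomial.continuous_eval K).comp (continuous_pi fun i => ?_)
  fin_cases i
  · exact continuous_fst
  · exact continuous_snd

lemma continuous_ev2_mul (K : Poly2) (x : ℝ) {z : ℝ → ℝ} (hz : Continuous z) :
    Continuous fun ξ => ev2 K x ξ * z ξ :=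
  ((continuous_ev2 K).comp (Continuous.prodMk_right x)).mul hz

lemma intervalIntegrable_ev2_mul (K : Poly2) (x p q : ℝ) {z : ℝ → ℝ} (hz : Continuous z) :
    IntervalIntegrable (fun ξ => ev2 K x ξ * z ξ) volume p q :=
  (continuous_ev2_mul K x hz).intervalIntegrable _ _

@[simp] lemma swap2_add (K L : Poly2) : swap2 (K + L) = swap2 K + swap2 L := map_add _ _ _
@[simp] lemma swap2_sub (K L : Poly2) : swap2 (K - L) = swap2 K - swap2 L := map_sub _ _ _
@[simp] lemma swap2_mul (K L : Poly2) : swap2 (K * L) = swap2 K * swap2 L := map_mul _ _ _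

@[simp] lemma swap2_swap2 (K : Poly2) : swap2 (swap2 K) = K := by
  unfold swap2
  rw [MvPolynomial.rename_rename]
  have : (⇑(Equiv.swap (0 : Fin 2) 1) ∘ ⇑(Equiv.swap (0 : Fin 2) 1)) = id := by
    funext i; simp
  rw [this, MvPolynomial.rename_id_apply]

@[simp] lemma swap2_inX (p : ℝ[X]) : swap2 (inX p) = inXi p := by
  unfold swap2 inX inXi
  rw [← Polynomial.aeval_algHom_apply]
  simp

@[simp] lemma swap2_dX (K : Poly2) : swap2 (dX K) = dXi (swap2 K) := by
  unfold swap2 dX dXi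
  rw [← MvPolynomial.pderiv_rename (Equiv.injective _)]
  simp

lemma ev2_dX_inX_mul (p : ℝ[X]) (K : Poly2) (x ξ : ℝ) :
    ev2 (dX (inX p * K)) x ξ = p.derivative.eval x * ev2 K x ξ + p.eval x * ev2 (dX K) x ξ := by
  have h : dX (inX p) = inX p.derivative := by
    unfold dX inX
    rw [Derivation.map_aeval]
    simp
  have h2 : dX (inX p * K) = inX p * dX K + K * dX (inX p) := by
    unfold dX
    rw [Derivation.leibniz]; rfl
  rw [h2, h]
  simp
  ring

@[simp] lemma dX_sub (K L : Poly2) : dX (K - L) = dX K - dX L := map_sub _ _ _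
@[simp] lemma dX_add (K L : Poly2) : dX (K + L) = dX K + dX L := map_add _ _ _

/-! ### Volterra-type integrals with polynomial kernels -/

/-- Leibniz rule for `x ↦ ∫_p^x K(x, ξ) z(ξ) dξ`. -/
lemma hasDerivAt_integral_ev2 (K : Poly2) (p x : ℝ) {z : ℝ → ℝ} (hz : Continuous z) :
    HasDerivAt (fun x => ∫ ξ in p..x, ev2 K x ξ * z ξ)
      ((∫ ξ in p..x, ev2 (dX K) x ξ * z ξ) + ev2 K x x * z x) x := by
  -- Multiplication by x is the product rule, while multiplication by ξ is absorbed into z; this is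
  -- why z is generalized.
  induction K using MvPolynomial.induction_on generalizing z with
  | C r =>
    have h : ∀ x ξ, ev2 (MvPolynomial.C r) x ξ = r := fun x ξ => by simp [ev2]
    have h' : dX (MvPolynomial.C r) = 0 := by simp [dX]
    have h0 : ∀ x ξ, ev2 0 x ξ = 0 := fun x ξ => by simp [ev2]
    simp only [h, h', h0, zero_mul, intervalIntegral.integral_zero, zero_add]
    have hc : Continuous fun ξ => r * z ξ := by fun_prop
    exact intervalIntegral.integral_hasDerivAt_right (hc.intervalIntegrable _ _)
      (hc.stronglyMeasurableAtFilter _ _) hc.continuousAt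
  | add K L hK hL =>
    have hi : ∀ (K : Poly2) (x : ℝ), IntervalIntegrable (fun ξ => ev2 K x ξ * z ξ) volume p x :=
      fun K x => intervalIntegrable_ev2_mul K x p x hz
    simp only [dX_add, ev2_add, add_mul]
    simp only [fun x => intervalIntegral.integral_add (hi K x) (hi L x),
      intervalIntegral.integral_add (hi (dX K) x) (hi (dX L) x)]
    exact ((hK hz).add (hL hz)).congr_deriv (by ring)
  | mul_X K i hK =>
    have hi : ∀ (K : Poly2) (x : ℝ), IntervalIntegrable (fun ξ => ev2 K x ξ * z ξ) volume p x :=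
      fun K x => intervalIntegrable_ev2_mul K x p x hz
    fin_cases i
    · have h : ∀ x ξ, ev2 (K * MvPolynomial.X 0) x ξ = x * ev2 K x ξ := fun x ξ => by
        simp [ev2, mul_comm]
      have h' : ∀ x ξ, ev2 (dX (K * MvPolynomial.X 0)) x ξ = x * ev2 (dX K) x ξ + ev2 K x ξ :=
        fun x ξ => by
          simp [ev2, dX, Derivation.leibniz]; ring
      simp only [Fin.zero_eta, h, h', add_mul, mul_assoc, intervalIntegral.integral_const_mul]
      rw [intervalIntegral.integral_add ((hi _ _).const_mul _) (hi _ _),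
        intervalIntegral.integral_const_mul]
      exact ((hasDerivAt_id x).mul (hK hz)).congr_deriv (by simp; ring)
    · have h : ∀ x ξ, ev2 (K * MvPolynomial.X 1) x ξ = ev2 K x ξ * ξ := fun x ξ => by
        simp [ev2]
      have h' : ∀ x ξ, ev2 (dX (K * MvPolynomial.X 1)) x ξ = ev2 (dX K) x ξ * ξ :=
        fun x ξ => by
          simp [ev2, dX, Derivation.leibniz, MvPolynomial.pderiv_X]; ring
      simp only [Fin.mk_one, h, h', mul_assoc]
      exact hK (z := fun ξ => ξ * z ξ) (by fun_prop)

/-- `x ↦ ∫_0^x K₁(x, ξ) z(ξ) dξ + ∫_x^1 K₂(x, ξ) z(ξ) dξ`. -/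
noncomputable def volt (K₁ K₂ : Poly2) (z : ℝ → ℝ) (x : ℝ) : ℝ :=
  (∫ ξ in (0 : ℝ)..x, ev2 K₁ x ξ * z ξ) + ∫ ξ in x..(1 : ℝ), ev2 K₂ x ξ * z ξ

/-- The moving limits contribute the jump of the kernel across the diagonal. These jump terms are
the source of the diagonal derivatives in T₀ and Q₀. -/
lemma hasDerivAt_volt (K₁ K₂ : Poly2) {z : ℝ → ℝ} (hz : Continuous z) (x : ℝ) :
    HasDerivAt (volt K₁ K₂ z)
      (volt (dX K₁) (dX K₂) z x + ev2 (K₁ - K₂) x x * z x) x := by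
  -- Anchoring the second integral at 1 gives both pieces a variable upper limit, so one Leibniz
  -- rule serves both.
  have h : volt K₁ K₂ z = fun x => (∫ ξ in (0 : ℝ)..x, ev2 K₁ x ξ * z ξ)
      - ∫ ξ in (1 : ℝ)..x, ev2 K₂ x ξ * z ξ := by
    funext x
    rw [volt, intervalIntegral.integral_symm 1 x, sub_eq_add_neg]
  rw [h]
  refine ((hasDerivAt_integral_ev2 K₁ 0 x hz).sub
    (hasDerivAt_integral_ev2 K₂ 1 x hz)).congr_deriv ?_
  rw [volt, intervalIntegral.integral_symm 1 x, ev2_sub]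
  ring

/-- A symmetric kernel is continuous across the diagonal, so the first derivative has no jump term.
This gives the integral part two derivatives when z is merely continuous. -/
lemma hasDerivAt_volt_swap2 (K : Poly2) {z : ℝ → ℝ} (hz : Continuous z) (x : ℝ) :
    HasDerivAt (volt K (swap2 K) z) (volt (dX K) (dX (swap2 K)) z x) x := by
  simpa using hasDerivAt_volt K (swap2 K) hz x

lemma continuous_volt (K₁ K₂ : Poly2) {z : ℝ → ℝ} (hz : Continuous z) :
    Continuous (volt K₁ K₂ z) :=
  continuous_iff_continuousAt.2 fun x => (hasDerivAt_volt K₁ K₂ hz x).continuousAt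

lemma volt_inX_mul (p : ℝ[X]) (K₁ K₂ : Poly2) (z : ℝ → ℝ) (x : ℝ) :
    volt (inX p * K₁) (inX p * K₂) z x = p.eval x * volt K₁ K₂ z x := by
  simp [volt, mul_assoc, mul_add]

lemma volt_add (K₁ K₂ L₁ L₂ : Poly2) {z : ℝ → ℝ} (hz : Continuous z) (x : ℝ) :
    volt (K₁ + L₁) (K₂ + L₂) z x = volt K₁ K₂ z x + volt L₁ L₂ z x := by
  have hi : ∀ (K : Poly2) (p q : ℝ), IntervalIntegrable (fun ξ => ev2 K x ξ * z ξ) volume p q :=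
    fun K p q => intervalIntegrable_ev2_mul K x p q hz
  simp only [volt, ev2_add, add_mul]
  rw [intervalIntegral.integral_add (hi _ _ _) (hi _ _ _),
    intervalIntegral.integral_add (hi _ _ _) (hi _ _ _)]
  ring

lemma volt_smul (r : ℝ) (K₁ K₂ : Poly2) (z : ℝ → ℝ) (x : ℝ) :
    volt (r • K₁) (r • K₂) z x = r * volt K₁ K₂ z x := by
  simp [volt, mul_assoc, mul_add]

lemma volt_neg (K₁ K₂ : Poly2) (z : ℝ → ℝ) (x : ℝ) :
    volt (-K₁) (-K₂) z x = -volt K₁ K₂ z x := by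
  simp [volt, neg_mul]; ring

lemma volt_sub (K₁ K₂ L₁ L₂ : Poly2) {z : ℝ → ℝ} (hz : Continuous z) (x : ℝ) :
    volt (K₁ - L₁) (K₂ - L₂) z x = volt K₁ K₂ z x - volt L₁ L₂ z x := by
  rw [sub_eq_add_neg, sub_eq_add_neg, volt_add _ _ _ _ hz, volt_neg, sub_eq_add_neg]

/-- Links the two descriptions of the operator: one bounded kernel on the square, suited to Fubini
and L² bounds, and two Volterra integrals, suited to differentiation in x. -/
lemma semisepOp_eq_volt (M : ℝ[X]) (K₁ K₂ : Poly2) {z : ℝ → ℝ} (hz : Continuous z) {x : ℝ}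
    (hx : x ∈ Icc (0 : ℝ) 1) :
    semisepOp M K₁ K₂ z x = M.eval x * z x + volt K₁ K₂ z x := by
  have h1 : EqOn (fun ξ => ev2 K₁ x ξ * z ξ) (fun ξ => semisepKernel K₁ K₂ x ξ * z ξ)
      (uIoc 0 x) := fun ξ hξ => by
    rw [uIoc_of_le hx.1] at hξ
    simp [semisepKernel, hξ.2]
  have h2 : EqOn (fun ξ => ev2 K₂ x ξ * z ξ) (fun ξ => semisepKernel K₁ K₂ x ξ * z ξ)
      (uIoc x 1) := fun ξ hξ => by
    rw [uIoc_of_le hx.2] at hξ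
    simp [semisepKernel, not_le.2 hξ.1]
  have c1 : ∀ᵐ ξ, ξ ∈ uIoc 0 x → ev2 K₁ x ξ * z ξ = semisepKernel K₁ K₂ x ξ * z ξ :=
    ae_of_all _ fun ξ hξ => h1 hξ
  have c2 : ∀ᵐ ξ, ξ ∈ uIoc x 1 → ev2 K₂ x ξ * z ξ = semisepKernel K₁ K₂ x ξ * z ξ :=
    ae_of_all _ fun ξ hξ => h2 hξ
  rw [semisepOp, volt, intervalIntegral.integral_congr_ae c1,
    intervalIntegral.integral_congr_ae c2, intervalIntegral.integral_add_adjacent_intervals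
      ((intervalIntegrable_ev2_mul K₁ x 0 x hz).congr_ae
        (ae_restrict_of_forall_mem measurableSet_uIoc fun ξ hξ => h1 hξ))
      ((intervalIntegrable_ev2_mul K₂ x x 1 hz).congr_ae
        (ae_restrict_of_forall_mem measurableSet_uIoc fun ξ hξ => h2 hξ))]

/-! ### Integral operators with bounded kernels on the unit interval -/

/-- Lebesgue measure on the unit interval. -/
noncomputable abbrev unitMeasure : Measure ℝ := volume.restrict (Ioc (0 : ℝ) 1)

instance : IsProbabilityMeasure unitMeasure := ⟨by simp [unitMeasure]⟩

lemma ae_unit_of_forall {p : ℝ → Prop} (h : ∀ x ∈ Icc (0 : ℝ) 1, p x) : ∀ᵐ x ∂unitMeasure, p x :=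
  ae_restrict_of_forall_mem measurableSet_Ioc fun x hx => h x (Ioc_subset_Icc_self hx)

lemma integral_unit_congr {f g : ℝ → ℝ} (h : EqOn f g (Icc 0 1)) :
    ∫ x, f x ∂unitMeasure = ∫ x, g x ∂unitMeasure :=
  integral_congr_ae (ae_unit_of_forall h)

lemma memLp_unit_of_continuousOn {f : ℝ → ℝ} (hf : ContinuousOn f (Icc 0 1)) :
    MemLp f 2 unitMeasure := by
  obtain ⟨C, hC⟩ := isCompact_Icc.exists_bound_of_continuousOn hf
  exact MemLp.of_bound ((hf.mono Ioc_subset_Icc_self).aestronglyMeasurable measurableSet_Ioc) C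
    (ae_unit_of_forall hC)

lemma integrable_unit_of_memLp {f : ℝ → ℝ} (hf : MemLp f 2 unitMeasure) :
    Integrable f unitMeasure := hf.integrable (by norm_num)

lemma integrable_unit_of_continuousOn {f : ℝ → ℝ} (hf : ContinuousOn f (Icc 0 1)) :
    Integrable f unitMeasure :=
  integrable_unit_of_memLp (memLp_unit_of_continuousOn hf)

lemma integrable_mul_unit {f g : ℝ → ℝ} (hf : MemLp f 2 unitMeasure)
    (hg : MemLp g 2 unitMeasure) : Integrable (fun x => f x * g x) unitMeasure :=
  hf.integrable_mul hg

/-- Jensen's inequality for the square. -/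
lemma sq_integral_unit_le {f : ℝ → ℝ} (hf : MemLp f 2 unitMeasure) :
    (∫ x, f x ∂unitMeasure) ^ 2 ≤ ∫ x, f x ^ 2 ∂unitMeasure := by
  set m := ∫ x, f x ∂unitMeasure
  have h1 := integrable_unit_of_memLp hf
  have h2 := hf.integrable_sq
  have h : 0 ≤ ∫ x, (f x - m) ^ 2 ∂unitMeasure := integral_nonneg fun x => sq_nonneg _
  have e : ∫ x, (f x - m) ^ 2 ∂unitMeasure = ∫ x, (f x ^ 2 - 2 * m * f x) + m ^ 2 ∂unitMeasure :=
    integral_congr_ae (ae_of_all _ fun x => by ring)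
  have i1 : Integrable (fun x => 2 * m * f x) unitMeasure := h1.const_mul _
  have i2 : Integrable (fun x => f x ^ 2 - 2 * m * f x) unitMeasure := h2.sub i1
  rw [e, integral_add i2 (integrable_const _), integral_sub h2 i1, integral_const_mul] at h
  simp only [integral_const, probReal_univ, one_smul] at h
  change 0 ≤ _ - 2 * m * m + _ at h
  linarith

/-- A measurable kernel that is bounded on the unit square. -/
structure BddKernel (H : ℝ → ℝ → ℝ) : Prop where
  meas : Measurable (Function.uncurry H)
  bdd : ∃ C, ∀ x ∈ Icc (0 : ℝ) 1, ∀ ξ ∈ Icc (0 : ℝ) 1, |H x ξ| ≤ C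

namespace BddKernel

variable {H L : ℝ → ℝ → ℝ}

lemma swap (hH : BddKernel H) : BddKernel fun x ξ => H ξ x :=
  ⟨hH.meas.comp measurable_swap, hH.bdd.imp fun _ h x hx ξ hξ => h ξ hξ x hx⟩

lemma integrable_prod (hH : BddKernel H) {y z : ℝ → ℝ} (hy : Integrable y unitMeasure)
    (hz : Integrable z unitMeasure) :
    Integrable (fun p : ℝ × ℝ => H p.1 p.2 * (y p.1 * z p.2)) (unitMeasure.prod unitMeasure) := by
  obtain ⟨C, hC⟩ := hH.bdd
  refine (hy.mul_prod hz).bdd_mul (c := C) hH.meas.aestronglyMeasurable ?_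
  rw [Measure.prod_restrict]
  refine ae_restrict_of_forall_mem (measurableSet_Ioc.prod measurableSet_Ioc) fun p hp => ?_
  exact hC _ (Ioc_subset_Icc_self hp.1) _ (Ioc_subset_Icc_self hp.2)

lemma bddMul (hH : BddKernel H) {x : ℝ} (hx : x ∈ Icc (0 : ℝ) 1) {z : ℝ → ℝ}
    (hz : MemLp z 2 unitMeasure) : MemLp (fun ξ => H x ξ * z ξ) 2 unitMeasure := by
  obtain ⟨C, hC⟩ := hH.bdd
  refine MemLp.of_le_mul (c := C) hz ?_ (ae_unit_of_forall fun ξ hξ => ?_)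
  · exact (hH.meas.of_uncurry_left).aestronglyMeasurable.mul hz.1
  · rw [norm_mul]
    exact mul_le_mul_of_nonneg_right (hC x hx ξ hξ) (norm_nonneg _)

lemma integrable_mul (hH : BddKernel H) {x : ℝ} (hx : x ∈ Icc (0 : ℝ) 1) {z : ℝ → ℝ}
    (hz : Integrable z unitMeasure) : Integrable (fun ξ => H x ξ * z ξ) unitMeasure := by
  obtain ⟨C, hC⟩ := hH.bdd
  exact hz.bdd_mul (c := C) (hH.meas.of_uncurry_left).aestronglyMeasurable
    (ae_unit_of_forall fun ξ hξ => hC x hx ξ hξ)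

lemma integral_swap (hH : BddKernel H) {y z : ℝ → ℝ} (hy : Integrable y unitMeasure)
    (hz : Integrable z unitMeasure) :
    ∫ x, y x * (∫ ξ, H x ξ * z ξ ∂unitMeasure) ∂unitMeasure
      = ∫ ξ, z ξ * (∫ x, H x ξ * y x ∂unitMeasure) ∂unitMeasure := by
  simp_rw [← integral_const_mul]
  have e1 : ∀ x ξ, y x * (H x ξ * z ξ) = H x ξ * (y x * z ξ) := fun x ξ => by ring
  have e2 : ∀ ξ x, z ξ * (H x ξ * y x) = H x ξ * (y x * z ξ) := fun ξ x => by ring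
  simp_rw [e1, e2]
  exact integral_integral_swap (hH.integrable_prod hy hz)

/-- The integral operator maps `L²` to `L²` boundedly. -/
lemma memLp_integral (hH : BddKernel H) {z : ℝ → ℝ} (hz : MemLp z 2 unitMeasure) :
    MemLp (fun x => ∫ ξ, H x ξ * z ξ ∂unitMeasure) 2 unitMeasure := by
  obtain ⟨C, hC⟩ := hH.bdd
  have hz1 := integrable_unit_of_memLp hz
  have hm : AEStronglyMeasurable (fun x => ∫ ξ, H x ξ * z ξ ∂unitMeasure) unitMeasure := by
    -- Taking the constant 1 as the first function makes measurability of the image a by-product of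
    -- Fubini.
    have := (hH.integrable_prod (integrable_const (1 : ℝ)) hz1).1
    simp only [one_mul] at this
    exact this.integral_prod_right'
  refine MemLp.of_bound hm (C * ∫ ξ, |z ξ| ∂unitMeasure) (ae_unit_of_forall fun x hx => ?_)
  refine (norm_integral_le_integral_norm _).trans ?_
  rw [← integral_const_mul]
  refine integral_mono_ae (hH.integrable_mul hx hz1).norm (hz1.abs.const_mul _)
    (ae_unit_of_forall fun ξ hξ => ?_)
  simp only [norm_mul]
  exact mul_le_mul_of_nonneg_right (hC x hx ξ hξ) (norm_nonneg _)

lemma sq_integral_le (hH : BddKernel H) : ∃ C, 0 ≤ C ∧ ∀ z : ℝ → ℝ, MemLp z 2 unitMeasure →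
    ∀ x ∈ Icc (0 : ℝ) 1, (∫ ξ, H x ξ * z ξ ∂unitMeasure) ^ 2 ≤ C * ∫ ξ, z ξ ^ 2 ∂unitMeasure := by
  obtain ⟨C, hC⟩ := hH.bdd
  refine ⟨C ^ 2, sq_nonneg _, fun z hz x hx => (sq_integral_unit_le (hH.bddMul hx hz)).trans ?_⟩
  rw [← integral_const_mul]
  refine integral_mono_ae (hH.bddMul hx hz).integrable_sq (hz.integrable_sq.const_mul _)
    (ae_unit_of_forall fun ξ hξ => ?_)
  simp only [mul_pow]
  exact mul_le_mul_of_nonneg_right (sq_le_sq' (by linarith [(abs_le.1 (hC x hx ξ hξ)).1])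
    (abs_le.1 (hC x hx ξ hξ)).2) (sq_nonneg _)

end BddKernel

lemma bddKernel_of_continuous {H : ℝ → ℝ → ℝ} (hH : Continuous fun p : ℝ × ℝ => H p.1 p.2) :
    BddKernel H := by
  obtain ⟨C, hC⟩ := (isCompact_Icc.prod isCompact_Icc).exists_bound_of_continuousOn
    (s := Icc (0 : ℝ) 1 ×ˢ Icc (0 : ℝ) 1) hH.continuousOn
  exact ⟨hH.measurable, C, fun x hx ξ hξ => hC (x, ξ) ⟨hx, hξ⟩⟩

lemma BddKernel.ite {H L : ℝ → ℝ → ℝ} (hH : BddKernel H) (hL : BddKernel L)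
    {s : ℝ → ℝ → Prop} [∀ x ξ, Decidable (s x ξ)] (hs : MeasurableSet {p : ℝ × ℝ | s p.1 p.2}) :
    BddKernel fun x ξ => if s x ξ then H x ξ else L x ξ := by
  obtain ⟨C, hC⟩ := hH.bdd
  obtain ⟨D, hD⟩ := hL.bdd
  refine ⟨Measurable.ite hs hH.meas hL.meas, max C D, fun x hx ξ hξ => ?_⟩
  split_ifs
  · exact (hC x hx ξ hξ).trans (le_max_left _ _)
  · exact (hD x hx ξ hξ).trans (le_max_right _ _)

lemma bddKernel_semisepKernel (K₁ K₂ : Poly2) : BddKernel (semisepKernel K₁ K₂) :=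
  (bddKernel_of_continuous (continuous_ev2 K₁)).ite (bddKernel_of_continuous (continuous_ev2 K₂))
    (measurableSet_le measurable_snd measurable_fst)

lemma semisepOp_eq (M : ℝ[X]) (K₁ K₂ : Poly2) (z : ℝ → ℝ) (x : ℝ) :
    semisepOp M K₁ K₂ z x
      = M.eval x * z x + ∫ ξ, semisepKernel K₁ K₂ x ξ * z ξ ∂unitMeasure := by
  rw [semisepOp, intervalIntegral.integral_of_le zero_le_one]

lemma semisepOp_congr (M : ℝ[X]) (K₁ K₂ : Poly2) {y z : ℝ → ℝ} (h : EqOn y z (Icc 0 1)) :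
    EqOn (semisepOp M K₁ K₂ y) (semisepOp M K₁ K₂ z) (Icc 0 1) := fun x hx => by
  rw [semisepOp_eq, semisepOp_eq, h hx]
  congr 1
  exact integral_unit_congr fun ξ hξ => by simp only [h hξ]

lemma semisepOp_sub (M : ℝ[X]) (K₁ K₂ : Poly2) {y z : ℝ → ℝ} (hy : Integrable y unitMeasure)
    (hz : Integrable z unitMeasure) {x : ℝ} (hx : x ∈ Icc (0 : ℝ) 1) :
    semisepOp M K₁ K₂ (fun x => y x - z x) x = semisepOp M K₁ K₂ y x - semisepOp M K₁ K₂ z x := by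
  simp only [semisepOp_eq, mul_sub]
  rw [integral_sub ((bddKernel_semisepKernel K₁ K₂).integrable_mul hx hy)
    ((bddKernel_semisepKernel K₁ K₂).integrable_mul hx hz)]
  ring

lemma semisepOp_add (M : ℝ[X]) (K₁ K₂ : Poly2) {y z : ℝ → ℝ} (hy : Integrable y unitMeasure)
    (hz : Integrable z unitMeasure) {x : ℝ} (hx : x ∈ Icc (0 : ℝ) 1) :
    semisepOp M K₁ K₂ (fun x => y x + z x) x = semisepOp M K₁ K₂ y x + semisepOp M K₁ K₂ z x := by
  simp only [semisepOp_eq, mul_add]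
  rw [integral_add ((bddKernel_semisepKernel K₁ K₂).integrable_mul hx hy)
    ((bddKernel_semisepKernel K₁ K₂).integrable_mul hx hz)]
  ring

lemma semisepOp_smul (M : ℝ[X]) (K₁ K₂ : Poly2) (r : ℝ) (z : ℝ → ℝ) (x : ℝ) :
    semisepOp M K₁ K₂ (fun x => r * z x) x = r * semisepOp M K₁ K₂ z x := by
  simp only [semisepOp_eq, mul_add, ← integral_const_mul]
  congr 1
  · ring
  · congr 1; ext; ring

lemma memLp_polynomial_mul (M : ℝ[X]) {z : ℝ → ℝ} (hz : MemLp z 2 unitMeasure) :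
    MemLp (fun x => M.eval x * z x) 2 unitMeasure := by
  obtain ⟨C, hC⟩ := isCompact_Icc.exists_bound_of_continuousOn
    (s := Icc (0 : ℝ) 1) (f := fun x => M.eval x) (by fun_prop)
  refine MemLp.of_le_mul (c := C) hz ?_ (ae_unit_of_forall fun ξ hξ => ?_)
  · exact (Continuous.aestronglyMeasurable (by fun_prop)).mul hz.1
  · rw [norm_mul]
    exact mul_le_mul_of_nonneg_right (hC ξ hξ) (norm_nonneg _)

lemma memLp_semisepOp (M : ℝ[X]) (K₁ K₂ : Poly2) {z : ℝ → ℝ} (hz : MemLp z 2 unitMeasure) :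
    MemLp (semisepOp M K₁ K₂ z) 2 unitMeasure := by
  have h := (memLp_polynomial_mul M hz).add
    ((bddKernel_semisepKernel K₁ K₂).memLp_integral hz)
  exact h.ae_eq (ae_of_all _ fun x => (semisepOp_eq M K₁ K₂ z x).symm)

/-- Boundedness of `𝒫` on `L²(0,1)`. -/
lemma exists_integral_semisepOp_sq_le (M : ℝ[X]) (K₁ K₂ : Poly2) :
    ∃ C, 0 < C ∧ ∀ z : ℝ → ℝ, MemLp z 2 unitMeasure →
      ∫ x, semisepOp M K₁ K₂ z x ^ 2 ∂unitMeasure ≤ C * ∫ x, z x ^ 2 ∂unitMeasure := by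
  obtain ⟨C, hC⟩ := isCompact_Icc.exists_bound_of_continuousOn
    (s := Icc (0 : ℝ) 1) (f := fun x => M.eval x) (by fun_prop)
  obtain ⟨D, hD0, hD⟩ := (bddKernel_semisepKernel K₁ K₂).sq_integral_le
  refine ⟨2 * C ^ 2 + 2 * D + 1, by positivity, fun z hz => ?_⟩
  have hI : 0 ≤ ∫ x, z x ^ 2 ∂unitMeasure := integral_nonneg fun x => sq_nonneg _
  set I := ∫ x, z x ^ 2 ∂unitMeasure with hIdef
  have h1 : ∫ x, semisepOp M K₁ K₂ z x ^ 2 ∂unitMeasure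
      ≤ ∫ x, 2 * C ^ 2 * z x ^ 2 + 2 * D * I ∂unitMeasure := by
    refine integral_mono_ae (memLp_semisepOp M K₁ K₂ hz).integrable_sq
      ((hz.integrable_sq.const_mul _).add (integrable_const _))
      (ae_unit_of_forall fun x hx => ?_)
    have h2 := hD z hz x hx
    have h3 : (M.eval x * z x) ^ 2 ≤ C ^ 2 * z x ^ 2 := by
      rw [mul_pow]
      exact mul_le_mul_of_nonneg_right (sq_le_sq' (by linarith [(abs_le.1 (hC x hx)).1])
        (abs_le.1 (hC x hx)).2) (sq_nonneg _)
    simp only [semisepOp_eq]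
    nlinarith [sq_nonneg (M.eval x * z x - ∫ ξ, semisepKernel K₁ K₂ x ξ * z ξ ∂unitMeasure)]
  rw [integral_add (hz.integrable_sq.const_mul _) (integrable_const _), integral_const_mul] at h1
  simp only [integral_const, probReal_univ, one_smul] at h1
  linarith

lemma semisepKernel_swap2_comm (K : Poly2) (x ξ : ℝ) :
    semisepKernel K (swap2 K) x ξ = semisepKernel K (swap2 K) ξ x := by
  simp only [semisepKernel, ev2_swap2]
  rcases lt_trichotomy x ξ with h | h | h
  · rw [if_neg (not_le.2 h), if_pos h.le]
  · rw [h]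
  · rw [if_pos h.le, if_neg (not_le.2 h)]

/-- `𝒫` is self-adjoint. -/
lemma integral_mul_semisepOp_comm (M : ℝ[X]) (K : Poly2) {y z : ℝ → ℝ}
    (hy : MemLp y 2 unitMeasure) (hz : MemLp z 2 unitMeasure) :
    ∫ x, y x * semisepOp M K (swap2 K) z x ∂unitMeasure
      = ∫ x, z x * semisepOp M K (swap2 K) y x ∂unitMeasure := by
  have hk := bddKernel_semisepKernel K (swap2 K)
  simp only [semisepOp_eq, mul_add]
  rw [integral_add (integrable_mul_unit hy (memLp_polynomial_mul M hz))
      (integrable_mul_unit hy (hk.memLp_integral hz)),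
    integral_add (integrable_mul_unit hz (memLp_polynomial_mul M hy))
      (integrable_mul_unit hz (hk.memLp_integral hy)),
    hk.integral_swap (integrable_unit_of_memLp hy) (integrable_unit_of_memLp hz)]
  congr 1
  · congr 1; ext; ring
  · congr 1; ext x; congr 2; ext ξ; rw [semisepKernel_swap2_comm]

/-- A quadratic form only sees the symmetric part of its kernel. -/
lemma two_mul_integral_mul_volt (J₁ J₂ : Poly2) {z : ℝ → ℝ} (hz : Continuous z) :
    2 * ∫ x, z x * volt J₁ J₂ z x ∂unitMeasure
      = ∫ x, z x * volt (J₁ + swap2 J₂) (swap2 (J₁ + swap2 J₂)) z x ∂unitMeasure := by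
  have hz2 := memLp_unit_of_continuousOn hz.continuousOn
  have hz1 := integrable_unit_of_memLp hz2
  -- Transposing the kernel exchanges the two triangles, hence the swapped roles of J₁ and J₂. The
  -- diagonal is negligible, so the kernels need not agree there.
  have key : ∀ J₁ J₂ : Poly2, ∫ x, z x * volt J₁ J₂ z x ∂unitMeasure
      = ∫ x, z x * volt (swap2 J₂) (swap2 J₁) z x ∂unitMeasure := by
    intro J₁ J₂
    have e : ∀ J₁ J₂ : Poly2, ∫ x, z x * volt J₁ J₂ z x ∂unitMeasure
        = ∫ x, z x * (∫ ξ, semisepKernel J₁ J₂ x ξ * z ξ ∂unitMeasure) ∂unitMeasure :=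
      fun J₁ J₂ => integral_unit_congr fun x hx => by
        have h1 := semisepOp_eq_volt 0 J₁ J₂ hz hx
        have h2 := semisepOp_eq 0 J₁ J₂ z x
        simp only [Polynomial.eval_zero, zero_mul, zero_add] at h1 h2
        simp only [← h1, h2]
    rw [e, e, (bddKernel_semisepKernel J₁ J₂).integral_swap hz1 hz1]
    refine integral_congr_ae (ae_of_all _ fun x => ?_)
    simp only
    congr 1
    refine integral_congr_ae ?_
    have : ∀ᵐ ξ ∂unitMeasure, ξ ≠ x := Measure.ae_ne _ x
    filter_upwards [this] with ξ hξ
    simp only [semisepKernel, ev2_swap2]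
    rcases lt_or_gt_of_ne hξ with h | h
    · rw [if_neg (not_le.2 h), if_pos h.le]
    · rw [if_pos h.le, if_neg (not_le.2 h)]
  have hi : ∀ J₁ J₂ : Poly2, Integrable (fun x => z x * volt J₁ J₂ z x) unitMeasure :=
    fun J₁ J₂ => integrable_unit_of_continuousOn
      (hz.mul (continuous_volt J₁ J₂ hz)).continuousOn
  rw [two_mul]
  nth_rewrite 2 [key]
  rw [← integral_add (hi _ _) (hi _ _)]
  congr 1
  ext x
  rw [swap2_add, swap2_swap2, add_comm (swap2 J₁) J₂, volt_add _ _ _ _ hz]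
  ring

/-! ### Positivity of the quadratic form generated by a positive semidefinite matrix -/

lemma bil_eq_sum {m n : Type} [Fintype m] [Fintype n] (u : m → ℝ) (A : Matrix m n ℝ) (v : n → ℝ) :
    bil u A v = ∑ i, ∑ j, A i j * (u i * v j) := by
  simp only [bil, dotProduct, Matrix.mulVec, Finset.mul_sum]
  exact Finset.sum_congr rfl fun i _ => Finset.sum_congr rfl fun j _ => by ring

lemma integral_sum_sum {ι κ : Type} [Fintype ι] [Fintype κ] (c : ι → κ → ℝ) {f : ι → κ → ℝ → ℝ}
    (h : ∀ i j, Integrable (f i j) unitMeasure) :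
    ∫ η, ∑ i, ∑ j, c i j * f i j η ∂unitMeasure
      = ∑ i, ∑ j, c i j * ∫ η, f i j η ∂unitMeasure := by
  rw [integral_finsetSum _ fun i _ => integrable_finsetSum _ fun j _ => (h i j).const_mul _]
  refine Finset.sum_congr rfl fun i _ => ?_
  rw [integral_finsetSum _ fun j _ => (h i j).const_mul _]
  exact Finset.sum_congr rfl fun j _ => integral_const_mul _ _

namespace BddKernel

variable {H L : ℝ → ℝ → ℝ}

lemma mul (hH : BddKernel H) (hL : BddKernel L) : BddKernel fun x ξ => H x ξ * L x ξ := by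
  obtain ⟨C, hC⟩ := hH.bdd
  obtain ⟨D, hD⟩ := hL.bdd
  refine ⟨hH.meas.mul hL.meas, C * D, fun x hx ξ hξ => ?_⟩
  rw [abs_mul]
  exact mul_le_mul (hC x hx ξ hξ) (hD x hx ξ hξ) (abs_nonneg _)
    ((abs_nonneg _).trans (hC x hx ξ hξ))

lemma add (hH : BddKernel H) (hL : BddKernel L) : BddKernel fun x ξ => H x ξ + L x ξ := by
  obtain ⟨C, hC⟩ := hH.bdd
  obtain ⟨D, hD⟩ := hL.bdd
  exact ⟨hH.meas.add hL.meas, C + D, fun x hx ξ hξ =>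
    (abs_add_le _ _).trans (add_le_add (hC x hx ξ hξ) (hD x hx ξ hξ))⟩

lemma const_mul (r : ℝ) (hH : BddKernel H) : BddKernel fun x ξ => r * H x ξ :=
  (bddKernel_of_continuous (H := fun _ _ => r) continuous_const).mul hH

lemma zero : BddKernel fun _ _ => 0 := bddKernel_of_continuous continuous_const

lemma sum {ι : Type*} (s : Finset ι) {H : ι → ℝ → ℝ → ℝ} (h : ∀ i, BddKernel (H i)) :
    BddKernel fun x ξ => ∑ i ∈ s, H i x ξ := by
  classical
  induction s using Finset.induction_on with
  | empty => simpa using zero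
  | insert i s hi ih => simpa [Finset.sum_insert hi] using (h i).add ih

lemma left {p : ℝ → ℝ} (hp : Continuous p) : BddKernel fun x _ => p x :=
  bddKernel_of_continuous (hp.comp continuous_fst)

lemma right {p : ℝ → ℝ} (hp : Continuous p) : BddKernel fun _ ξ => p ξ :=
  bddKernel_of_continuous (hp.comp continuous_snd)

/-- Boundedness of composed kernels. -/
lemma comp (hH : BddKernel H) (hL : BddKernel L) :
    BddKernel fun x ξ => ∫ η, H η x * L η ξ ∂unitMeasure := by
  obtain ⟨C, hC⟩ := hH.bdd
  obtain ⟨D, hD⟩ := hL.bdd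
  refine ⟨?_, C * D, fun x hx ξ hξ => ?_⟩
  · have hm : Measurable fun q : (ℝ × ℝ) × ℝ => H q.2 q.1.1 * L q.2 q.1.2 :=
      (hH.meas.comp (measurable_snd.prodMk (measurable_fst.comp measurable_fst))).mul
        (hL.meas.comp (measurable_snd.prodMk (measurable_snd.comp measurable_fst)))
    exact (hm.stronglyMeasurable.integral_prod_right'
      (ν := unitMeasure)).measurable
  · have h := norm_integral_le_of_norm_le_const (μ := unitMeasure)
      (f := fun η => H η x * L η ξ) (C := C * D) (ae_unit_of_forall fun η hη => by
        rw [norm_mul]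
        exact mul_le_mul (hC η hη x hx) (hD η hη ξ hξ) (norm_nonneg _)
          ((abs_nonneg _).trans (hC η hη x hx)))
    simpa using h

lemma integrable_quad (hH : BddKernel H) {y z : ℝ → ℝ} (hy : MemLp y 2 unitMeasure)
    (hz : MemLp z 2 unitMeasure) :
    Integrable (fun x => y x * ∫ ξ, H x ξ * z ξ ∂unitMeasure) unitMeasure :=
  integrable_mul_unit hy (hH.memLp_integral hz)

lemma quad_add (hH : BddKernel H) (hL : BddKernel L) {y z : ℝ → ℝ} (hy : MemLp y 2 unitMeasure)
    (hz : MemLp z 2 unitMeasure) :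
    ∫ x, y x * (∫ ξ, (H x ξ + L x ξ) * z ξ ∂unitMeasure) ∂unitMeasure
      = (∫ x, y x * (∫ ξ, H x ξ * z ξ ∂unitMeasure) ∂unitMeasure)
        + ∫ x, y x * (∫ ξ, L x ξ * z ξ ∂unitMeasure) ∂unitMeasure := by
  rw [← integral_add (hH.integrable_quad hy hz) (hL.integrable_quad hy hz)]
  refine integral_unit_congr fun x hx => ?_
  have hz1 := integrable_unit_of_memLp hz
  simp only [add_mul]
  rw [integral_add (hH.integrable_mul hx hz1) (hL.integrable_mul hx hz1), mul_add]

lemma quad_sum {ι : Type*} (s : Finset ι) (c : ι → ℝ) {H : ι → ℝ → ℝ → ℝ}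
    (h : ∀ i, BddKernel (H i)) {z : ℝ → ℝ} (hz : MemLp z 2 unitMeasure) :
    ∫ x, z x * (∫ ξ, (∑ i ∈ s, c i * H i x ξ) * z ξ ∂unitMeasure) ∂unitMeasure
      = ∑ i ∈ s, c i * ∫ x, z x * (∫ ξ, H i x ξ * z ξ ∂unitMeasure) ∂unitMeasure := by
  classical
  induction s using Finset.induction_on with
  | empty => simp
  | insert i s hi ih =>
    simp only [Finset.sum_insert hi]
    rw [quad_add ((h i).const_mul (c i)) (sum s fun j => (h j).const_mul (c j)) hz hz, ih]
    congr 1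
    simp only [mul_assoc, integral_const_mul, mul_left_comm _ (c i)]

end BddKernel

/-- The integral of a product of two functions of the form `p z + ∫ Φ(·, x) z(x) dx`. -/
lemma integral_mul_affine {p q z : ℝ → ℝ} {Φ Ψ : ℝ → ℝ → ℝ} (hp : Continuous p)
    (hq : Continuous q) (hΦ : BddKernel Φ) (hΨ : BddKernel Ψ) (hz : MemLp z 2 unitMeasure) :
    ∫ η, (p η * z η + ∫ x, Φ η x * z x ∂unitMeasure)
        * (q η * z η + ∫ x, Ψ η x * z x ∂unitMeasure) ∂unitMeasure
      = (∫ x, p x * q x * z x ^ 2 ∂unitMeasure)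
        + ∫ x, z x * (∫ ξ, (p x * Ψ x ξ + q ξ * Φ ξ x
            + ∫ η, Φ η x * Ψ η ξ ∂unitMeasure) * z ξ ∂unitMeasure) ∂unitMeasure := by
  have hz1 := integrable_unit_of_memLp hz
  have kp : BddKernel fun x ξ => p x * Ψ x ξ := (BddKernel.left hp).mul hΨ
  have kq : BddKernel fun x ξ => q ξ * Φ ξ x := (BddKernel.right hq).mul hΦ.swap
  have kq' : BddKernel fun x ξ => q x * Φ x ξ := (BddKernel.left hq).mul hΦ
  have kc := hΦ.comp hΨ
  have hpq : Integrable (fun x => p x * q x * z x ^ 2) unitMeasure := by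
    obtain ⟨C, hC⟩ := isCompact_Icc.exists_bound_of_continuousOn
      (s := Icc (0 : ℝ) 1) (f := fun x => p x * q x) (by fun_prop)
    exact hz.integrable_sq.bdd_mul (c := C)
      (Continuous.aestronglyMeasurable (by fun_prop)) (ae_unit_of_forall hC)
  have hΦm := hΦ.memLp_integral hz
  have hΨm := hΨ.memLp_integral hz
  rw [(kp.add kq).quad_add kc hz hz, kp.quad_add kq hz hz]
  have e : ∀ η, (p η * z η + ∫ x, Φ η x * z x ∂unitMeasure)
        * (q η * z η + ∫ x, Ψ η x * z x ∂unitMeasure)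
      = p η * q η * z η ^ 2 + (z η * (∫ x, p η * Ψ η x * z x ∂unitMeasure)
        + z η * (∫ x, q η * Φ η x * z x ∂unitMeasure)
        + (∫ x, Ψ η x * z x ∂unitMeasure) * ∫ x, Φ η x * z x ∂unitMeasure) := fun η => by
    simp only [mul_assoc, integral_const_mul]; ring
  simp only [e]
  have i2 : Integrable (fun η => z η * (∫ x, p η * Ψ η x * z x ∂unitMeasure)
      + z η * (∫ x, q η * Φ η x * z x ∂unitMeasure)) unitMeasure :=
    (kp.integrable_quad hz hz).add (kq'.integrable_quad hz hz)
  have i3 : Integrable (fun η => z η * (∫ x, p η * Ψ η x * z x ∂unitMeasure)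
      + z η * (∫ x, q η * Φ η x * z x ∂unitMeasure)
      + (∫ x, Ψ η x * z x ∂unitMeasure) * ∫ x, Φ η x * z x ∂unitMeasure) unitMeasure :=
    i2.add (integrable_mul_unit hΨm hΦm)
  -- Fubini is applied to the q-term and to the product of the two integral terms, to bring z(x)
  -- outside as in the target form.
  rw [integral_add hpq i3, integral_add i2 (integrable_mul_unit hΨm hΦm),
    integral_add (kp.integrable_quad hz hz) (kq'.integrable_quad hz hz),
    kq'.integral_swap hz1 hz1, hΦ.integral_swap (integrable_unit_of_memLp hΨm) hz1]
  congr 2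
  refine integral_unit_congr fun x hx => ?_
  congr 1
  have hΦx : Integrable (fun η => Φ η x) unitMeasure := by
    simpa using hΦ.swap.integrable_mul hx (integrable_const (1 : ℝ))
  rw [hΨ.integral_swap hΦx hz1]
  refine integral_congr_ae (ae_of_all _ fun ξ => ?_)
  simp only [mul_comm]

/-! ### Operators in Ξ as integrated squares. -/

section Generated

variable {d₁ d₂ : ℕ}

/-- The pointwise factor multiplying `z(η)` in the vector `(𝒵 z)(η)`. -/
def pointVec (d₁ d₂ : ℕ) (η : ℝ) : BlockIdx d₁ d₂ → ℝ := Sum.elim (monoVec1 d₁ η) 0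

open scoped Classical in
/-- The kernel factor multiplying `z(x)` in the vector `(𝒵 z)(η)`. -/
noncomputable def kernVec (d₁ d₂ : ℕ) (η x : ℝ) : BlockIdx d₁ d₂ → ℝ :=
  Sum.elim 0 (Sum.elim (fun j => if x < η then monoVec2 d₂ η x j else 0)
    (fun j => if η < x then monoVec2 d₂ η x j else 0))

lemma kernVec_of_lt {η x : ℝ} (h : x < η) :
    kernVec d₁ d₂ η x = Sum.elim (0 : Fin (d₁ + 1) → ℝ)
      (Sum.elim (monoVec2 d₂ η x) (0 : MonoIdx d₂ → ℝ)) := by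
  unfold kernVec
  simp only [if_pos h, if_neg (not_lt.2 h.le)]
  rfl

lemma kernVec_of_gt {η x : ℝ} (h : η < x) :
    kernVec d₁ d₂ η x = Sum.elim (0 : Fin (d₁ + 1) → ℝ)
      (Sum.elim (0 : MonoIdx d₂ → ℝ) (monoVec2 d₂ η x)) := by
  unfold kernVec
  simp only [if_pos h, if_neg (not_lt.2 h.le)]
  rfl

lemma continuous_pointVec (i : BlockIdx d₁ d₂) : Continuous fun η => pointVec d₁ d₂ η i := by
  rcases i with i | i
  · simp only [pointVec, Sum.elim_inl, monoVec1]; fun_prop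
  · simp only [pointVec, Sum.elim_inr, Pi.zero_apply]; fun_prop

lemma bddKernel_kernVec (i : BlockIdx d₁ d₂) : BddKernel fun η x => kernVec d₁ d₂ η x i := by
  have hc : ∀ j, BddKernel fun η x => monoVec2 d₂ η x j := fun j =>
    bddKernel_of_continuous (by simp only [monoVec2]; fun_prop)
  rcases i with i | i | i
  · exact BddKernel.zero
  · exact (hc i).ite BddKernel.zero (measurableSet_lt measurable_snd measurable_fst)
  · exact (hc i).ite BddKernel.zero (measurableSet_lt measurable_fst measurable_snd)

variable (U : Matrix (BlockIdx d₁ d₂) (BlockIdx d₁ d₂) ℝ)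

/-- The kernel of the quadratic form `∫ (𝒵 z)ᵀ U (𝒵 z)`. -/
noncomputable def quadKernel (x ξ : ℝ) : ℝ :=
  ∑ i, ∑ j, U i j * (pointVec d₁ d₂ x i * kernVec d₁ d₂ x ξ j
    + pointVec d₁ d₂ ξ j * kernVec d₁ d₂ ξ x i
    + ∫ η, kernVec d₁ d₂ η x i * kernVec d₁ d₂ η ξ j ∂unitMeasure)

lemma quadKernel_comm (hU : U.IsSymm) (x ξ : ℝ) : quadKernel U x ξ = quadKernel U ξ x := by
  unfold quadKernel
  rw [Finset.sum_comm]
  refine Finset.sum_congr rfl fun i _ => Finset.sum_congr rfl fun j _ => ?_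
  rw [hU.apply]
  simp only [mul_comm (kernVec d₁ d₂ _ x j)]
  ring

lemma integrable_kernVec_mul {x ξ : ℝ} (hx : x ∈ Icc (0 : ℝ) 1) (hξ : ξ ∈ Icc (0 : ℝ) 1)
    (i j : BlockIdx d₁ d₂) :
    Integrable (fun η => kernVec d₁ d₂ η x i * kernVec d₁ d₂ η ξ j) unitMeasure := by
  have h : ∀ (i : BlockIdx d₁ d₂) (x : ℝ), x ∈ Icc (0 : ℝ) 1 →
      MemLp (fun η => kernVec d₁ d₂ η x i) 2 unitMeasure := fun i x hx => by
    simpa using (bddKernel_kernVec i).swap.bddMul hx (memLp_const (1 : ℝ))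
  exact integrable_mul_unit (h i x hx) (h j ξ hξ)

/-- The five terms of the kernel in Ξ are the blocks of U selected by the positions of x, ξ and η.
Only ξ < x is needed: symmetry gives the other triangle and the diagonal is null. -/
lemma quadKernel_eq_kernOf {x ξ : ℝ} (hξ : 0 ≤ ξ) (h : ξ < x) (hx : x ≤ 1) :
    quadKernel U x ξ = kernOf d₁ d₂ U x ξ := by
  have hx' : x ∈ Icc (0 : ℝ) 1 := ⟨hξ.trans h.le, hx⟩
  have hξ' : ξ ∈ Icc (0 : ℝ) 1 := ⟨hξ, h.le.trans hx⟩
  have hint : Integrable (fun η => bil (kernVec d₁ d₂ η x) U (kernVec d₁ d₂ η ξ)) unitMeasure := by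
    simp only [bil_eq_sum]
    exact integrable_finsetSum _ fun i _ => integrable_finsetSum _ fun j _ =>
      (integrable_kernVec_mul hx' hξ' i j).const_mul _
  have e : quadKernel U x ξ = bil (pointVec d₁ d₂ x) U (kernVec d₁ d₂ x ξ)
      + bil (kernVec d₁ d₂ ξ x) U (pointVec d₁ d₂ ξ)
      + ∫ η, bil (kernVec d₁ d₂ η x) U (kernVec d₁ d₂ η ξ) ∂unitMeasure := by
    have h3 := integral_sum_sum (fun i j => U i j) (f := fun i j η =>
      kernVec d₁ d₂ η x i * kernVec d₁ d₂ η ξ j) (integrable_kernVec_mul hx' hξ')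
    simp only [bil_eq_sum]
    refine Eq.trans ?_ (congrArg _ h3.symm)
    simp only [← Finset.sum_add_distrib, ← mul_add, quadKernel]
    refine Finset.sum_congr rfl fun i _ => Finset.sum_congr rfl fun j _ => ?_
    ring
  have hii : ∀ a b : ℝ, 0 ≤ a → a ≤ b → b ≤ 1 → IntervalIntegrable
      (fun η => bil (kernVec d₁ d₂ η x) U (kernVec d₁ d₂ η ξ)) volume a b := fun a b h0 h1 h2 => by
    rw [intervalIntegrable_iff_integrableOn_Ioc_of_le h1]
    exact IntegrableOn.mono_set hint (Ioc_subset_Ioc h0 h2)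
  -- Cutting at ξ and x makes the active block constant on each piece: third–third below ξ,
  -- third–second between, second–second above x.
  rw [e, ← intervalIntegral.integral_of_le zero_le_one,
    ← intervalIntegral.integral_add_adjacent_intervals (hii 0 x le_rfl hx'.1 hx)
      (hii x 1 hx'.1 hx le_rfl),
    ← intervalIntegral.integral_add_adjacent_intervals (hii 0 ξ le_rfl hξ hξ'.2)
      (hii ξ x hξ h.le hx)]
  have e1 : bil (pointVec d₁ d₂ x) U (kernVec d₁ d₂ x ξ)
      = bil (monoVec1 d₁ x) (U.submatrix blk1 blk2) (monoVec2 d₂ x ξ) := by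
    rw [kernVec_of_lt h]
    simp [bil_eq_sum, Fintype.sum_sum_type, blk1, blk2, pointVec]
  have e2 : bil (kernVec d₁ d₂ ξ x) U (pointVec d₁ d₂ ξ)
      = bil (monoVec2 d₂ ξ x) (U.submatrix blk3 blk1) (monoVec1 d₁ ξ) := by
    rw [kernVec_of_gt h]
    simp [bil_eq_sum, Fintype.sum_sum_type, blk1, blk3, pointVec]
  have e3 : ∫ η in (0 : ℝ)..ξ, bil (kernVec d₁ d₂ η x) U (kernVec d₁ d₂ η ξ)
      = ∫ η in (0 : ℝ)..ξ, bil (monoVec2 d₂ η x) (U.submatrix blk3 blk3) (monoVec2 d₂ η ξ) :=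
    intervalIntegral.integral_congr_Ioo_of_le hξ fun η hη => by
      rw [kernVec_of_gt hη.2, kernVec_of_gt (hη.2.trans h)]
      simp [bil_eq_sum, Fintype.sum_sum_type, blk3]
  have e4 : ∫ η in ξ..x, bil (kernVec d₁ d₂ η x) U (kernVec d₁ d₂ η ξ)
      = ∫ η in ξ..x, bil (monoVec2 d₂ η x) (U.submatrix blk3 blk2) (monoVec2 d₂ η ξ) :=
    intervalIntegral.integral_congr_Ioo_of_le h.le fun η hη => by
      rw [kernVec_of_gt hη.2, kernVec_of_lt hη.1]
      simp [bil_eq_sum, Fintype.sum_sum_type, blk3, blk2]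
  have e5 : ∫ η in x..(1 : ℝ), bil (kernVec d₁ d₂ η x) U (kernVec d₁ d₂ η ξ)
      = ∫ η in x..(1 : ℝ), bil (monoVec2 d₂ η x) (U.submatrix blk2 blk2) (monoVec2 d₂ η ξ) :=
    intervalIntegral.integral_congr_Ioo_of_le hx fun η hη => by
      rw [kernVec_of_lt hη.1, kernVec_of_lt (h.trans hη.1)]
      simp [bil_eq_sum, Fintype.sum_sum_type, blk2]
  rw [e1, e2, e3, e4, e5, kernOf]
  ring

end Generated

/-- Coercivity of the quadratic form of an operator in the class `Ξ`. -/
lemma InXi.mul_integral_sq_le {d₁ d₂ : ℕ} {ε₁ ε₂ : ℝ} {M : ℝ[X]} {K₁ K₂ : Poly2}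
    (h : InXi d₁ d₂ ε₁ ε₂ M K₁ K₂) (hε : 0 ≤ ε₁) {z : ℝ → ℝ} (hz : MemLp z 2 unitMeasure) :
    ε₁ * ∫ x, z x ^ 2 ∂unitMeasure ≤ ∫ x, z x * semisepOp M K₁ K₂ z x ∂unitMeasure := by
  obtain ⟨U, hU, hpos, -, hM, hK, rfl⟩ := h
  -- The three blocks of A(η) are Z₁(η)z(η), ∫₀^η Z₂(η,x)z(x)dx and ∫_η^1 Z₂(η,x)z(x)dx. The
  -- quadratic form of the operator is ∫ AᵀUA.
  set A : ℝ → BlockIdx d₁ d₂ → ℝ := fun η i =>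
    pointVec d₁ d₂ η i * z η + ∫ x, kernVec d₁ d₂ η x i * z x ∂unitMeasure with hA
  have hAi : ∀ i, MemLp (fun η => A η i) 2 unitMeasure := fun i => by
    have h1 : MemLp (fun η => pointVec d₁ d₂ η i * z η) 2 unitMeasure := by
      obtain ⟨C, hC⟩ := isCompact_Icc.exists_bound_of_continuousOn
        (continuous_pointVec i).continuousOn
      refine MemLp.of_le_mul (c := C) hz
        ((continuous_pointVec i).aestronglyMeasurable.mul hz.1) (ae_unit_of_forall fun ξ hξ => ?_)
      rw [norm_mul]
      exact mul_le_mul_of_nonneg_right (hC ξ hξ) (norm_nonneg _)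
    exact h1.add ((bddKernel_kernVec i).memLp_integral hz)
  have hij : ∀ i j, Integrable (fun η => A η i * A η j) unitMeasure := fun i j =>
    integrable_mul_unit (hAi i) (hAi j)
  have hquad : Integrable (fun η => bil (A η) U (A η)) unitMeasure := by
    simp only [bil_eq_sum]
    exact integrable_finsetSum _ fun i _ => integrable_finsetSum _ fun j _ =>
      (hij i j).const_mul _
  -- pointwise lower bound
  have hlow : ∀ η, ε₁ * z η ^ 2 ≤ bil (A η) U (A η) := fun η => by
    have h0 := hpos.dotProduct_mulVec_nonneg (A η)
    rw [Matrix.sub_mulVec, dotProduct_sub, sub_nonneg] at h0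
    refine le_trans ?_ h0
    have e : star (A η) ⬝ᵥ (Matrix.fromBlocks
        (ε₁ • (1 : Matrix (Fin (d₁ + 1)) (Fin (d₁ + 1)) ℝ)) 0 0 0).mulVec (A η)
        = ∑ i, ε₁ * A η (Sum.inl i) ^ 2 := by
      simp [dotProduct, Fintype.sum_sum_type, Matrix.fromBlocks_mulVec, Matrix.smul_mulVec]
      refine Finset.sum_congr rfl fun i _ => by ring
    rw [e]
    -- The monomial of degree 0 equals 1, so this single entry of the first block already yields
    -- ε₁z².
    have e0 : A η (Sum.inl 0) = z η := by
      simp [hA, pointVec, kernVec, monoVec1]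
    rw [← e0]
    exact Finset.single_le_sum (f := fun i => ε₁ * A η (Sum.inl i) ^ 2)
      (fun i _ => mul_nonneg hε (sq_nonneg _)) (Finset.mem_univ _)
  have h1 : ε₁ * ∫ x, z x ^ 2 ∂unitMeasure ≤ ∫ η, bil (A η) U (A η) ∂unitMeasure := by
    rw [← integral_const_mul]
    exact integral_mono (hz.integrable_sq.const_mul _) hquad hlow
  refine h1.trans_eq ?_
  have hpp : ∀ i j : BlockIdx d₁ d₂, Integrable (fun x =>
      pointVec d₁ d₂ x i * pointVec d₁ d₂ x j * z x ^ 2) unitMeasure := fun i j => by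
    obtain ⟨C, hC⟩ := isCompact_Icc.exists_bound_of_continuousOn (s := Icc (0 : ℝ) 1)
      ((continuous_pointVec i).mul (continuous_pointVec j)).continuousOn
    exact hz.integrable_sq.bdd_mul (c := C) ((continuous_pointVec i).mul
      (continuous_pointVec j)).aestronglyMeasurable (ae_unit_of_forall hC)
  have hHij : ∀ q : BlockIdx d₁ d₂ × BlockIdx d₁ d₂, BddKernel fun x ξ =>
      pointVec d₁ d₂ x q.1 * kernVec d₁ d₂ x ξ q.2 + pointVec d₁ d₂ ξ q.2 * kernVec d₁ d₂ ξ x q.1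
        + ∫ η, kernVec d₁ d₂ η x q.1 * kernVec d₁ d₂ η ξ q.2 ∂unitMeasure := fun q =>
    (((BddKernel.left (continuous_pointVec q.1)).mul (bddKernel_kernVec q.2)).add
      ((BddKernel.right (continuous_pointVec q.2)).mul (bddKernel_kernVec q.1).swap)).add
      ((bddKernel_kernVec q.1).comp (bddKernel_kernVec q.2))
  have h2 : ∫ η, bil (A η) U (A η) ∂unitMeasure
      = (∫ x, multOf d₁ d₂ U x * z x ^ 2 ∂unitMeasure)
        + ∫ x, z x * (∫ ξ, quadKernel U x ξ * z ξ ∂unitMeasure) ∂unitMeasure := by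
    have e1 : ∀ x, multOf d₁ d₂ U x * z x ^ 2
        = ∑ i, ∑ j, U i j * (pointVec d₁ d₂ x i * pointVec d₁ d₂ x j * z x ^ 2) := fun x => by
      simp only [← mul_assoc, ← Finset.sum_mul]
      congr 1
      simp [multOf, bil_eq_sum, Fintype.sum_sum_type, pointVec, blk1, mul_assoc]
    have e2 : ∀ x ξ, quadKernel U x ξ = ∑ q : BlockIdx d₁ d₂ × BlockIdx d₁ d₂, U q.1 q.2 *
        (pointVec d₁ d₂ x q.1 * kernVec d₁ d₂ x ξ q.2 + pointVec d₁ d₂ ξ q.2 * kernVec d₁ d₂ ξ x q.1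
        + ∫ η, kernVec d₁ d₂ η x q.1 * kernVec d₁ d₂ η ξ q.2 ∂unitMeasure) := fun x ξ => by
      rw [quadKernel, Fintype.sum_prod_type]
    have i1 := integral_sum_sum (fun i j => U i j) (f := fun i j η => A η i * A η j) hij
    have i2 := integral_sum_sum (fun i j => U i j) (f := fun i j x =>
      pointVec d₁ d₂ x i * pointVec d₁ d₂ x j * z x ^ 2) hpp
    simp only [e1, e2, bil_eq_sum]
    rw [BddKernel.quad_sum _ _ hHij hz, Fintype.sum_prod_type]
    refine i1.trans (Eq.trans ?_ (congrArg (· + _) i2.symm))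
    simp only [← Finset.sum_add_distrib, ← mul_add]
    refine Finset.sum_congr rfl fun i _ => Finset.sum_congr rfl fun j _ => ?_
    congr 1
    exact integral_mul_affine (continuous_pointVec i) (continuous_pointVec j)
      (bddKernel_kernVec i) (bddKernel_kernVec j) hz
  rw [h2]
  have hk := bddKernel_semisepKernel K₁ (swap2 K₁)
  have e3 : ∀ x, z x * semisepOp M K₁ (swap2 K₁) z x = z x * (M.eval x * z x)
      + z x * ∫ ξ, semisepKernel K₁ (swap2 K₁) x ξ * z ξ ∂unitMeasure := fun x => by
    rw [semisepOp_eq, mul_add]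
  simp only [e3]
  rw [integral_add (integrable_mul_unit hz (memLp_polynomial_mul M hz))
    (hk.integrable_quad hz hz)]
  congr 1
  · refine integral_unit_congr fun x hx => ?_
    simp only [hM x hx]; ring
  · refine integral_unit_congr fun x hx => ?_
    congr 1
    refine integral_congr_ae ?_
    have hne : ∀ᵐ ξ ∂unitMeasure, ξ ≠ x := Measure.ae_ne _ x
    filter_upwards [hne, ae_unit_of_forall (p := fun ξ => ξ ∈ Icc (0 : ℝ) 1) fun ξ hξ => hξ]
      with ξ hξ hξ'
    congr 1
    rcases lt_or_gt_of_ne hξ with hlt | hlt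
    · rw [quadKernel_eq_kernOf U hξ'.1 hlt hx.2, semisepKernel, if_pos hlt.le, hK x hx ξ hξ']
    · rw [quadKernel_comm U hU, quadKernel_eq_kernOf U hx.1 hlt hξ'.2, semisepKernel,
        if_neg (not_le.2 hlt), ev2_swap2, hK ξ hξ' x hx]

/-- Pointwise positivity of the multiplier. -/
lemma InXi.le_eval {d₁ d₂ : ℕ} {ε₁ ε₂ : ℝ} {M : ℝ[X]} {K₁ K₂ : Poly2}
    (h : InXi d₁ d₂ ε₁ ε₂ M K₁ K₂) (hε : 0 ≤ ε₁) {x : ℝ} (hx : x ∈ Icc (0 : ℝ) 1) :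
    ε₁ ≤ M.eval x := by
  obtain ⟨U, hU, hpos, -, hM, hK, rfl⟩ := h
  rw [hM x hx]
  have h0 := hpos.dotProduct_mulVec_nonneg (pointVec d₁ d₂ x)
  rw [Matrix.sub_mulVec, dotProduct_sub, sub_nonneg] at h0
  have e : star (pointVec d₁ d₂ x) ⬝ᵥ (Matrix.fromBlocks
      (ε₁ • (1 : Matrix (Fin (d₁ + 1)) (Fin (d₁ + 1)) ℝ)) 0 0 0).mulVec (pointVec d₁ d₂ x)
      = ∑ i, ε₁ * (monoVec1 d₁ x i) ^ 2 := by
    simp [dotProduct, Fintype.sum_sum_type, Matrix.fromBlocks_mulVec, Matrix.smul_mulVec, pointVec]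
    refine Finset.sum_congr rfl fun i _ => by ring
  have e' : multOf d₁ d₂ U x = star (pointVec d₁ d₂ x) ⬝ᵥ U.mulVec (pointVec d₁ d₂ x) := by
    change _ = bil (pointVec d₁ d₂ x) U (pointVec d₁ d₂ x)
    simp [multOf, bil_eq_sum, Fintype.sum_sum_type, pointVec, blk1]
  rw [e']
  refine le_trans ?_ (e ▸ h0)
  have := Finset.single_le_sum (f := fun i : Fin (d₁ + 1) => ε₁ * monoVec1 d₁ x i ^ 2)
      (fun i _ => mul_nonneg hε (sq_nonneg _)) (Finset.mem_univ 0)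
  simpa [monoVec1] using this

/-! ### Bounded invertibility -/

lemma semisepOp_congr_ae (M : ℝ[X]) (K₁ K₂ : Poly2) {y z : ℝ → ℝ} (h : y =ᵐ[unitMeasure] z) :
    semisepOp M K₁ K₂ y =ᵐ[unitMeasure] semisepOp M K₁ K₂ z := by
  filter_upwards [h] with x hx
  rw [semisepOp_eq, semisepOp_eq, hx]
  congr 1
  exact integral_congr_ae (by filter_upwards [h] with ξ hξ; rw [hξ])

lemma norm_sq_toLp {f : ℝ → ℝ} (hf : MemLp f 2 unitMeasure) :
    ‖hf.toLp f‖ ^ 2 = ∫ x, f x ^ 2 ∂unitMeasure := by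
  rw [← real_inner_self_eq_norm_sq, L2.inner_def]
  refine integral_congr_ae ?_
  filter_upwards [hf.coeFn_toLp] with x hx
  rw [hx]
  simp [sq]

lemma norm_sq_Lp (u : Lp ℝ 2 unitMeasure) : ‖u‖ ^ 2 = ∫ x, u x ^ 2 ∂unitMeasure := by
  conv_lhs => rw [← Lp.toLp_coeFn u (Lp.memLp u)]
  exact norm_sq_toLp _

/-- The operator `𝒫` on `L²(0,1)`. -/
noncomputable def semisepLp (M : ℝ[X]) (K₁ K₂ : Poly2) :
    Lp ℝ 2 unitMeasure →ₗ[ℝ] Lp ℝ 2 unitMeasure where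
  toFun u := (memLp_semisepOp M K₁ K₂ (Lp.memLp u)).toLp _
  map_add' u v := by
    rw [← MemLp.toLp_add, MemLp.toLp_eq_toLp_iff]
    refine (semisepOp_congr_ae M K₁ K₂ (Lp.coeFn_add u v)).trans ?_
    exact ae_unit_of_forall fun x hx => semisepOp_add M K₁ K₂
      (integrable_unit_of_memLp (Lp.memLp u)) (integrable_unit_of_memLp (Lp.memLp v)) hx
  map_smul' r u := by
    rw [RingHom.id_apply, ← MemLp.toLp_const_smul, MemLp.toLp_eq_toLp_iff]
    refine (semisepOp_congr_ae M K₁ K₂ (Lp.coeFn_smul r u)).trans ?_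
    exact ae_unit_of_forall fun x hx => semisepOp_smul M K₁ K₂ r u x

/-- Lax–Milgram: the bounded bilinear form induced by the operator is coercive with constant ε₁. -/
lemma exists_memLp_semisepOp_eq {d₁ d₂ : ℕ} {ε₁ ε₂ : ℝ} {M : ℝ[X]} {K₁ K₂ : Poly2}
    (h : InXi d₁ d₂ ε₁ ε₂ M K₁ K₂) (hε : 0 < ε₁) {v : ℝ → ℝ} (hv : MemLp v 2 unitMeasure) :
    ∃ z, MemLp z 2 unitMeasure ∧ semisepOp M K₁ K₂ z =ᵐ[unitMeasure] v := by
  obtain ⟨C, hC0, hC⟩ := exists_integral_semisepOp_sq_le M K₁ K₂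
  have hb : ∀ u, ‖semisepLp M K₁ K₂ u‖ ≤ √C * ‖u‖ := fun u => by
    refine abs_le_of_sq_le_sq' ?_ (by positivity) |>.2
    rw [mul_pow, Real.sq_sqrt hC0.le, norm_sq_Lp u]
    exact (norm_sq_toLp (memLp_semisepOp M K₁ K₂ (Lp.memLp u))).trans_le (hC u (Lp.memLp u))
  let A := (semisepLp M K₁ K₂).mkContinuous _ hb
  let B : Lp ℝ 2 unitMeasure →L[ℝ] Lp ℝ 2 unitMeasure →L[ℝ] ℝ :=
    (innerSL ℝ : Lp ℝ 2 unitMeasure →L[ℝ] Lp ℝ 2 unitMeasure →L[ℝ] ℝ).comp A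
  have hco : IsCoercive B := by
    refine ⟨ε₁, hε, fun u => ?_⟩
    have h1 := h.mul_integral_sq_le hε.le (Lp.memLp u)
    rw [← norm_sq_Lp] at h1
    have h2 : B u u = ∫ x, u x * semisepOp M K₁ K₂ u x ∂unitMeasure := by
      change inner ℝ (semisepLp M K₁ K₂ u) u = _
      rw [L2.inner_def]
      refine integral_congr_ae ?_
      filter_upwards [(memLp_semisepOp M K₁ K₂ (Lp.memLp u)).coeFn_toLp] with x hx
      change inner ℝ ((memLp_semisepOp M K₁ K₂ (Lp.memLp u)).toLp _ x) (u x) = _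
      rw [hx]
      simp
    rw [h2]
    nlinarith
  have hA : ∀ u, hco.continuousLinearEquivOfBilin u = A u := fun u =>
    (hco.unique_continuousLinearEquivOfBilin (fun w => rfl)).symm
  obtain ⟨u, hu⟩ := hco.continuousLinearEquivOfBilin.surjective (hv.toLp v)
  rw [hA] at hu
  exact ⟨u, Lp.memLp u, (MemLp.toLp_eq_toLp_iff (memLp_semisepOp M K₁ K₂ (Lp.memLp u)) hv).1 hu⟩

/-- With swapped kernels the glued kernel is K(max(x,ξ), min(x,ξ)), continuous even on the diagonal,
so dominated convergence applies for z merely in L². -/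
lemma continuousOn_integral_semisepKernel (K : Poly2) {z : ℝ → ℝ} (hz : MemLp z 2 unitMeasure) :
    ContinuousOn (fun x => ∫ ξ, semisepKernel K (swap2 K) x ξ * z ξ ∂unitMeasure) (Icc 0 1) := by
  have hk : Continuous fun p : ℝ × ℝ => semisepKernel K (swap2 K) p.1 p.2 := by
    have e : (fun p : ℝ × ℝ => semisepKernel K (swap2 K) p.1 p.2)
        = fun p => ev2 K (max p.1 p.2) (min p.1 p.2) := by
      funext p
      simp only [semisepKernel, ev2_swap2]
      split_ifs with hp
      · rw [max_eq_left hp, min_eq_right hp]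
      · rw [max_eq_right (not_le.1 hp).le, min_eq_left (not_le.1 hp).le]
    have hm : Continuous fun p : ℝ × ℝ => (max p.1 p.2, min p.1 p.2) := by fun_prop
    have h := (continuous_ev2 K).comp hm
    rw [e]
    exact h
  have hz1 := integrable_unit_of_memLp hz
  obtain ⟨C, hC⟩ := (bddKernel_semisepKernel K (swap2 K)).bdd
  refine continuousOn_of_dominated (bound := fun ξ => C * |z ξ|) ?_ ?_ (hz1.abs.const_mul C) ?_
  · exact fun x hx => ((bddKernel_semisepKernel K (swap2 K)).integrable_mul hx hz1).1
  · refine fun x hx => ae_unit_of_forall fun ξ hξ => ?_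
    rw [norm_mul]
    exact mul_le_mul_of_nonneg_right (hC x hx ξ hξ) (abs_nonneg _)
  · exact ae_of_all _ fun ξ => ((hk.comp (Continuous.prodMk_left ξ)).mul
      continuous_const).continuousOn

lemma InXi.eq_swap2 {d₁ d₂ : ℕ} {ε₁ ε₂ : ℝ} {M : ℝ[X]} {K₁ K₂ : Poly2}
    (h : InXi d₁ d₂ ε₁ ε₂ M K₁ K₂) : K₂ = swap2 K₁ := by
  obtain ⟨U, -, -, -, -, -, h⟩ := h
  exact h

/-- `𝒫⁻¹` maps continuous functions to continuous functions. -/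
lemma InXi.semisepInv_spec {d₁ d₂ : ℕ} {ε₁ ε₂ : ℝ} {M : ℝ[X]} {K₁ K₂ : Poly2}
    (h : InXi d₁ d₂ ε₁ ε₂ M K₁ K₂) (hε : 0 < ε₁) {v : ℝ → ℝ} (hv : ContinuousOn v (Icc 0 1)) :
    ContinuousOn (semisepInv M K₁ K₂ v) (Icc 0 1) ∧
      ∀ x ∈ Icc (0 : ℝ) 1, semisepOp M K₁ K₂ (semisepInv M K₁ K₂ v) x = v x := by
  refine Classical.epsilon_spec (p := fun z : ℝ → ℝ =>
    ContinuousOn z (Icc 0 1) ∧ ∀ x ∈ Icc (0 : ℝ) 1, semisepOp M K₁ K₂ z x = v x) ?_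
  obtain ⟨z, hz, hzv⟩ := exists_memLp_semisepOp_eq h hε (memLp_unit_of_continuousOn hv)
  have hM : ∀ x ∈ Icc (0 : ℝ) 1, M.eval x ≠ 0 := fun x hx => (hε.trans_le (h.le_eval hε.le hx)).ne'
  -- The L² solution is solved for its multiplier term, which is possible because M ≥ ε₁ pointwise.
  -- The result agrees with z almost everywhere, so the integral is unchanged and the equation holds
  -- at every point.
  refine ⟨fun x => (v x - ∫ ξ, semisepKernel K₁ K₂ x ξ * z ξ ∂unitMeasure) / M.eval x,
    ContinuousOn.div (hv.sub ?_) (by fun_prop) hM, fun x hx => ?_⟩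
  · rw [h.eq_swap2]
    exact continuousOn_integral_semisepKernel K₁ hz
  · have e : (fun x => (v x - ∫ ξ, semisepKernel K₁ K₂ x ξ * z ξ ∂unitMeasure) / M.eval x)
        =ᵐ[unitMeasure] z := by
      filter_upwards [hzv, ae_unit_of_forall hM] with x hx hx'
      rw [← hx, semisepOp_eq, add_sub_cancel_right, mul_div_cancel_left₀ _ hx']
    rw [semisepOp_eq]
    have e2 : ∫ ξ, semisepKernel K₁ K₂ x ξ * ((v ξ
        - ∫ η, semisepKernel K₁ K₂ ξ η * z η ∂unitMeasure) / M.eval ξ) ∂unitMeasure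
        = ∫ ξ, semisepKernel K₁ K₂ x ξ * z ξ ∂unitMeasure :=
      integral_congr_ae (by filter_upwards [e] with ξ hξ; rw [hξ])
    rw [e2, mul_div_cancel₀ _ (hM x hx)]
    ring

/-! ### Wirtinger's inequality -/

/-- Wirtinger's inequality on `(0,1)` for functions vanishing at `0`. -/
lemma wirtinger {y y' : ℝ → ℝ} (hy : ∀ x, HasDerivAt y (y' x) x) (hy' : Continuous y')
    (h0 : y 0 = 0) :
    Real.pi ^ 2 / 4 * ∫ x in (0 : ℝ)..1, y x ^ 2 ≤ ∫ x in (0 : ℝ)..1, y' x ^ 2 := by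
  have hyc : Continuous y := continuous_iff_continuousAt.2 fun x => (hy x).continuousAt
  -- Complete the square with the Riccati function k·tan(k(1−x)): the difference of the two
  -- integrands is (y′ − k·tan(k(1−x))y)² plus an exact derivative. Its primitive vanishes at 0
  -- because y(0) = 0 and at 1 because tan 0 = 0. At k = π/2 the tangent would be singular at x = 0,
  -- hence the strict bound and a final limit.
  have key : ∀ k : ℝ, 0 < k → k < Real.pi / 2 →
      k ^ 2 * ∫ x in (0 : ℝ)..1, y x ^ 2 ≤ ∫ x in (0 : ℝ)..1, y' x ^ 2 := by
    intro k hk hk2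
    have hcos : ∀ x ∈ Icc (0 : ℝ) 1, Real.cos (k * (1 - x)) ≠ 0 := fun x hx =>
      (Real.cos_pos_of_mem_Ioo ⟨by nlinarith [hx.1, hx.2, Real.pi_pos],
        by nlinarith [hx.1, hx.2, Real.pi_pos]⟩).ne'
    have hG : ∀ x ∈ uIcc (0 : ℝ) 1, HasDerivAt (fun x => k * Real.tan (k * (1 - x)) * y x ^ 2)
        (-(k ^ 2 * (1 + Real.tan (k * (1 - x)) ^ 2)) * y x ^ 2
          + 2 * k * Real.tan (k * (1 - x)) * y x * y' x) x := fun x hx => by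
      rw [uIcc_of_le zero_le_one] at hx
      have h1 : HasDerivAt (fun x : ℝ => k * (1 - x)) (-k) x :=
        (((hasDerivAt_id x).const_sub 1).const_mul k).congr_deriv (by ring)
      have h2 := (Real.hasDerivAt_tan (hcos x hx)).comp x h1
      refine ((h2.const_mul k).mul ((hy x).pow 2)).congr_deriv ?_
      have h3 : 1 / Real.cos (k * (1 - x)) ^ 2 = 1 + Real.tan (k * (1 - x)) ^ 2 := by
        rw [Real.tan_eq_sin_div_cos]
        have := hcos x hx
        have := Real.sin_sq_add_cos_sq (k * (1 - x))
        field_simp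
        linarith
      simp only [h3, Function.comp_apply, Pi.pow_apply]
      push_cast
      ring
    have htan : ContinuousOn (fun x => Real.tan (k * (1 - x))) (uIcc 0 1) := fun x hx => by
      rw [uIcc_of_le zero_le_one] at hx
      exact ((Real.continuousAt_tan.2 (hcos x hx)).comp
        (f := fun x : ℝ => k * (1 - x)) (by fun_prop)).continuousWithinAt
    have hGi : IntervalIntegrable (fun x => -(k ^ 2 * (1 + Real.tan (k * (1 - x)) ^ 2)) * y x ^ 2
          + 2 * k * Real.tan (k * (1 - x)) * y x * y' x) volume 0 1 :=
      ContinuousOn.intervalIntegrable (by fun_prop)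
    have hF := intervalIntegral.integral_eq_sub_of_hasDerivAt hG hGi
    simp only [h0, sub_self, mul_zero, Real.tan_zero] at hF
    have i1 : IntervalIntegrable (fun x => y' x ^ 2) volume 0 1 :=
      Continuous.intervalIntegrable (by fun_prop) _ _
    have i2 : IntervalIntegrable (fun x => k ^ 2 * y x ^ 2) volume 0 1 :=
      Continuous.intervalIntegrable (by fun_prop) _ _
    have hnn : 0 ≤ ∫ x in (0 : ℝ)..1, (y' x - k * Real.tan (k * (1 - x)) * y x) ^ 2 :=
      intervalIntegral.integral_nonneg zero_le_one fun x _ => sq_nonneg _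
    have e : ∀ x, (y' x - k * Real.tan (k * (1 - x)) * y x) ^ 2
        = (y' x ^ 2 - k ^ 2 * y x ^ 2) - (-(k ^ 2 * (1 + Real.tan (k * (1 - x)) ^ 2)) * y x ^ 2
          + 2 * k * Real.tan (k * (1 - x)) * y x * y' x) := fun x => by ring
    simp only [e] at hnn
    rw [intervalIntegral.integral_sub (i1.sub i2) hGi, hF, intervalIntegral.integral_sub i1 i2,
      intervalIntegral.integral_const_mul] at hnn
    linarith
  have hl : Tendsto (fun k : ℝ => k ^ 2 * ∫ x in (0 : ℝ)..1, y x ^ 2) (𝓝[<] (Real.pi / 2))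
      (𝓝 ((Real.pi / 2) ^ 2 * ∫ x in (0 : ℝ)..1, y x ^ 2)) :=
    (Continuous.tendsto (by fun_prop) _).mono_left nhdsWithin_le_nhds
  have := le_of_tendsto hl (by
    filter_upwards [Ioo_mem_nhdsLT (show (0 : ℝ) < Real.pi / 2 by positivity)] with k hk
    exact key k hk.1 hk.2)
  linarith [this]

/-- Wirtinger applied to e − e(0), with the square expanded so that its three pieces can meet the
three π² corrections separately. -/
lemma wirtinger_unit {e e' : ℝ → ℝ} (he : ∀ x, HasDerivAt e (e' x) x) (he' : Continuous e') :
    Real.pi ^ 2 / 4 * ((∫ x, e x ^ 2 ∂unitMeasure) - 2 * e 0 * (∫ x, e x ∂unitMeasure) + e 0 ^ 2)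
      ≤ ∫ x, e' x ^ 2 ∂unitMeasure := by
  have hc : Continuous e := continuous_iff_continuousAt.2 fun x => (he x).continuousAt
  have h := wirtinger (y := fun x => e x - e 0) (fun x => (he x).sub_const _) he' (sub_self _)
  simp only [intervalIntegral.integral_of_le zero_le_one] at h
  refine le_trans (le_of_eq ?_) h
  congr 1
  have h1 : Integrable e unitMeasure := integrable_unit_of_continuousOn hc.continuousOn
  have h2 : Integrable (fun x => e x ^ 2) unitMeasure :=
    integrable_unit_of_continuousOn (hc.pow 2).continuousOn
  have e1 : ∀ x, (e x - e 0) ^ 2 = (e x ^ 2 - 2 * e 0 * e x) + e 0 ^ 2 := fun x => by ring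
  have i1 : Integrable (fun x => 2 * e 0 * e x) unitMeasure := h1.const_mul _
  have i2 : Integrable (fun x => e x ^ 2 - 2 * e 0 * e x) unitMeasure := h2.sub i1
  simp only [e1]
  rw [integral_add i2 (integrable_const _), integral_sub h2 i1, integral_const_mul]
  simp

/-! ### The two dissipation inequalities -/

lemma continuous_ev2_diag (K : Poly2) : Continuous fun x => ev2 K x x := by
  simp only [← eval_diag2]
  fun_prop

lemma volt_zero (K₁ K₂ : Poly2) (z : ℝ → ℝ) :
    volt K₁ K₂ z 0 = ∫ ξ, ev2 K₂ 0 ξ * z ξ ∂unitMeasure := by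
  simp [volt, intervalIntegral.integral_of_le]

lemma volt_one (K₁ K₂ : Poly2) (z : ℝ → ℝ) :
    volt K₁ K₂ z 1 = ∫ ξ, ev2 K₁ 1 ξ * z ξ ∂unitMeasure := by
  simp [volt, intervalIntegral.integral_of_le]

/-- The consequence of a negativity constraint `{-T₀ - 2δM, …} ∈ Ξ`. -/
lemma InXi.integral_add_le {d₁ d₂ : ℕ} {β δ : ℝ} {T₀ M : ℝ[X]} {T₁ T₂ K₁ K₂ : Poly2}
    (h : InXi d₁ d₂ 0 β (-T₀ - (2 * δ) • M) (-T₁ - (2 * δ) • K₁) (-T₂ - (2 * δ) • K₂))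
    {z : ℝ → ℝ} (hz : Continuous z) :
    (∫ x, T₀.eval x * z x ^ 2 ∂unitMeasure) + ∫ x, z x * volt T₁ T₂ z x ∂unitMeasure
      ≤ -(2 * δ) * ∫ x, z x * semisepOp M K₁ K₂ z x ∂unitMeasure := by
  have h1 := h.mul_integral_sq_le le_rfl (memLp_unit_of_continuousOn hz.continuousOn)
  have e : ∫ x, z x * semisepOp (-T₀ - (2 * δ) • M) (-T₁ - (2 * δ) • K₁) (-T₂ - (2 * δ) • K₂) z x
      ∂unitMeasure = ∫ x, (-(T₀.eval x * z x ^ 2) - z x * volt T₁ T₂ z x)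
        - 2 * δ * (z x * (M.eval x * z x + volt K₁ K₂ z x)) ∂unitMeasure :=
    integral_unit_congr fun x hx => by
      simp only [semisepOp_eq_volt _ _ _ hz hx, volt_sub _ _ _ _ hz, volt_neg, volt_smul,
        Polynomial.eval_sub, Polynomial.eval_neg, Polynomial.eval_smul, smul_eq_mul]
      ring
  have e' : ∫ x, z x * semisepOp M K₁ K₂ z x ∂unitMeasure
      = ∫ x, z x * (M.eval x * z x + volt K₁ K₂ z x) ∂unitMeasure :=
    integral_unit_congr fun x hx => by simp only [semisepOp_eq_volt _ _ _ hz hx]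
  have v1 := continuous_volt T₁ T₂ hz
  have v2 := continuous_volt K₁ K₂ hz
  have i1 : Integrable (fun x => T₀.eval x * z x ^ 2) unitMeasure :=
    integrable_unit_of_continuousOn (by fun_prop)
  have i2 : Integrable (fun x => z x * volt T₁ T₂ z x) unitMeasure :=
    integrable_unit_of_continuousOn (by fun_prop)
  have i3 : Integrable (fun x => 2 * δ * (z x * (M.eval x * z x + volt K₁ K₂ z x))) unitMeasure :=
    integrable_unit_of_continuousOn (by fun_prop)
  have i4 : Integrable (fun x => -(T₀.eval x * z x ^ 2) - z x * volt T₁ T₂ z x) unitMeasure :=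
    i1.neg.sub i2
  have i5 : Integrable (fun x => -(T₀.eval x * z x ^ 2)) unitMeasure := i1.neg
  rw [e, integral_sub i4 i3, integral_sub i5 i2, integral_neg, integral_const_mul] at h1
  rw [e']
  linarith

lemma integral_unit_deriv {F F' : ℝ → ℝ} (h : ∀ x, HasDerivAt F (F' x) x) (hc : Continuous F') :
    ∫ x, F' x ∂unitMeasure = F 1 - F 0 := by
  rw [← intervalIntegral.integral_of_le zero_le_one]
  exact intervalIntegral.integral_eq_sub_of_hasDerivAt (fun x _ => h x) (hc.intervalIntegrable _ _)

lemma mul_wirtinger_le {p e e' : ℝ → ℝ} {κ : ℝ} (hκ : 0 ≤ κ) (hp : Continuous p)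
    (hpκ : ∀ x ∈ Icc (0 : ℝ) 1, κ ≤ p x) (he : ∀ x, HasDerivAt e (e' x) x) (he' : Continuous e') :
    Real.pi ^ 2 / 2 * κ * ((∫ x, e x ^ 2 ∂unitMeasure) - 2 * e 0 * (∫ x, e x ∂unitMeasure)
      + e 0 ^ 2) ≤ ∫ x, 2 * p x * e' x ^ 2 ∂unitMeasure := by
  have h1 := mul_le_mul_of_nonneg_left (wirtinger_unit he he') (by positivity : 0 ≤ 2 * κ)
  have h2 : 2 * κ * ∫ x, e' x ^ 2 ∂unitMeasure ≤ ∫ x, 2 * p x * e' x ^ 2 ∂unitMeasure := by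
    rw [← integral_const_mul]
    refine integral_mono_ae (integrable_unit_of_continuousOn (by fun_prop))
      (integrable_unit_of_continuousOn (by fun_prop)) (ae_unit_of_forall fun x hx => ?_)
    have := hpκ x hx
    simp only
    nlinarith [sq_nonneg (e' x)]
  linarith

section Dissipation

variable {a b c : ℝ[X]} {α : ℝ} {d₁ d₂ : ℕ} {ε₁ β δ : ℝ}

set_option maxHeartbeats 1000000 in
-- Integration by parts, Wirtinger for the gradient term, and the Ξ constraint for the remaining
-- form. The value e(1) is left free; the surviving terms at 1 are exactly those that the observer
-- gains must handle.
lemma primal_dissipation (hα : 0 < α) (ha : ∀ x ∈ Icc (0 : ℝ) 1, α ≤ a.eval x) (hε₁ : 0 < ε₁)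
    {N : ℝ[X]} {P₁ P₂ : Poly2} (hP : P₂ = swap2 P₁) (hN : ∀ x ∈ Icc (0 : ℝ) 1, ε₁ ≤ N.eval x)
    {Q : PrimalData} (hQdef : Q = primalMap a b c α ε₁ N P₁ P₂)
    (hQ : InXi d₁ d₂ 0 β
      (-Q.Q0 - (2 * δ) • N) (-Q.Q1 - (2 * δ) • P₁) (-Q.Q2 - (2 * δ) • P₂))
    (hQ3 : Q.Q3 ≤ 0) (hQ4 : Q.Q4 = 0) {e e1 e2 : ℝ → ℝ} (he : ∀ x, HasDerivAt e (e1 x) x)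
    (he1 : ∀ x, HasDerivAt e1 (e2 x) x) (he2 : Continuous e2) (h0 : e1 0 = 0) :
    2 * ∫ x, (a.eval x * e2 x + b.eval x * e1 x + c.eval x * e x) * semisepOp N P₁ P₂ e x
        ∂unitMeasure
      ≤ -(2 * δ) * (∫ x, e x * semisepOp N P₁ P₂ e x ∂unitMeasure)
        + Q.Q5 * e 1 ^ 2 + Q.Q7 * (e 1 * e1 1)
        + e 1 * (∫ x, Q.Q6.eval x * e x ∂unitMeasure)
        + e1 1 * ∫ x, Q.Q8.eval x * e x ∂unitMeasure := by
  have hc0 : Continuous e := continuous_iff_continuousAt.2 fun x => (he x).continuousAt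
  have hc1 : Continuous e1 := continuous_iff_continuousAt.2 fun x => (he1 x).continuousAt
  set g := volt P₁ P₂ e with hg
  set L₁ : Poly2 := dX (inX a * P₁) - inX b * P₁ with hL₁
  set L₂ : Poly2 := dX (inX a * P₂) - inX b * P₂ with hL₂
  set m := volt L₁ L₂ e with hm
  set J₁ : Poly2 := dX L₁ + inX c * P₁ with hJ₁
  set J₂ : Poly2 := dX L₂ + inX c * P₂ with hJ₂
  have hdiag : ∀ x, ev2 P₁ x x = ev2 P₂ x x := fun x => by rw [hP, ev2_swap2]
  have hgc : Continuous g := continuous_volt _ _ hc0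
  have hmc : Continuous m := continuous_volt _ _ hc0
  have hJc : Continuous (volt J₁ J₂ e) := continuous_volt _ _ hc0
  -- Here m = (ag)′ − bg, the flux of the formal adjoint of A acting on the integral part of 𝒮e. The
  -- jump vanishes because P₁ and P₂ agree on the diagonal.
  have hag : ∀ x, HasDerivAt (fun x => a.eval x * g x) (m x + b.eval x * g x) x := fun x => by
    have h := hasDerivAt_volt (inX a * P₁) (inX a * P₂) hc0 x
    have e3 : volt (inX a * P₁) (inX a * P₂) e = fun x => a.eval x * g x :=
      funext fun x => volt_inX_mul a P₁ P₂ e x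
    rw [e3] at h
    refine h.congr_deriv ?_
    rw [hm, hL₁, hL₂, volt_sub _ _ _ _ hc0, volt_inX_mul]
    simp only [ev2_sub, ev2_mul, ev2_inX, hdiag x, hg]
    ring
  set D : ℝ → ℝ := fun x => ev2 (dX (inX a * (P₁ - P₂))) x x with hD
  have hDc : Continuous D := continuous_ev2_diag _
  have hm' : ∀ x, HasDerivAt m (volt J₁ J₂ e x + D x * e x - c.eval x * g x) x := fun x => by
    refine (hasDerivAt_volt L₁ L₂ hc0 x).congr_deriv ?_
    rw [hJ₁, hJ₂, volt_add _ _ _ _ hc0, volt_inX_mul, hD, hL₁, hL₂]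
    simp only [ev2_sub, mul_sub, dX_sub, ev2_mul, hdiag x]
    ring
  -- B collects all boundary terms of the integrations by parts, so the whole computation becomes
  -- the pointwise identity B′ followed by one integration.
  set B : ℝ → ℝ := fun x => 2 * (a * N).eval x * (e x * e1 x) - (a * N).derivative.eval x * e x ^ 2
    + (b * N).eval x * e x ^ 2 + 2 * (e1 x * (a.eval x * g x)) - 2 * (e x * m x) with hB
  set B' : ℝ → ℝ := fun x => 2 * ((a.eval x * e2 x + b.eval x * e1 x + c.eval x * e x)
      * (N.eval x * e x + g x)) + 2 * (a * N).eval x * e1 x ^ 2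
    - (Q.Q0.eval x + Real.pi ^ 2 / 2 * α * ε₁) * e x ^ 2 - 2 * (e x * volt J₁ J₂ e x) with hB'
  have hBd : ∀ x, HasDerivAt B (B' x) x := fun x => by
    have d1 := (((a * N).hasDerivAt x).const_mul 2).mul ((he x).mul (he1 x))
    have d2 := ((a * N).derivative.hasDerivAt x).mul ((he x).pow 2)
    have d3 := ((b * N).hasDerivAt x).mul ((he x).pow 2)
    have d4 := ((he1 x).mul (hag x)).const_mul 2
    have d5 := ((he x).mul (hm' x)).const_mul 2
    refine ((((d1.sub d2).add d3).add d4).sub d5).congr_deriv ?_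
    simp only [hB', hQdef, primalMap, hD, Polynomial.eval_add, Polynomial.eval_sub,
      Polynomial.eval_mul, Polynomial.derivative_mul, Polynomial.derivative_add,
      Polynomial.derivative_sub, eval_diag2, Polynomial.eval_C, Polynomial.eval_ofNat,
      Pi.mul_apply, Pi.pow_apply]
    push_cast
    ring
  have hB'c : Continuous B' := by fun_prop
  have hint := integral_unit_deriv hBd hB'c
  have i1 : Integrable (fun x => 2 * ((a.eval x * e2 x + b.eval x * e1 x + c.eval x * e x)
      * (N.eval x * e x + g x))) unitMeasure := integrable_unit_of_continuousOn (by fun_prop)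
  have i2 : Integrable (fun x => 2 * (a * N).eval x * e1 x ^ 2) unitMeasure :=
    integrable_unit_of_continuousOn (by fun_prop)
  have i3 : Integrable (fun x => (Q.Q0.eval x + Real.pi ^ 2 / 2 * α * ε₁) * e x ^ 2)
    unitMeasure := integrable_unit_of_continuousOn (by fun_prop)
  have i4 : Integrable (fun x => 2 * (e x * volt J₁ J₂ e x)) unitMeasure :=
    integrable_unit_of_continuousOn (by fun_prop)
  have i12 : Integrable (fun x => 2 * ((a.eval x * e2 x + b.eval x * e1 x + c.eval x * e x)
      * (N.eval x * e x + g x)) + 2 * (a * N).eval x * e1 x ^ 2) unitMeasure := i1.add i2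
  have i123 : Integrable (fun x => 2 * ((a.eval x * e2 x + b.eval x * e1 x + c.eval x * e x)
      * (N.eval x * e x + g x)) + 2 * (a * N).eval x * e1 x ^ 2
      - (Q.Q0.eval x + Real.pi ^ 2 / 2 * α * ε₁) * e x ^ 2) unitMeasure := i12.sub i3
  rw [hB', integral_sub i123 i4, integral_sub i12 i3, integral_add i1 i2, integral_const_mul,
    integral_const_mul (2 : ℝ) (fun x => e x * volt J₁ J₂ e x),
    two_mul_integral_mul_volt _ _ hc0] at hint
  have hQ1 : Q.Q1 = J₁ + swap2 J₂ := by
    rw [hQdef, hJ₁, hJ₂, hL₁, hL₂, hP]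
    simp only [primalMap, swap2_add, swap2_dX, swap2_sub, swap2_mul, swap2_inX, swap2_swap2]
    ring
  have hQ2 : Q.Q2 = swap2 (J₁ + swap2 J₂) := by
    rw [← hQ1, hQdef]; rfl
  have hneg := hQ.integral_add_le hc0
  rw [← hQ2, ← hQ1] at hint
  have i5 : Integrable (fun x => Q.Q0.eval x * e x ^ 2) unitMeasure :=
    integrable_unit_of_continuousOn (by fun_prop)
  have i6 : Integrable (fun x => Real.pi ^ 2 / 2 * α * ε₁ * e x ^ 2) unitMeasure :=
    integrable_unit_of_continuousOn (by fun_prop)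
  simp only [add_mul (Polynomial.eval _ _) (Real.pi ^ 2 / 2 * α * ε₁)] at hint
  rw [integral_add i5 i6, integral_const_mul] at hint
  have hLHS : ∫ x, (a.eval x * e2 x + b.eval x * e1 x + c.eval x * e x) * semisepOp N P₁ P₂ e x
      ∂unitMeasure = ∫ x, (a.eval x * e2 x + b.eval x * e1 x + c.eval x * e x)
        * (N.eval x * e x + g x) ∂unitMeasure :=
    integral_unit_congr fun x hx => by rw [semisepOp_eq_volt _ _ _ hc0 hx]
  -- The weight aN is at least αε₁, which fixes the factor αε₁ in the π² corrections.
  have hw := mul_wirtinger_le (κ := α * ε₁) (p := fun x => (a * N).eval x) (by positivity)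
    (by fun_prop) (fun x hx => by
      rw [Polynomial.eval_mul]
      exact mul_le_mul (ha x hx) (hN x hx) hε₁.le (hα.le.trans (ha x hx))) he hc1
  have hI6 : ∫ x, Q.Q6.eval x * e x ∂unitMeasure = -2 * m 1 := by
    rw [hm, volt_one, ← integral_const_mul]
    refine integral_unit_congr fun x _ => ?_
    simp only [hQdef, primalMap, hL₁, ev2_sub, ev2_dX_inX_mul, ev2_mul, ev2_inX,
      Polynomial.eval_sub, Polynomial.eval_mul, Polynomial.eval_C, eval_sec2]
    ring
  have hI8 : ∫ x, Q.Q8.eval x * e x ∂unitMeasure = 2 * a.eval 1 * g 1 := by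
    rw [hg, volt_one, ← integral_const_mul]
    refine integral_unit_congr fun x _ => ?_
    simp only [hQdef, primalMap, Polynomial.eval_mul, Polynomial.eval_C, eval_sec2]
    ring
  -- The vanishing of Q₄ makes the flux at 0 a multiple of ∫e, precisely the one that cancels
  -- Wirtinger's cross term e(0)∫e.
  have hI4 : 2 * m 0 = -(Real.pi ^ 2 * α * ε₁) * ∫ x, e x ∂unitMeasure := by
    rw [hm, volt_zero, ← integral_const_mul, ← integral_const_mul]
    refine integral_unit_congr fun x _ => ?_
    have h4 := congrArg (Polynomial.eval x) hQ4
    simp only [hQdef, primalMap, Polynomial.eval_add, Polynomial.eval_mul, Polynomial.eval_C,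
      eval_sec2, Polynomial.eval_zero] at h4
    simp only [hL₂, ev2_sub, ev2_dX_inX_mul, ev2_mul, ev2_inX]
    linear_combination e x * h4
  have h3 : Q.Q3 * e 0 ^ 2 ≤ 0 := mul_nonpos_of_nonpos_of_nonneg hQ3 (sq_nonneg _)
  have hQ3' : Q.Q3 = (a.derivative.eval 0 - b.eval 0) * N.eval 0
    + a.eval 0 * N.derivative.eval 0 - Real.pi ^ 2 / 2 * α * ε₁ := by rw [hQdef]; rfl
  have hQ5' : Q.Q5 = (b.eval 1 - a.derivative.eval 1) * N.eval 1
    - a.eval 1 * N.derivative.eval 1 := by rw [hQdef]; rfl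
  have hQ7' : Q.Q7 = 2 * a.eval 1 * N.eval 1 := by rw [hQdef]; rfl
  have hB1 : B 1 = Q.Q5 * e 1 ^ 2 + Q.Q7 * (e 1 * e1 1) + e 1 * (-2 * m 1)
      + e1 1 * (2 * a.eval 1 * g 1) := by
    simp only [hB, hQ5', hQ7', Polynomial.eval_mul, Polynomial.derivative_mul, Polynomial.eval_add]
    ring
  have hB0 : B 0 = -(Q.Q3 + Real.pi ^ 2 / 2 * α * ε₁) * e 0 ^ 2 - e 0 * (2 * m 0) := by
    simp only [hB, hQ3', h0, Polynomial.eval_mul, Polynomial.derivative_mul, Polynomial.eval_add]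
    ring
  rw [hI4] at hB0
  rw [hLHS, hI6, hI8]
  linarith

set_option maxHeartbeats 1000000 in
-- The same scheme carried out in the variable z with v = 𝒫z. The boundary condition at 0 is on v,
-- so it couples z(0), z_x(0) and an integral of z.
lemma dual_dissipation (hα : 0 < α) (ha : ∀ x ∈ Icc (0 : ℝ) 1, α ≤ a.eval x) (hε₁ : 0 < ε₁)
    {M : ℝ[X]} {K₁ K₂ : Poly2} (hK : K₂ = swap2 K₁) (hM : ∀ x ∈ Icc (0 : ℝ) 1, ε₁ ≤ M.eval x)
    {T : DualData} (hTdef : T = dualMap a b c α ε₁ M K₁ K₂)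
    (hT : InXi d₁ d₂ 0 β
      (-T.T0 - (2 * δ) • M) (-T.T1 - (2 * δ) • K₁) (-T.T2 - (2 * δ) • K₂))
    (hT3 : T.T3 ≤ 0) (hT4 : T.T4 = 0) {z z1 z2 : ℝ → ℝ} (hz : ∀ x, HasDerivAt z (z1 x) x)
    (hz1 : ∀ x, HasDerivAt z1 (z2 x) x) (hz2 : Continuous z2) {v v1 v2 : ℝ → ℝ}
    (hv : ∀ x, v x = M.eval x * z x + volt K₁ K₂ z x) (hv1 : ∀ x, HasDerivAt v (v1 x) x)
    (hv2 : ∀ x, HasDerivAt v1 (v2 x) x) (h0 : v1 0 = 0) :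
    2 * ∫ x, (a.eval x * v2 x + b.eval x * v1 x + c.eval x * v x) * z x ∂unitMeasure
      ≤ -(2 * δ) * (∫ x, z x * v x ∂unitMeasure) + T.T5 * z 1 ^ 2 + T.T6 * (z 1 * z1 1) := by
  have hc0 : Continuous z := continuous_iff_continuousAt.2 fun x => (hz x).continuousAt
  have hc1 : Continuous z1 := continuous_iff_continuousAt.2 fun x => (hz1 x).continuousAt
  set g := volt K₁ K₂ z with hg
  set g1 := volt (dX K₁) (dX K₂) z with hg1
  set D : ℝ → ℝ := fun x => ev2 (dX (K₁ - K₂)) x x with hD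
  have hDc : Continuous D := continuous_ev2_diag _
  set g2 : ℝ → ℝ := fun x => volt (dX (dX K₁)) (dX (dX K₂)) z x + D x * z x with hg2
  have hgd : ∀ x, HasDerivAt g (g1 x) x := fun x => by
    rw [hg, hg1, hK]; exact hasDerivAt_volt_swap2 K₁ hc0 x
  have hgd1 : ∀ x, HasDerivAt g1 (g2 x) x := fun x => by
    simpa only [hD, hg2, dX_sub] using hasDerivAt_volt (dX K₁) (dX K₂) hc0 x
  have ev1 : ∀ x, v1 x = M.derivative.eval x * z x + M.eval x * z1 x + g1 x := fun x => by
    have e : v = fun x => M.eval x * z x + g x := funext hv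
    refine (hv1 x).unique ?_
    rw [e]
    exact ((M.hasDerivAt x).mul (hz x)).add (hgd x)
  have ev2' : ∀ x, v2 x = M.derivative.derivative.eval x * z x + 2 * M.derivative.eval x * z1 x
      + M.eval x * z2 x + g2 x := fun x => by
    have e : v1 = fun x => M.derivative.eval x * z x + M.eval x * z1 x + g1 x := funext ev1
    refine (hv2 x).unique ?_
    rw [e]
    exact ((((M.derivative.hasDerivAt x).mul (hz x)).add
      ((M.hasDerivAt x).mul (hz1 x))).add (hgd1 x)).congr_deriv (by ring)
  set J₁ : Poly2 := inX a * dX (dX K₁) + inX b * dX K₁ + inX c * K₁ with hJ₁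
  set J₂ : Poly2 := inX a * dX (dX K₂) + inX b * dX K₂ + inX c * K₂ with hJ₂
  have hJ : ∀ x, volt J₁ J₂ z x = a.eval x * volt (dX (dX K₁)) (dX (dX K₂)) z x
      + b.eval x * g1 x + c.eval x * g x := fun x => by
    rw [hJ₁, hJ₂, volt_add _ _ _ _ hc0, volt_add _ _ _ _ hc0, volt_inX_mul, volt_inX_mul,
      volt_inX_mul]
  have hgc : Continuous g := continuous_volt _ _ hc0
  have hJc : Continuous (volt J₁ J₂ z) := continuous_volt _ _ hc0
  have hv0c : Continuous v := continuous_iff_continuousAt.2 fun x => (hv1 x).continuousAt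
  have hv1c : Continuous v1 := continuous_iff_continuousAt.2 fun x => (hv2 x).continuousAt
  have hg1c : Continuous g1 := continuous_volt _ _ hc0
  have hv2c : Continuous v2 := by
    have hg2c : Continuous g2 := by
      have := continuous_volt (dX (dX K₁)) (dX (dX K₂)) hc0
      fun_prop
    rw [funext ev2']
    fun_prop
  -- No integral term occurs in B: only the multiplier part of v is integrated by parts, and
  -- derivatives of the integral part fall on its polynomial kernel.
  set B : ℝ → ℝ := fun x => 2 * (a * M).eval x * (z x * z1 x) - (a * M).derivative.eval x * z x ^ 2
    + (2 * a * M.derivative + b * M).eval x * z x ^ 2 with hB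
  set B' : ℝ → ℝ := fun x => 2 * ((a.eval x * v2 x + b.eval x * v1 x + c.eval x * v x) * z x)
    + 2 * (a * M).eval x * z1 x ^ 2
    - (T.T0.eval x + Real.pi ^ 2 / 2 * α * ε₁) * z x ^ 2 - 2 * (z x * volt J₁ J₂ z x) with hB'
  have hBd : ∀ x, HasDerivAt B (B' x) x := fun x => by
    have d1 := (((a * M).hasDerivAt x).const_mul 2).mul ((hz x).mul (hz1 x))
    have d2 := ((a * M).derivative.hasDerivAt x).mul ((hz x).pow 2)
    have d3 := ((2 * a * M.derivative + b * M).hasDerivAt x).mul ((hz x).pow 2)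
    refine ((d1.sub d2).add d3).congr_deriv ?_
    simp only [hB', hTdef, dualMap, hv, ev1, ev2', hJ, hg2, hD, Polynomial.eval_add,
      Polynomial.eval_sub,
      Polynomial.eval_mul, Polynomial.derivative_mul, Polynomial.derivative_add,
      Polynomial.derivative_ofNat, Polynomial.eval_zero,
      eval_diag2, Polynomial.eval_C, Polynomial.eval_ofNat,
      Pi.mul_apply, Pi.pow_apply]
    push_cast
    ring
  have hB'c : Continuous B' := by fun_prop
  have hint := integral_unit_deriv hBd hB'c
  have i1 : Integrable (fun x => 2 * ((a.eval x * v2 x + b.eval x * v1 x + c.eval x * v x)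
      * z x)) unitMeasure := integrable_unit_of_continuousOn (by fun_prop)
  have i2 : Integrable (fun x => 2 * (a * M).eval x * z1 x ^ 2) unitMeasure :=
    integrable_unit_of_continuousOn (by fun_prop)
  have i3 : Integrable (fun x => (T.T0.eval x + Real.pi ^ 2 / 2 * α * ε₁) * z x ^ 2)
    unitMeasure := integrable_unit_of_continuousOn (by fun_prop)
  have i4 : Integrable (fun x => 2 * (z x * volt J₁ J₂ z x)) unitMeasure :=
    integrable_unit_of_continuousOn (by fun_prop)
  have i12 : Integrable (fun x => 2 * ((a.eval x * v2 x + b.eval x * v1 x + c.eval x * v x)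
      * z x) + 2 * (a * M).eval x * z1 x ^ 2) unitMeasure := i1.add i2
  have i123 : Integrable (fun x => 2 * ((a.eval x * v2 x + b.eval x * v1 x + c.eval x * v x)
      * z x) + 2 * (a * M).eval x * z1 x ^ 2
      - (T.T0.eval x + Real.pi ^ 2 / 2 * α * ε₁) * z x ^ 2) unitMeasure := i12.sub i3
  rw [hB', integral_sub i123 i4, integral_sub i12 i3, integral_add i1 i2, integral_const_mul,
    integral_const_mul (2 : ℝ) (fun x => z x * volt J₁ J₂ z x),
    two_mul_integral_mul_volt _ _ hc0] at hint
  have hT1 : T.T1 = J₁ + swap2 J₂ := by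
    rw [hTdef, hJ₁, hJ₂, hK]
    simp only [dualMap, swap2_add, swap2_dX, swap2_mul, swap2_inX, swap2_swap2]
    ring
  have hT2 : T.T2 = swap2 (J₁ + swap2 J₂) := by
    rw [← hT1, hTdef]; rfl
  have hneg := hT.integral_add_le hc0
  rw [← hT2, ← hT1] at hint
  have i5 : Integrable (fun x => T.T0.eval x * z x ^ 2) unitMeasure :=
    integrable_unit_of_continuousOn (by fun_prop)
  have i6 : Integrable (fun x => Real.pi ^ 2 / 2 * α * ε₁ * z x ^ 2) unitMeasure :=
    integrable_unit_of_continuousOn (by fun_prop)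
  simp only [add_mul (Polynomial.eval _ _) (Real.pi ^ 2 / 2 * α * ε₁)] at hint
  rw [integral_add i5 i6, integral_const_mul] at hint
  have hzv : ∫ x, z x * semisepOp M K₁ K₂ z x ∂unitMeasure = ∫ x, z x * v x ∂unitMeasure :=
    integral_unit_congr fun x hx => by rw [semisepOp_eq_volt _ _ _ hc0 hx, hv]
  rw [hzv] at hneg
  have hw := mul_wirtinger_le (κ := α * ε₁) (p := fun x => (a * M).eval x) (by positivity)
    (by fun_prop) (fun x hx => by
      rw [Polynomial.eval_mul]
      exact mul_le_mul (ha x hx) (hM x hx) hε₁.le (hα.le.trans (ha x hx))) hz hc1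
  have hI4 : 2 * a.eval 0 * g1 0 = -(Real.pi ^ 2 * α * ε₁) * ∫ x, z x ∂unitMeasure := by
    rw [hg1, volt_zero, ← integral_const_mul, ← integral_const_mul]
    refine integral_unit_congr fun x _ => ?_
    have h4 := congrArg (Polynomial.eval x) hT4
    simp only [hTdef, dualMap, Polynomial.eval_add, Polynomial.eval_mul, Polynomial.eval_C,
      eval_sec2, Polynomial.eval_zero] at h4
    linear_combination z x * h4
  have h3 : T.T3 * z 0 ^ 2 ≤ 0 := mul_nonpos_of_nonpos_of_nonneg hT3 (sq_nonneg _)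
  have hT3' : T.T3 = (a.derivative.eval 0 - b.eval 0) * M.eval 0
    + a.eval 0 * M.derivative.eval 0 - Real.pi ^ 2 / 2 * α * ε₁ := by rw [hTdef]; rfl
  have hT5' : T.T5 = (b.eval 1 - a.derivative.eval 1) * M.eval 1
    + a.eval 1 * M.derivative.eval 1 := by rw [hTdef]; rfl
  have hT6' : T.T6 = 2 * a.eval 1 * M.eval 1 := by rw [hTdef]; rfl
  have hB1 : B 1 = T.T5 * z 1 ^ 2 + T.T6 * (z 1 * z1 1) := by
    simp only [hB, hT5', hT6', Polynomial.eval_mul, Polynomial.derivative_mul, Polynomial.eval_add,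
      Polynomial.eval_ofNat]
    ring
  have hB0 : B 0 = -(T.T3 + Real.pi ^ 2 / 2 * α * ε₁) * z 0 ^ 2 - z 0 * (2 * a.eval 0 * g1 0) := by
    have h0' := ev1 0
    rw [h0] at h0'
    simp only [hB, hT3', Polynomial.eval_mul, Polynomial.derivative_mul, Polynomial.eval_add,
      Polynomial.eval_ofNat]
    -- The condition v_x(0) = 0 eliminates M(0)z_x(0) in favour of z(0) and the integral term that
    -- T₄ controls.
    linear_combination (-2 * a.eval 0 * z 0) * h0'
  rw [hI4] at hB0
  linarith

end Dissipation

/-! ### Extension of functions from the unit interval -/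

lemma exists_hasDerivAt_extension {u u' U' : ℝ → ℝ}
    (h : ∀ x ∈ Icc (0 : ℝ) 1, HasDerivWithinAt u (u' x) (Icc 0 1) x) (hU' : Continuous U')
    (hu : EqOn u' U' (Icc 0 1)) :
    ∃ U : ℝ → ℝ, (∀ x, HasDerivAt U (U' x) x) ∧ EqOn u U (Icc 0 1) := by
  refine ⟨fun x => u 0 + ∫ s in (0 : ℝ)..x, U' s, fun x => ?_, fun x hx => ?_⟩
  · exact (intervalIntegral.integral_hasDerivAt_right (hU'.intervalIntegrable _ _)
      (hU'.stronglyMeasurableAtFilter _ _) hU'.continuousAt).const_add _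
  · have h1 : ∫ s in (0 : ℝ)..x, U' s = u x - u 0 := by
      refine intervalIntegral.integral_eq_sub_of_hasDerivAt_of_le hx.1
        (fun y hy => (h y ⟨hy.1, hy.2.trans hx.2⟩).continuousWithinAt.mono
          (Icc_subset_Icc_right hx.2)) (fun y hy => ?_) (hU'.intervalIntegrable _ _)
      have hy' : y ∈ Icc (0 : ℝ) 1 := ⟨hy.1.le, hy.2.le.trans hx.2⟩
      rw [← hu hy']
      exact (h y hy').hasDerivAt (Icc_mem_nhds hy.1 (hy.2.trans_le hx.2))
    simp only [h1]
    ring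

/-- The calculus of `volt` uses functions and two-sided derivatives on all of ℝ, while solutions
live on the unit interval. Extending the second derivative by constants and integrating twice
reconciles the two. -/
lemma exists_C2_extension {u u1 u2 : ℝ → ℝ}
    (h : ∀ x ∈ Icc (0 : ℝ) 1, HasDerivWithinAt u (u1 x) (Icc 0 1) x)
    (h1 : ∀ x ∈ Icc (0 : ℝ) 1, HasDerivWithinAt u1 (u2 x) (Icc 0 1) x)
    (h2 : ContinuousOn u2 (Icc 0 1)) :
    ∃ U U1 U2 : ℝ → ℝ, (∀ x, HasDerivAt U (U1 x) x) ∧ (∀ x, HasDerivAt U1 (U2 x) x) ∧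
      Continuous U2 ∧ EqOn u U (Icc 0 1) ∧ EqOn u1 U1 (Icc 0 1) ∧ EqOn u2 U2 (Icc 0 1) := by
  have hU2 : Continuous (IccExtend zero_le_one ((Icc (0 : ℝ) 1).domRestrict u2)) :=
    h2.domRestrict.Icc_extend'
  have e2 : EqOn u2 (IccExtend zero_le_one ((Icc (0 : ℝ) 1).domRestrict u2)) (Icc 0 1) :=
    fun x hx => by rw [IccExtend_of_mem _ _ hx]; rfl
  obtain ⟨U1, hU1, e1⟩ := exists_hasDerivAt_extension h1 hU2 e2
  obtain ⟨U, hU, e⟩ := exists_hasDerivAt_extension h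
    (continuous_iff_continuousAt.2 fun x => (hU1 x).continuousAt) e1
  exact ⟨U, U1, _, hU, hU1, hU2, e, e1, e2⟩

/-! ### Regular functions of space and time -/

/-- The functions `ut, ux, uxx` are the derivatives of `u` on `[0,1] × (0,∞)`. -/
structure HasC12 (u ut ux uxx : ℝ → ℝ → ℝ) : Prop where
  dt : ∀ x ∈ Icc (0 : ℝ) 1, ∀ t, 0 < t → HasDerivAt (fun s => u x s) (ut x t) t
  dx : ∀ t, 0 < t → ∀ x ∈ Icc (0 : ℝ) 1,
    HasDerivWithinAt (fun y => u y t) (ux x t) (Icc 0 1) x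
  dxx : ∀ t, 0 < t → ∀ x ∈ Icc (0 : ℝ) 1,
    HasDerivWithinAt (fun y => ux y t) (uxx x t) (Icc 0 1) x
  cont : ContinuousOn (Function.uncurry u) (Icc 0 1 ×ˢ Ioi 0)
  cont_t : ContinuousOn (Function.uncurry ut) (Icc 0 1 ×ˢ Ioi 0)
  cont_xx : ContinuousOn (Function.uncurry uxx) (Icc 0 1 ×ˢ Ioi 0)

lemma IsC12.hasC12 {w : ℝ → ℝ → ℝ} (h : IsC12 w) : HasC12 w (pt w) (px w) (pxx w) where
  dt x hx t ht := (h.diff_t x hx t ht).hasDerivAt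
  dx t ht x hx := (h.diff_x t ht x hx).hasDerivWithinAt
  dxx t ht x hx := (h.diff_xx t ht x hx).hasDerivWithinAt
  cont := h.cont
  cont_t := h.cont_t
  cont_xx := h.cont_xx

lemma continuousOn_slice {u : ℝ → ℝ → ℝ}
    (h : ContinuousOn (Function.uncurry u) (Icc 0 1 ×ˢ Ioi 0)) {t : ℝ} (ht : 0 < t) :
    ContinuousOn (fun x => u x t) (Icc 0 1) :=
  h.comp (f := fun x : ℝ => (x, t)) (by fun_prop) fun _ hx => ⟨hx, ht⟩

lemma HasC12.sub {u ut ux uxx v vt vx vxx : ℝ → ℝ → ℝ} (hu : HasC12 u ut ux uxx)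
    (hv : HasC12 v vt vx vxx) :
    HasC12 (fun x t => u x t - v x t) (fun x t => ut x t - vt x t) (fun x t => ux x t - vx x t)
      (fun x t => uxx x t - vxx x t) where
  dt x hx t ht := (hu.dt x hx t ht).sub (hv.dt x hx t ht)
  dx t ht x hx := (hu.dx t ht x hx).sub (hv.dx t ht x hx)
  dxx t ht x hx := (hu.dxx t ht x hx).sub (hv.dxx t ht x hx)
  cont := hu.cont.sub hv.cont
  cont_t := hu.cont_t.sub hv.cont_t
  cont_xx := hu.cont_xx.sub hv.cont_xx

/-- Clamping x to the interval and writing t = exp s makes the integrand continuous on the whole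
plane, where continuity of parametric integrals applies directly. -/
lemma continuousOn_integral_sq {u : ℝ → ℝ → ℝ}
    (h : ContinuousOn (Function.uncurry u) (Icc 0 1 ×ˢ Ioi 0)) :
    ContinuousOn (fun t => ∫ x, u x t ^ 2 ∂unitMeasure) (Ioi 0) := by
  set G : ℝ → ℝ → ℝ := fun s x => u (projIcc 0 1 zero_le_one x) (Real.exp s) ^ 2 with hG
  have hGc : Continuous (Function.uncurry G) := by
    have hp : Continuous fun q : ℝ × ℝ => ((projIcc (0 : ℝ) 1 zero_le_one q.2 : ℝ), Real.exp q.1) :=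
      by fun_prop
    have := h.comp_continuous hp fun q =>
      ⟨(projIcc (0 : ℝ) 1 zero_le_one q.2).2, Real.exp_pos _⟩
    exact this.pow 2
  have h1 := intervalIntegral.continuous_parametric_intervalIntegral_of_continuous' (μ := volume)
    hGc 0 1
  refine (h1.comp_continuousOn (s := Ioi 0) (f := Real.log)
    (Real.continuousOn_log.mono fun t ht => ne_of_gt ht)).congr fun t ht => ?_
  simp only [Function.comp_apply, intervalIntegral.integral_of_le zero_le_one, hG]
  refine integral_unit_congr fun x hx => ?_
  simp only [Real.exp_log ht, projIcc_of_mem _ hx]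

/-- Differentiation of a quadratic form `t ↦ ⟨u(t), Y(t)⟩`, where `Y` depends on `u` through a
bounded symmetric operator. -/
lemma hasDerivAt_integral_mul {u ut Y : ℝ → ℝ → ℝ} {t C : ℝ} (ht : 0 < t) (hC : 0 ≤ C)
    (dt : ∀ x ∈ Icc (0 : ℝ) 1, ∀ s, 0 < s → HasDerivAt (fun s => u x s) (ut x s) s)
    (hu : ContinuousOn (Function.uncurry u) (Icc 0 1 ×ˢ Ioi 0))
    (hut : ContinuousOn (Function.uncurry ut) (Icc 0 1 ×ˢ Ioi 0))
    (hY : ∀ s, 0 < s → MemLp (fun x => Y x s) 2 unitMeasure)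
    (hsym : ∀ s, 0 < s →
      ∫ x, u x t * Y x s ∂unitMeasure = ∫ x, u x s * Y x t ∂unitMeasure)
    (hbd : ∀ s, 0 < s → ∫ x, (Y x s - Y x t) ^ 2 ∂unitMeasure
      ≤ C * ∫ x, (u x s - u x t) ^ 2 ∂unitMeasure) :
    HasDerivAt (fun s => ∫ x, u x s * Y x s ∂unitMeasure)
      (2 * ∫ x, ut x t * Y x t ∂unitMeasure) t := by
  have hum : ∀ s, 0 < s → MemLp (fun x => u x s) 2 unitMeasure := fun s hs =>
    memLp_unit_of_continuousOn (continuousOn_slice hu hs)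
  obtain ⟨B, hB⟩ := (isCompact_Icc.prod isCompact_Icc).exists_bound_of_continuousOn
    (s := Icc (0 : ℝ) 1 ×ˢ Icc (t / 2) (2 * t))
    (hut.mono (prod_mono le_rfl fun s hs => (by linarith [hs.1] : (0 : ℝ) < s)))
  have hnhds : Ioo (t / 2) (2 * t) ∈ 𝓝 t := Ioo_mem_nhds (by linarith) (by linarith)
  have hpos : ∀ s ∈ Ioo (t / 2) (2 * t), 0 < s := fun s hs => by linarith [hs.1]
  have hlip : ∀ x ∈ Icc (0 : ℝ) 1, ∀ s ∈ Ioo (t / 2) (2 * t), |u x s - u x t| ≤ B * |s - t| :=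
    fun x hx s hs => (convex_Ioo _ _).norm_image_sub_le_of_norm_hasDerivWithin_le
      (fun r hr => (dt x hx r (hpos r hr)).hasDerivWithinAt)
      (fun r hr => hB (x, r) ⟨hx, Ioo_subset_Icc_self hr⟩)
      (mem_of_mem_nhds hnhds) hs
  have d1 : HasDerivAt (fun s => ∫ x, u x s * Y x t ∂unitMeasure)
      (∫ x, ut x t * Y x t ∂unitMeasure) t := by
    refine (hasDerivAt_integral_of_dominated_loc_of_deriv_le (bound := fun x => B * |Y x t|)
      (F := fun s x => u x s * Y x t) (F' := fun s x => ut x s * Y x t) hnhds ?_ ?_ ?_ ?_ ?_ ?_).2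
    · filter_upwards [hnhds] with s hs
      exact (integrable_mul_unit (hum s (hpos s hs)) (hY t ht)).1
    · exact integrable_mul_unit (hum t ht) (hY t ht)
    · exact (integrable_mul_unit (memLp_unit_of_continuousOn (continuousOn_slice hut ht))
        (hY t ht)).1
    · refine ae_unit_of_forall fun x hx s hs => ?_
      rw [norm_mul]
      exact mul_le_mul_of_nonneg_right (hB (x, s) ⟨hx, Ioo_subset_Icc_self hs⟩) (abs_nonneg _)
    · exact (integrable_unit_of_memLp (hY t ht)).abs.const_mul _
    · exact ae_unit_of_forall fun x hx s hs => (dt x hx s (hpos s hs)).mul_const _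
  -- Polarization at time t: by symmetry ⟨u(s),Y(s)⟩ = R(s) + 2⟨u(s),Y(t)⟩ − ⟨u(t),Y(t)⟩. The
  -- remainder is quadratic in s − t since u is Lipschitz near t and Y − Y(t) is bounded by u − u(t)
  -- in L². Only u is differentiated.
  set R : ℝ → ℝ := fun s => ∫ x, (u x s - u x t) * (Y x s - Y x t) ∂unitMeasure with hR
  have hRle : ∀ s ∈ Ioo (t / 2) (2 * t), ‖R s‖ ≤ ((1 + C) / 2 * B ^ 2) * ‖‖s - t‖ ^ 2‖ := by
    intro s hs
    have m1 : MemLp (fun x => u x s - u x t) 2 unitMeasure := (hum s (hpos s hs)).sub (hum t ht)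
    have m2 : MemLp (fun x => Y x s - Y x t) 2 unitMeasure := (hY s (hpos s hs)).sub (hY t ht)
    have h1 : ‖R s‖ ≤ ∫ x, (1 / 2) * (u x s - u x t) ^ 2 + (1 / 2) * (Y x s - Y x t) ^ 2
        ∂unitMeasure := by
      refine (norm_integral_le_integral_norm _).trans (integral_mono
        (integrable_mul_unit m1 m2).norm
        ((m1.integrable_sq.const_mul _).add (m2.integrable_sq.const_mul _)) fun x => ?_)
      simp only [norm_mul, Real.norm_eq_abs]
      nlinarith [sq_abs (u x s - u x t), sq_abs (Y x s - Y x t),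
        sq_nonneg (|u x s - u x t| - |Y x s - Y x t|)]
    rw [integral_add (m1.integrable_sq.const_mul _) (m2.integrable_sq.const_mul _),
      integral_const_mul, integral_const_mul] at h1
    have h2 : ∫ x, (u x s - u x t) ^ 2 ∂unitMeasure ≤ ∫ _x, (B * |s - t|) ^ 2 ∂unitMeasure :=
      integral_mono_ae m1.integrable_sq (integrable_const _) (ae_unit_of_forall fun x hx => by
        have := hlip x hx s hs
        exact sq_le_sq' (by linarith [(abs_le.1 this).1]) (abs_le.1 this).2)
    simp only [integral_const, probReal_univ, one_smul] at h2
    have h3 := hbd s (hpos s hs)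
    rw [norm_pow, norm_norm, Real.norm_eq_abs (s - t)]
    have h4 : (1 + C) / 2 * (∫ x, (u x s - u x t) ^ 2 ∂unitMeasure)
      ≤ (1 + C) / 2 * (B * |s - t|) ^ 2 := mul_le_mul_of_nonneg_left h2 (by positivity)
    nlinarith
  have d2 : HasDerivAt R 0 t := by
    have hO : R =O[𝓝 t] fun s => ‖s - t‖ ^ 2 :=
      Asymptotics.IsBigO.of_bound _ (by filter_upwards [hnhds] with s hs using hRle s hs)
    simpa using (hO.hasFDerivAt one_lt_two).hasDerivAt
  have e : (fun s => ∫ x, u x s * Y x s ∂unitMeasure) =ᶠ[𝓝 t]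
      fun s => R s + 2 * (∫ x, u x s * Y x t ∂unitMeasure) - ∫ x, u x t * Y x t ∂unitMeasure := by
    filter_upwards [hnhds] with s hs
    have hs' := hpos s hs
    have j1 := integrable_mul_unit (hum s hs') (hY s hs')
    have j2 := integrable_mul_unit (hum s hs') (hY t ht)
    have j3 := integrable_mul_unit (hum t ht) (hY s hs')
    have j4 := integrable_mul_unit (hum t ht) (hY t ht)
    have j12 : Integrable (fun x => u x s * Y x s - u x s * Y x t) unitMeasure := j1.sub j2
    have j123 : Integrable (fun x => u x s * Y x s - u x s * Y x t - u x t * Y x s)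
      unitMeasure := j12.sub j3
    have e1 : ∀ x, (u x s - u x t) * (Y x s - Y x t)
        = u x s * Y x s - u x s * Y x t - u x t * Y x s + u x t * Y x t := fun x => by ring
    simp only [hR, e1]
    rw [integral_add j123 j4, integral_sub j12 j3, integral_sub j1 j2, hsym s hs']
    ring
  refine HasDerivAt.congr_of_eventuallyEq ?_ e
  exact ((d2.add (d1.const_mul 2)).sub_const _).congr_deriv (by ring)

/-! ### Integration of a dissipation inequality -/

/-- Integrate over (s, T), drop W(T) ≥ 0, let s → 0⁺ so that W(s) disappears, then exhaust the
half-line. Extended integrals make finiteness of ∫φ part of the conclusion. -/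
lemma lintegral_le_of_dissipation {W W' φ ψ : ℝ → ℝ} {κ C : ℝ} (hκ : 0 < κ) (hC : 0 < C)
    (hW : ∀ t, 0 < t → HasDerivAt W (W' t) t)
    (hle : ∀ t, 0 < t → W' t ≤ -κ * φ t + C * ψ t) (hpos : ∀ t, 0 < t → 0 ≤ W t)
    (h0 : Tendsto W (𝓝[>] 0) (𝓝 0)) (hφ : ContinuousOn φ (Ioi 0)) (hψ : ContinuousOn ψ (Ioi 0))
    (hφ0 : ∀ t, 0 < t → 0 ≤ φ t) (hψ0 : ∀ t, 0 < t → 0 ≤ ψ t) :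
    ∫⁻ t in Ioi (0 : ℝ), ENNReal.ofReal (φ t)
      ≤ ENNReal.ofReal (C / κ) * ∫⁻ t in Ioi (0 : ℝ), ENNReal.ofReal (ψ t) := by
  have hCκ : 0 < C / κ := by positivity
  rcases eq_or_ne (∫⁻ t in Ioi (0 : ℝ), ENNReal.ofReal (ψ t)) ⊤ with htop | htop
  · rw [htop, ENNReal.mul_top (by simpa using hCκ)]
    exact le_top
  set P := (∫⁻ t in Ioi (0 : ℝ), ENNReal.ofReal (ψ t)).toReal with hP
  have hsub : ∀ {r T : ℝ}, 0 < r → Icc r T ⊆ Ioi 0 := fun hr x hx => hr.trans_le hx.1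
  have hii : ∀ {θ : ℝ → ℝ}, ContinuousOn θ (Ioi 0) → ∀ {r T : ℝ}, 0 < r → r ≤ T →
      IntervalIntegrable θ volume r T := fun hθ r T hr hT =>
    ContinuousOn.intervalIntegrable (hθ.mono (by rw [uIcc_of_le hT]; exact hsub hr))
  have hof : ∀ {θ : ℝ → ℝ}, ContinuousOn θ (Ioi 0) → (∀ t, 0 < t → 0 ≤ θ t) → ∀ {r T : ℝ},
      0 < r → r ≤ T → ∫⁻ t in Ioc r T, ENNReal.ofReal (θ t)
        = ENNReal.ofReal (∫ t in r..T, θ t) := fun hθ hθ0 r T hr hT => by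
    rw [intervalIntegral.integral_of_le hT, ofReal_integral_eq_lintegral_ofReal
      ((intervalIntegrable_iff_integrableOn_Ioc_of_le hT).1 (hii hθ hr hT))
      (ae_restrict_of_forall_mem measurableSet_Ioc fun t ht => hθ0 t (hr.trans ht.1))]
  have hψP : ∀ {r T : ℝ}, 0 < r → r ≤ T → ∫ t in r..T, ψ t ≤ P := fun {r T} hr hT => by
    have h1 : ENNReal.ofReal (∫ t in r..T, ψ t) ≤ ∫⁻ t in Ioi (0 : ℝ), ENNReal.ofReal (ψ t) := by
      rw [← hof hψ hψ0 hr hT]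
      exact lintegral_mono_set fun t ht => hr.trans ht.1
    exact (ENNReal.ofReal_le_iff_le_toReal htop).1 h1
  have key : ∀ {r T : ℝ}, 0 < r → r ≤ T → κ * ∫ t in r..T, φ t ≤ C * P := by
    -- The lower limit r of the φ-integral is fixed while the starting time s tends to 0. This needs
    -- no integrability of φ near 0.
    intro r T hr hT
    have hs : ∀ᶠ s in 𝓝[>] (0 : ℝ), κ * (∫ t in r..T, φ t) ≤ W s + C * P := by
      filter_upwards [Ioo_mem_nhdsGT hr] with s hs
      have hsT : s ≤ T := hs.2.le.trans hT
      have h1 := intervalIntegral.sub_le_integral_of_hasDeriv_right_of_le (g := W) (g' := W')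
        (φ := fun t => -κ * φ t + C * ψ t) hsT
        (fun t ht => (hW t (hsub hs.1 ht)).continuousAt.continuousWithinAt)
        (fun t ht => (hW t (hs.1.trans ht.1)).hasDerivWithinAt)
        (ContinuousOn.integrableOn_Icc ((((hφ.mono (hsub hs.1)).const_smul (-κ)).add
          ((hψ.mono (hsub hs.1)).const_smul C))))
        (fun t ht => hle t (hs.1.trans ht.1))
      rw [intervalIntegral.integral_add ((hii hφ hs.1 hsT).const_mul _)
        ((hii hψ hs.1 hsT).const_mul _), intervalIntegral.integral_const_mul,
        intervalIntegral.integral_const_mul] at h1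
      have h2 : ∫ t in r..T, φ t ≤ ∫ t in s..T, φ t := by
        rw [← intervalIntegral.integral_add_adjacent_intervals (hii hφ hs.1 hs.2.le)
          (hii hφ hr hT)]
        have : 0 ≤ ∫ t in s..r, φ t := intervalIntegral.integral_nonneg hs.2.le
          fun t ht => hφ0 t (hsub hs.1 ht)
        linarith
      have h3 := mul_le_mul_of_nonneg_left (hψP hs.1 hsT) hC.le
      have h4 := hpos T (hs.1.trans_le hsT)
      have h5 := mul_le_mul_of_nonneg_left h2 hκ.le
      linarith
    simpa using ge_of_tendsto (h0.add_const (C * P)) hs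
  have hcov : AECover (volume.restrict (Ioi (0 : ℝ))) (atTop : Filter ℕ)
      fun n => Ioc (1 / ((n : ℝ) + 1)) ((n : ℝ) + 1) := by
    refine aecover_Ioi_of_Ioi (μ := volume) tendsto_one_div_add_atTop_nhds_zero_nat |>.inter
      ((aecover_Iic (μ := volume) (tendsto_atTop_add_const_right _ _
        tendsto_natCast_atTop_atTop)).mono Measure.restrict_le_self)
  have hmeas : AEMeasurable (fun t => ENNReal.ofReal (φ t)) (volume.restrict (Ioi (0 : ℝ))) :=
    (hφ.aemeasurable measurableSet_Ioi).ennreal_ofReal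
  refine le_of_tendsto (hcov.lintegral_tendsto_of_countably_generated hmeas)
    (Eventually.of_forall fun n => ?_)
  have hr : 0 < 1 / ((n : ℝ) + 1) := by positivity
  have hT : 1 / ((n : ℝ) + 1) ≤ (n : ℝ) + 1 := by
    rw [div_le_iff₀ (by positivity)]
    nlinarith [(n.cast_nonneg : (0 : ℝ) ≤ n)]
  have hss : Ioc (1 / ((n : ℝ) + 1)) ((n : ℝ) + 1) ⊆ Ioi 0 := fun t ht => hr.trans ht.1
  rw [Measure.restrict_restrict measurableSet_Ioc, inter_eq_left.2 hss,
    hof hφ hφ0 hr hT, ← ENNReal.ofReal_toReal htop, ← hP, ← ENNReal.ofReal_mul hCκ.le]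
  refine ENNReal.ofReal_le_ofReal ?_
  rw [div_mul_eq_mul_div, le_div_iff₀ hκ, mul_comm]
  exact key hr hT

/-! ### Lyapunov estimates for the observer error and for the observer state -/

/-- Young's inequality for integrals over the unit interval. -/
lemma two_mul_integral_mul_le {f g : ℝ → ℝ} (hf : MemLp f 2 unitMeasure)
    (hg : MemLp g 2 unitMeasure) {r : ℝ} (hr : 0 < r) :
    2 * ∫ x, f x * g x ∂unitMeasure
      ≤ r * (∫ x, f x ^ 2 ∂unitMeasure) + r⁻¹ * ∫ x, g x ^ 2 ∂unitMeasure := by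
  rw [← integral_const_mul, ← integral_const_mul, ← integral_const_mul,
    ← integral_add (hf.integrable_sq.const_mul _) (hg.integrable_sq.const_mul _)]
  refine integral_mono ((integrable_mul_unit hf hg).const_mul _)
    ((hf.integrable_sq.const_mul _).add (hg.integrable_sq.const_mul _)) fun x => ?_
  have h : r * f x ^ 2 + r⁻¹ * g x ^ 2 - 2 * (f x * g x) = r⁻¹ * (r * f x - g x) ^ 2 := by
    field_simp
    ring
  have h2 : 0 ≤ r⁻¹ * (r * f x - g x) ^ 2 := by positivity
  simp only
  linarith

/-- The inverse of a coercive operator is bounded. -/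
lemma InXi.integral_sq_le {d₁ d₂ : ℕ} {ε₁ ε₂ : ℝ} {M : ℝ[X]} {K₁ K₂ : Poly2}
    (h : InXi d₁ d₂ ε₁ ε₂ M K₁ K₂) (hε : 0 < ε₁) {z : ℝ → ℝ} (hz : MemLp z 2 unitMeasure) :
    ∫ x, z x ^ 2 ∂unitMeasure ≤ (ε₁⁻¹) ^ 2 * ∫ x, semisepOp M K₁ K₂ z x ^ 2 ∂unitMeasure := by
  have h1 := h.mul_integral_sq_le hε.le hz
  have h2 := two_mul_integral_mul_le hz (memLp_semisepOp M K₁ K₂ hz) hε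
  -- Young's inequality with weight ε₁ returns half of the coercive term, which is then absorbed.
  have h3 := mul_le_mul_of_nonneg_left (h1.trans (by linarith : _ ≤
    (ε₁ * (∫ x, z x ^ 2 ∂unitMeasure)
      + ε₁⁻¹ * ∫ x, semisepOp M K₁ K₂ z x ^ 2 ∂unitMeasure) / 2)) (inv_pos.2 hε).le
  have e1 : ε₁⁻¹ * (ε₁ * ∫ x, z x ^ 2 ∂unitMeasure) = ∫ x, z x ^ 2 ∂unitMeasure := by
    rw [← mul_assoc, inv_mul_cancel₀ hε.ne', one_mul]
  have e2 : ε₁⁻¹ * ((ε₁ * (∫ x, z x ^ 2 ∂unitMeasure)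
      + ε₁⁻¹ * ∫ x, semisepOp M K₁ K₂ z x ^ 2 ∂unitMeasure) / 2)
      = (∫ x, z x ^ 2 ∂unitMeasure) / 2
        + (ε₁⁻¹) ^ 2 * (∫ x, semisepOp M K₁ K₂ z x ^ 2 ∂unitMeasure) / 2 := by
    rw [← e1]; ring_nf; field_simp
  rw [e1, e2] at h3
  linarith

section Estimates

variable {a b c : ℝ[X]} {α : ℝ} {d₁ d₂ : ℕ} {ε₁ ε₂ β δ : ℝ}

/-- The Lyapunov inequality for the observer error. -/
lemma error_estimate (hα : 0 < α) (ha : ∀ x ∈ Icc (0 : ℝ) 1, α ≤ a.eval x) (hε₁ : 0 < ε₁)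
    (hδ : 0 < δ) {N : ℝ[X]} {P₁ P₂ : Poly2} (hN : InXi d₁ d₂ ε₁ ε₂ N P₁ P₂)
    {Q : PrimalData} (hQdef : Q = primalMap a b c α ε₁ N P₁ P₂)
    (hQ : InXi d₁ d₂ 0 β
      (-Q.Q0 - (2 * δ) • N) (-Q.Q1 - (2 * δ) • P₁) (-Q.Q2 - (2 * δ) • P₂))
    (hQ3 : Q.Q3 ≤ 0) (hQ4 : Q.Q4 = 0) {O₂ : ℝ} (hO₂ : O₂ < 0)
    (hO₂' : Q.Q5 + 1 / O₂ * Q.Q7 < 0) :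
    ∃ κ C, 0 < κ ∧ 0 < C ∧ ∀ e e1 e2 F : ℝ → ℝ,
      (∀ x ∈ Icc (0 : ℝ) 1, HasDerivWithinAt e (e1 x) (Icc 0 1) x) →
      (∀ x ∈ Icc (0 : ℝ) 1, HasDerivWithinAt e1 (e2 x) (Icc 0 1) x) →
      ContinuousOn e2 (Icc 0 1) → ContinuousOn F (Icc 0 1) → e1 0 = 0 → e 1 = O₂ * e1 1 →
      2 * ∫ x, (a.eval x * e2 x + b.eval x * e1 x + c.eval x * e x
          + observerGain N P₁ P₂ Q O₂ x * e1 1 - F x) * semisepOp N P₁ P₂ e x ∂unitMeasure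
        ≤ -κ * ((∫ x, e x ^ 2 ∂unitMeasure) + e1 1 ^ 2) + C * ∫ x, F x ^ 2 ∂unitMeasure := by
  obtain ⟨C, hC0, hC⟩ := exists_integral_semisepOp_sq_le N P₁ P₂
  obtain ⟨hOc, hOs⟩ := hN.semisepInv_spec hε₁
    (v := fun x => -(1 / 2) * (O₂ * Q.Q6.eval x + Q.Q8.eval x)) (by fun_prop)
  set O₁ := observerGain N P₁ P₂ Q O₂ with hO₁
  change ContinuousOn O₁ _ at hOc
  change ∀ x ∈ _, semisepOp N P₁ P₂ O₁ x = _ at hOs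
  -- With e(1) = O₂e_x(1) the local boundary form at 1 is exactly −ρ e_x(1)².
  set ρ := -(Q.Q5 + 1 / O₂ * Q.Q7) * O₂ ^ 2 with hρ
  have hρ0 : 0 < ρ := mul_pos (by linarith) (sq_pos_of_neg hO₂)
  -- This weight makes r⁻¹‖𝒮e‖² ≤ δε₁‖e‖², so the forcing consumes half of the decay 2δε₁‖e‖².
  set r := C / (δ * ε₁) with hr
  have hr0 : 0 < r := by positivity
  refine ⟨min (δ * ε₁) ρ, r, lt_min (by positivity) hρ0, hr0, ?_⟩
  intro e e1 e2 F he he1 he2 hF h0 h1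
  obtain ⟨E, E1, E2, hE, hE1, hE2, eq0, eq1, eq2⟩ := exists_C2_extension he he1 he2
  have hEc : Continuous E := continuous_iff_continuousAt.2 fun x => (hE x).continuousAt
  have hE1c : Continuous E1 := continuous_iff_continuousAt.2 fun x => (hE1 x).continuousAt
  have m0 : (0 : ℝ) ∈ Icc (0 : ℝ) 1 := by simp
  have m1 : (1 : ℝ) ∈ Icc (0 : ℝ) 1 := by simp
  have hdiss := primal_dissipation hα ha hε₁ hN.eq_swap2 (fun x hx => hN.le_eval hε₁.le hx) hQdef
    hQ hQ3 hQ4 hE hE1 hE2 (by rw [← eq1 m0, h0])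
  rw [eq0 m1, eq1 m1] at h1
  have mE : MemLp E 2 unitMeasure := memLp_unit_of_continuousOn hEc.continuousOn
  have mS := memLp_semisepOp N P₁ P₂ mE
  have mF : MemLp F 2 unitMeasure := memLp_unit_of_continuousOn hF
  have mO : MemLp O₁ 2 unitMeasure := memLp_unit_of_continuousOn hOc
  have mA : MemLp (fun x => a.eval x * E2 x + b.eval x * E1 x + c.eval x * E x) 2 unitMeasure :=
    memLp_unit_of_continuousOn (by fun_prop)
  have i1 := integrable_mul_unit mA mS
  have i2 : Integrable (fun x => E1 1 * (O₁ x * semisepOp N P₁ P₂ E x)) unitMeasure :=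
    (integrable_mul_unit mO mS).const_mul _
  have i3 := integrable_mul_unit mF mS
  have i12 : Integrable (fun x => (a.eval x * E2 x + b.eval x * E1 x + c.eval x * E x)
      * semisepOp N P₁ P₂ E x + E1 1 * (O₁ x * semisepOp N P₁ P₂ E x)) unitMeasure := i1.add i2
  have eL : ∫ x, (a.eval x * e2 x + b.eval x * e1 x + c.eval x * e x + O₁ x * e1 1 - F x)
      * semisepOp N P₁ P₂ e x ∂unitMeasure
      = ∫ x, ((a.eval x * E2 x + b.eval x * E1 x + c.eval x * E x) * semisepOp N P₁ P₂ E x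
        + E1 1 * (O₁ x * semisepOp N P₁ P₂ E x)) - F x * semisepOp N P₁ P₂ E x ∂unitMeasure :=
    integral_unit_congr fun x hx => by
      rw [semisepOp_congr N P₁ P₂ eq0 hx, eq0 hx, eq1 hx, eq2 hx, eq1 m1]
      ring
  -- Self-adjointness moves 𝒮 onto O₁ and leaves R₁. Twice y times this cancels the nonlocal Q₆ and
  -- Q₈ terms, because e(1) = O₂y.
  have eO : ∫ x, O₁ x * semisepOp N P₁ P₂ E x ∂unitMeasure
      = -(1 / 2) * (O₂ * (∫ x, Q.Q6.eval x * E x ∂unitMeasure)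
        + ∫ x, Q.Q8.eval x * E x ∂unitMeasure) := by
    rw [hN.eq_swap2, integral_mul_semisepOp_comm N P₁ mO mE, ← hN.eq_swap2,
      ← integral_const_mul O₂, ← integral_add
        (integrable_unit_of_continuousOn (by fun_prop))
        (integrable_unit_of_continuousOn (by fun_prop)), ← integral_const_mul]
    refine integral_unit_congr fun x hx => ?_
    simp only [hOs x hx]
    ring
  have hneg : -(2 * ∫ x, F x * semisepOp N P₁ P₂ E x ∂unitMeasure)
      ≤ r * (∫ x, F x ^ 2 ∂unitMeasure)
        + r⁻¹ * ∫ x, semisepOp N P₁ P₂ E x ^ 2 ∂unitMeasure := by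
    have := two_mul_integral_mul_le mF.neg mS hr0
    simpa only [Pi.neg_apply, neg_mul, integral_neg, neg_sq, mul_neg] using this
  have hS : r⁻¹ * ∫ x, semisepOp N P₁ P₂ E x ^ 2 ∂unitMeasure
      ≤ δ * ε₁ * ∫ x, E x ^ 2 ∂unitMeasure := by
    refine (mul_le_mul_of_nonneg_left (hC E mE) (inv_pos.2 hr0).le).trans_eq ?_
    rw [hr]
    field_simp
  have hco := mul_le_mul_of_nonneg_left (hN.mul_integral_sq_le hε₁.le mE)
    (by positivity : 0 ≤ 2 * δ)
  have eE : ∫ x, e x ^ 2 ∂unitMeasure = ∫ x, E x ^ 2 ∂unitMeasure :=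
    integral_unit_congr fun x hx => by simp only [eq0 hx]
  rw [eL, integral_sub i12 i3, integral_add i1 i2, integral_const_mul, eO, eE, eq1 m1]
  have hI : 0 ≤ ∫ x, E x ^ 2 ∂unitMeasure := integral_nonneg fun x => sq_nonneg _
  have k1 : min (δ * ε₁) ρ * ((∫ x, E x ^ 2 ∂unitMeasure) + E1 1 ^ 2)
      ≤ δ * ε₁ * (∫ x, E x ^ 2 ∂unitMeasure) + ρ * E1 1 ^ 2 := by
    rw [mul_add]
    exact add_le_add (mul_le_mul_of_nonneg_right (min_le_left _ _) hI)
      (mul_le_mul_of_nonneg_right (min_le_right _ _) (sq_nonneg _))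
  have k2 : Q.Q5 * E 1 ^ 2 + Q.Q7 * (E 1 * E1 1) = -ρ * E1 1 ^ 2 := by
    rw [h1, hρ]
    have := hO₂.ne
    field_simp
  rw [h1] at hdiss k2
  linarith

/-- The quotient rule twice. Keeping M² as a polynomial lets the denominator be differentiated
directly the second time. -/
lemma exists_deriv2_div {n n1 n2 : ℝ → ℝ} (M : ℝ[X]) (hM : ∀ x ∈ Icc (0 : ℝ) 1, M.eval x ≠ 0)
    (hn : ∀ x, HasDerivAt n (n1 x) x) (hn1 : ∀ x, HasDerivAt n1 (n2 x) x) (hn2 : Continuous n2)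
    {u : ℝ → ℝ} (hu : ∀ x ∈ Icc (0 : ℝ) 1, u x = n x / M.eval x) :
    ∃ U U1 U2 : ℝ → ℝ, (∀ x, HasDerivAt U (U1 x) x) ∧ (∀ x, HasDerivAt U1 (U2 x) x) ∧
      Continuous U2 ∧ EqOn u U (Icc 0 1) := by
  have hnc : Continuous n := continuous_iff_continuousAt.2 fun x => (hn x).continuousAt
  have hn1c : Continuous n1 := continuous_iff_continuousAt.2 fun x => (hn1 x).continuousAt
  have hM2 : ∀ x ∈ Icc (0 : ℝ) 1, (M ^ 2).eval x ≠ 0 := fun x hx => by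
    rw [Polynomial.eval_pow]; exact pow_ne_zero _ (hM x hx)
  obtain ⟨U, U1, U2, h, h1, h2, e, -⟩ := exists_C2_extension (u := u)
    (u1 := fun x => (n1 x * M.eval x - n x * M.derivative.eval x) / (M ^ 2).eval x)
    (u2 := fun x => (((n2 x * M.eval x + n1 x * M.derivative.eval x)
      - (n1 x * M.derivative.eval x + n x * M.derivative.derivative.eval x)) * (M ^ 2).eval x
      - (n1 x * M.eval x - n x * M.derivative.eval x) * (M ^ 2).derivative.eval x)
        / (M ^ 2).eval x ^ 2)
    (fun x hx => by
      have := ((hn x).div (M.hasDerivAt x) (hM x hx)).hasDerivWithinAt (s := Icc 0 1)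
      rw [← Polynomial.eval_pow] at this
      exact this.congr hu (hu x hx))
    (fun x hx => (((((hn1 x).mul (M.hasDerivAt x)).sub
      ((hn x).mul (M.derivative.hasDerivAt x))).div ((M ^ 2).hasDerivAt x)
        (hM2 x hx))).hasDerivWithinAt)
    (ContinuousOn.div (by fun_prop) (by fun_prop) fun x hx => pow_ne_zero _ (hM2 x hx))
  exact ⟨U, U1, U2, h, h1, h2, e⟩

lemma exists_deriv2_multiplier (M : ℝ[X]) (K : Poly2) {z z1 z2 : ℝ → ℝ}
    (hz : ∀ x, HasDerivAt z (z1 x) x) (hz1 : ∀ x, HasDerivAt z1 (z2 x) x) :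
    ∃ v1 v2 : ℝ → ℝ, (∀ x, HasDerivAt (fun x => M.eval x * z x + volt K (swap2 K) z x) (v1 x) x) ∧
      ∀ x, HasDerivAt v1 (v2 x) x := by
  have hc : Continuous z := continuous_iff_continuousAt.2 fun x => (hz x).continuousAt
  exact ⟨_, _, fun x => ((M.hasDerivAt x).mul (hz x)).add (hasDerivAt_volt_swap2 K hc x),
    fun x => (((M.derivative.hasDerivAt x).mul (hz x)).add
      ((M.hasDerivAt x).mul (hz1 x))).add (hasDerivAt_volt _ _ hc x)⟩

/-- The Lyapunov inequality for the observer state. -/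
lemma control_estimate (hα : 0 < α) (ha : ∀ x ∈ Icc (0 : ℝ) 1, α ≤ a.eval x) (hε₁ : 0 < ε₁)
    (hδ : 0 < δ) {M : ℝ[X]} {K₁ K₂ : Poly2} (hM : InXi d₁ d₂ ε₁ ε₂ M K₁ K₂)
    {T : DualData} (hTdef : T = dualMap a b c α ε₁ M K₁ K₂)
    (hT : InXi d₁ d₂ 0 β
      (-T.T0 - (2 * δ) • M) (-T.T1 - (2 * δ) • K₁) (-T.T2 - (2 * δ) • K₂))
    (hT3 : T.T3 ≤ 0) (hT4 : T.T4 = 0) {Z₁ : ℝ} (hZ₁ : Z₁ < 0)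
    (hZ₁' : T.T5 * Z₁ > -T.T6 * M.eval 1) {O₁ : ℝ → ℝ} (hO₁ : ContinuousOn O₁ (Icc 0 1)) (O₂ : ℝ) :
    ∃ κ C, 0 < κ ∧ 0 < C ∧ ∀ (v v1 v2 : ℝ → ℝ) (y : ℝ),
      (∀ x ∈ Icc (0 : ℝ) 1, HasDerivWithinAt v (v1 x) (Icc 0 1) x) →
      (∀ x ∈ Icc (0 : ℝ) 1, HasDerivWithinAt v1 (v2 x) (Icc 0 1) x) →
      ContinuousOn v2 (Icc 0 1) → v1 0 = 0 → v 1 = controller M K₁ K₂ Z₁ v + O₂ * y →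
      2 * ∫ x, (a.eval x * v2 x + b.eval x * v1 x + c.eval x * v x + O₁ x * y)
          * semisepInv M K₁ K₂ v x ∂unitMeasure
        ≤ -κ * (∫ x, semisepInv M K₁ K₂ v x ^ 2 ∂unitMeasure) + C * y ^ 2 := by
  -- Dividing the gain condition by the negative Z₁ reverses its sign and makes ρ positive.
  set ρ := -(T.T5 + T.T6 * M.eval 1 / Z₁) with hρ
  have hρ0 : 0 < ρ := by
    have h : ρ * (-Z₁) = T.T5 * Z₁ + T.T6 * M.eval 1 := by
      rw [hρ]; have := hZ₁.ne; field_simp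
    exact pos_of_mul_pos_left (by rw [h]; linarith) (by linarith)
  set I := ∫ x, O₁ x ^ 2 ∂unitMeasure with hI
  have hI0 : 0 ≤ I := integral_nonneg fun x => sq_nonneg _
  set q := T.T6 * O₂ / Z₁ with hq
  -- The first summand pays for the O₂y injected at the boundary, the second for the distributed
  -- injection O₁y; the 1 only keeps the constant positive.
  refine ⟨δ * ε₁, q ^ 2 / (4 * ρ) + I / (δ * ε₁) + 1, by positivity, by positivity, ?_⟩
  intro v v1 v2 y hv hv1 hv2 h0 h1
  have hvc : ContinuousOn v (Icc 0 1) := fun x hx => (hv x hx).continuousWithinAt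
  obtain ⟨hzc, hzs⟩ := hM.semisepInv_spec hε₁ hvc
  set z := semisepInv M K₁ K₂ v with hzdef
  have hK := hM.eq_swap2
  have hMne : ∀ x ∈ Icc (0 : ℝ) 1, M.eval x ≠ 0 := fun x hx =>
    (hε₁.trans_le (hM.le_eval hε₁.le hx)).ne'
  have m0 : (0 : ℝ) ∈ Icc (0 : ℝ) 1 := by simp
  have m1 : (1 : ℝ) ∈ Icc (0 : ℝ) 1 := by simp
  obtain ⟨V, V1, V2, hV, hV1, hV2, eV, eV1, eV2⟩ := exists_C2_extension hv hv1 hv2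
  -- the inverse is twice continuously differentiable
  obtain ⟨Z, Zd, Zdd, hZ, hZd, hZdd, eZ⟩ : ∃ Z Zd Zdd : ℝ → ℝ, (∀ x, HasDerivAt Z (Zd x) x) ∧
      (∀ x, HasDerivAt Zd (Zdd x) x) ∧ Continuous Zdd ∧ EqOn z Z (Icc 0 1) := by
    have hz'c : Continuous (IccExtend zero_le_one ((Icc (0 : ℝ) 1).domRestrict z)) :=
      hzc.domRestrict.Icc_extend'
    set z' := IccExtend zero_le_one ((Icc (0 : ℝ) 1).domRestrict z) with hz'
    have ez : EqOn z z' (Icc 0 1) := fun x hx => by rw [hz', IccExtend_of_mem _ _ hx]; rfl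
    have g1 := hasDerivAt_volt_swap2 K₁ hz'c
    have g2 := hasDerivAt_volt (dX K₁) (dX (swap2 K₁)) hz'c
    have c2 := continuous_volt (dX (dX K₁)) (dX (dX (swap2 K₁))) hz'c
    have c3 := continuous_ev2_diag (dX K₁ - dX (swap2 K₁))
    -- Bootstrapping: z is continuous, so its Volterra part is already C², and z = (v − Volterra
    -- part)/M inherits two derivatives.
    refine exists_deriv2_div M hMne (fun x => (hV x).sub (g1 x)) (fun x => (hV1 x).sub (g2 x))
      (by fun_prop) fun x hx => ?_
    have h := hzs x hx
    rw [semisepOp_congr M K₁ K₂ ez hx, semisepOp_eq_volt _ _ _ hz'c hx, ← ez hx, hK] at h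
    rw [eq_div_iff (hMne x hx), Pi.sub_apply, ← eV hx, ← h]
    ring
  have hZc : Continuous Z := continuous_iff_continuousAt.2 fun x => (hZ x).continuousAt
  obtain ⟨Y1, Y2, hY1, hY2⟩ := exists_deriv2_multiplier M K₁ hZ hZd
  set Y : ℝ → ℝ := fun x => M.eval x * Z x + volt K₁ (swap2 K₁) Z x with hY
  have eY : EqOn v Y (Icc 0 1) := fun x hx => by
    rw [← hzs x hx, semisepOp_congr M K₁ K₂ eZ hx, semisepOp_eq_volt _ _ _ hZc hx, hK]
  have eY1 : EqOn v1 Y1 (Icc 0 1) := fun x hx =>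
    (uniqueDiffOn_Icc zero_lt_one x hx).eq_deriv _ (hv x hx)
      ((hY1 x).hasDerivWithinAt.congr eY (eY hx))
  have eY2 : EqOn v2 Y2 (Icc 0 1) := fun x hx =>
    (uniqueDiffOn_Icc zero_lt_one x hx).eq_deriv _ (hv1 x hx)
      ((hY2 x).hasDerivWithinAt.congr eY1 (eY1 hx))
  have hdiss := dual_dissipation hα ha hε₁ hK (fun x hx => hM.le_eval hε₁.le hx) hTdef hT hT3 hT4
    hZ hZd hZdd (v := Y) (fun x => by rw [hK]) hY1 hY2 (by rw [← eY1 m0, h0])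
  have mZ : MemLp Z 2 unitMeasure := memLp_unit_of_continuousOn hZc.continuousOn
  have mO : MemLp O₁ 2 unitMeasure := memLp_unit_of_continuousOn hO₁
  -- boundary condition
  have hbd : M.eval 1 * Z 1 = Z₁ * Zd 1 + O₂ * y := by
    have e1 : derivWithin z (Icc 0 1) 1 = Zd 1 :=
      ((hZ 1).hasDerivWithinAt.congr eZ (eZ m1)).derivWithin (uniqueDiffOn_Icc zero_lt_one 1 m1)
    have e2 : ∫ x in (0 : ℝ)..1, ev2 K₁ 1 x * z x = volt K₁ (swap2 K₁) Z 1 := by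
      rw [volt_one, intervalIntegral.integral_of_le zero_le_one]
      exact integral_unit_congr fun x hx => by simp only [eZ hx]
    rw [controller, ← hzdef, e1, e2, eY m1] at h1
    simp only [hY] at h1
    linarith
  have hco := mul_le_mul_of_nonneg_left (hM.mul_integral_sq_le hε₁.le mZ)
    (by positivity : 0 ≤ 2 * δ)
  have eco : ∫ x, Z x * semisepOp M K₁ K₂ Z x ∂unitMeasure = ∫ x, Z x * Y x ∂unitMeasure :=
    integral_unit_congr fun x hx => by rw [semisepOp_eq_volt _ _ _ hZc hx, hK]
  rw [eco] at hco
  have mv : MemLp (fun x => a.eval x * v2 x + b.eval x * v1 x + c.eval x * v x) 2 unitMeasure := by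
    have : ContinuousOn v1 (Icc 0 1) := fun x hx => (hv1 x hx).continuousWithinAt
    exact memLp_unit_of_continuousOn (by fun_prop)
  have eL : ∫ x, (a.eval x * v2 x + b.eval x * v1 x + c.eval x * v x + O₁ x * y) * z x ∂unitMeasure
      = (∫ x, (a.eval x * Y2 x + b.eval x * Y1 x + c.eval x * Y x) * Z x ∂unitMeasure)
        + ∫ x, (y * O₁ x) * Z x ∂unitMeasure := by
    have e1 : ∫ x, (a.eval x * Y2 x + b.eval x * Y1 x + c.eval x * Y x) * Z x ∂unitMeasure
        = ∫ x, (a.eval x * v2 x + b.eval x * v1 x + c.eval x * v x) * Z x ∂unitMeasure :=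
      integral_unit_congr fun x hx => by simp only [eY hx, eY1 hx, eY2 hx]
    rw [e1, ← integral_add (integrable_mul_unit mv mZ)
      (integrable_mul_unit (mO.const_mul y) mZ)]
    refine integral_unit_congr fun x hx => ?_
    simp only [eZ hx]
    ring
  have hr : 0 < (δ * ε₁)⁻¹ := by positivity
  have hyoung := two_mul_integral_mul_le (mO.const_mul y) mZ hr
  simp only [mul_pow, integral_const_mul, inv_inv] at hyoung
  have eZ2 : ∫ x, z x ^ 2 ∂unitMeasure = ∫ x, Z x ^ 2 ∂unitMeasure :=
    integral_unit_congr fun x hx => by simp only [eZ hx]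
  rw [eL, eZ2]
  -- The integral part of the controller cancels that of 𝒫z at x = 1. The condition left is local
  -- and determines z_x(1) from z(1) and y.
  have k1 : T.T5 * Z 1 ^ 2 + T.T6 * (Z 1 * Zd 1) = -ρ * Z 1 ^ 2 - q * (Z 1 * y) := by
    have : Zd 1 = (M.eval 1 * Z 1 - O₂ * y) / Z₁ := by
      rw [eq_div_iff hZ₁.ne]; linarith
    rw [this, hρ, hq]
    ring
  have k2 : -ρ * Z 1 ^ 2 - q * (Z 1 * y) ≤ q ^ 2 / (4 * ρ) * y ^ 2 := by
    have e : q ^ 2 / (4 * ρ) * y ^ 2 - (-ρ * Z 1 ^ 2 - q * (Z 1 * y))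
        = (2 * ρ * Z 1 + q * y) ^ 2 / (4 * ρ) := by
      field_simp
      ring
    have : 0 ≤ (2 * ρ * Z 1 + q * y) ^ 2 / (4 * ρ) := by positivity
    linarith
  have k3 : (q ^ 2 / (4 * ρ) + I / (δ * ε₁) + 1) * y ^ 2
      = q ^ 2 / (4 * ρ) * y ^ 2 + (δ * ε₁)⁻¹ * (y ^ 2 * I) + y ^ 2 := by
    field_simp
  rw [k3]
  have := sq_nonneg y
  linarith

end Estimates

/-! ### The closed loop -/

lemma lintegral_enorm_sq_eq {g : ℝ → ℝ} (hg : ContinuousOn g (Icc 0 1)) :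
    ∫⁻ x in Icc (0 : ℝ) 1, ‖g x‖ₑ ^ 2 = ENNReal.ofReal (∫ x, g x ^ 2 ∂unitMeasure) := by
  rw [← Measure.restrict_congr_set (Ioc_ae_eq_Icc (μ := volume) (a := (0 : ℝ)) (b := 1)),
    ofReal_integral_eq_lintegral_ofReal (memLp_unit_of_continuousOn hg).integrable_sq
      (ae_of_all _ fun x => sq_nonneg _)]
  refine lintegral_congr fun x => ?_
  rw [Real.enorm_eq_ofReal_abs, ← ENNReal.ofReal_pow (abs_nonneg _), sq_abs]

lemma normL2L2_eq {g : ℝ → ℝ → ℝ}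
    (hg : ContinuousOn (Function.uncurry g) (Icc 0 1 ×ˢ Ioi 0)) :
    normL2L2 g = (∫⁻ t in Ioi (0 : ℝ),
      ENNReal.ofReal (∫ x, g x t ^ 2 ∂unitMeasure)) ^ (1 / 2 : ℝ) := by
  rw [normL2L2]
  congr 1
  exact setLIntegral_congr_fun measurableSet_Ioi fun t ht =>
    lintegral_enorm_sq_eq (continuousOn_slice hg ht)

/-- The norm has time as its outer variable while `spaceTime` lists space first, so the factors are
exchanged before slicing the null set. -/
lemma normL2L2_congr_ae {f g : ℝ → ℝ → ℝ}
    (h : ∀ᵐ p ∂spaceTime, f p.1 p.2 = g p.1 p.2) : normL2L2 f = normL2L2 g := by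
  have h' : ∀ᵐ q ∂((volume.restrict (Ioi (0 : ℝ))).prod (volume.restrict (Icc (0 : ℝ) 1))),
      f q.2 q.1 = g q.2 q.1 := by
    rw [spaceTime, ← Measure.prod_swap] at h
    exact ae_of_ae_map measurable_swap.aemeasurable h
  rw [normL2L2, normL2L2]
  congr 1
  refine lintegral_congr_ae ?_
  filter_upwards [Measure.ae_ae_of_ae_prod h'] with t ht
  refine lintegral_congr_ae ?_
  filter_upwards [ht] with x hx
  rw [hx]

lemma zeroInitial_iff (w : ℝ → ℝ → ℝ) :
    ZeroInitial w ↔ Tendsto (fun t => ∫ x, w x t ^ 2 ∂unitMeasure) (𝓝[>] 0) (𝓝 0) := by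
  simp only [ZeroInitial, intervalIntegral.integral_of_le zero_le_one]

lemma integral_add_sq_le {f g : ℝ → ℝ} (hf : MemLp f 2 unitMeasure) (hg : MemLp g 2 unitMeasure) :
    ∫ x, (f x + g x) ^ 2 ∂unitMeasure
      ≤ 2 * (∫ x, f x ^ 2 ∂unitMeasure) + 2 * ∫ x, g x ^ 2 ∂unitMeasure := by
  rw [← integral_const_mul, ← integral_const_mul,
    ← integral_add (hf.integrable_sq.const_mul _) (hg.integrable_sq.const_mul _)]
  refine integral_mono (hf.add hg).integrable_sq
    ((hf.integrable_sq.const_mul _).add (hg.integrable_sq.const_mul _)) fun x => ?_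
  simp only
  nlinarith [sq_nonneg (f x - g x)]

lemma integral_sub_sq_le {f g : ℝ → ℝ} (hf : MemLp f 2 unitMeasure) (hg : MemLp g 2 unitMeasure) :
    ∫ x, (f x - g x) ^ 2 ∂unitMeasure
      ≤ 2 * (∫ x, f x ^ 2 ∂unitMeasure) + 2 * ∫ x, g x ^ 2 ∂unitMeasure := by
  have h := integral_add_sq_le hf hg.neg
  simpa only [Pi.neg_apply, neg_sq, ← sub_eq_add_neg] using h

/-! ### Time derivatives of the two Lyapunov functionals. -/

section Lyapunov

variable {d₁ d₂ : ℕ} {ε₁ ε₂ : ℝ} {M : ℝ[X]} {K₁ K₂ : Poly2}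

/-- Derivative of `⟨e, 𝒮 e⟩` along a regular function. -/
lemma InXi.hasDerivAt_integral_mul_semisepOp (h : InXi d₁ d₂ ε₁ ε₂ M K₁ K₂)
    {e et ex exx : ℝ → ℝ → ℝ} (he : HasC12 e et ex exx) {t : ℝ} (ht : 0 < t) :
    HasDerivAt (fun s => ∫ x, e x s * semisepOp M K₁ K₂ (fun y => e y s) x ∂unitMeasure)
      (2 * ∫ x, et x t * semisepOp M K₁ K₂ (fun y => e y t) x ∂unitMeasure) t := by
  obtain ⟨C, hC0, hC⟩ := exists_integral_semisepOp_sq_le M K₁ K₂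
  have hm : ∀ s, 0 < s → MemLp (fun x => e x s) 2 unitMeasure := fun s hs =>
    memLp_unit_of_continuousOn (continuousOn_slice he.cont hs)
  refine hasDerivAt_integral_mul (Y := fun x s => semisepOp M K₁ K₂ (fun y => e y s) x) ht hC0.le
    he.dt he.cont he.cont_t (fun s hs => memLp_semisepOp _ _ _ (hm s hs)) (fun s hs => ?_)
    (fun s hs => ?_)
  · rw [h.eq_swap2]
    exact integral_mul_semisepOp_comm M K₁ (hm t ht) (hm s hs)
  · refine le_of_eq_of_le (integral_unit_congr fun x hx => ?_) (hC _ ((hm s hs).sub (hm t ht)))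
    congr 1
    exact (semisepOp_sub M K₁ K₂ (integrable_unit_of_memLp (hm s hs))
      (integrable_unit_of_memLp (hm t ht)) hx).symm

/-- Derivative of `⟨v, 𝒫⁻¹ v⟩` along a regular function. -/
lemma InXi.hasDerivAt_integral_mul_semisepInv (h : InXi d₁ d₂ ε₁ ε₂ M K₁ K₂) (hε : 0 < ε₁)
    {v vt vx vxx : ℝ → ℝ → ℝ} (hv : HasC12 v vt vx vxx) {t : ℝ} (ht : 0 < t) :
    HasDerivAt (fun s => ∫ x, v x s * semisepInv M K₁ K₂ (fun y => v y s) x ∂unitMeasure)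
      (2 * ∫ x, vt x t * semisepInv M K₁ K₂ (fun y => v y t) x ∂unitMeasure) t := by
  have hz : ∀ s, 0 < s → MemLp (semisepInv M K₁ K₂ (fun y => v y s)) 2 unitMeasure := fun s hs =>
    memLp_unit_of_continuousOn (h.semisepInv_spec hε (continuousOn_slice hv.cont hs)).1
  have hs' : ∀ s, 0 < s → ∀ x ∈ Icc (0 : ℝ) 1,
      semisepOp M K₁ K₂ (semisepInv M K₁ K₂ (fun y => v y s)) x = v x s := fun s hs =>
    (h.semisepInv_spec hε (continuousOn_slice hv.cont hs)).2
  refine hasDerivAt_integral_mul (Y := fun x s => semisepInv M K₁ K₂ (fun y => v y s) x) ht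
    (by positivity : 0 ≤ (ε₁⁻¹) ^ 2) hv.dt hv.cont hv.cont_t hz (fun s hs => ?_) (fun s hs => ?_)
  · have e : ∀ r q, 0 < r → ∫ x, v x r * semisepInv M K₁ K₂ (fun y => v y q) x ∂unitMeasure
        = ∫ x, semisepInv M K₁ K₂ (fun y => v y q) x
          * semisepOp M K₁ K₂ (semisepInv M K₁ K₂ (fun y => v y r)) x ∂unitMeasure :=
      fun r q hr => integral_unit_congr fun x hx => by
        simp only [hs' r hr x hx, mul_comm]
    rw [e t s ht, e s t hs]
    have := integral_mul_semisepOp_comm M K₁ (hz s hs) (hz t ht)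
    rwa [← h.eq_swap2] at this
  -- The inverse is Lipschitz from L² to L² by coercivity of 𝒫; this is the bound the polarization
  -- argument requires.
  · refine (h.integral_sq_le hε ((hz s hs).sub (hz t ht))).trans_eq ?_
    congr 1
    refine integral_unit_congr fun x hx => ?_
    congr 1
    refine (semisepOp_sub M K₁ K₂ (integrable_unit_of_memLp (hz s hs))
      (integrable_unit_of_memLp (hz t ht)) hx).trans ?_
    rw [hs' s hs x hx, hs' t ht x hx]

end Lyapunov

end ParabolicSOS

/-! ### The combined Lyapunov functional and the gain bound. -/

theorem mainTheorem1
    (a b c : Polynomial ℝ) (α : ℝ) (hα : 0 < α)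
    (ha : ∀ x ∈ Set.Icc (0 : ℝ) 1, α ≤ a.eval x)
    (d₁ d₂ : ℕ) (ε₁ ε₂ δ β : ℝ) (hε₁ : 0 < ε₁) (hε₂ : ε₁ < ε₂) (hδ : 0 < δ) (hβ : 0 < β)
    (M N : Polynomial ℝ) (K₁ K₂ P₁ P₂ : ParabolicSOS.Poly2)
    (hM : ParabolicSOS.InXi d₁ d₂ ε₁ ε₂ M K₁ K₂)
    (hN : ParabolicSOS.InXi d₁ d₂ ε₁ ε₂ N P₁ P₂)
    (T : ParabolicSOS.DualData) (hTdef : T = ParabolicSOS.dualMap a b c α ε₁ M K₁ K₂)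
    (Q : ParabolicSOS.PrimalData) (hQdef : Q = ParabolicSOS.primalMap a b c α ε₁ N P₁ P₂)
    (hT : ParabolicSOS.InXi d₁ d₂ 0 β
      (-T.T0 - (2 * δ) • M) (-T.T1 - (2 * δ) • K₁) (-T.T2 - (2 * δ) • K₂))
    (hQ : ParabolicSOS.InXi d₁ d₂ 0 β
      (-Q.Q0 - (2 * δ) • N) (-Q.Q1 - (2 * δ) • P₁) (-Q.Q2 - (2 * δ) • P₂))
    (hT3 : T.T3 ≤ 0) (hT4 : T.T4 = 0) (hQ3 : Q.Q3 ≤ 0) (hQ4 : Q.Q4 = 0)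
    (Z₁ : ℝ) (hZ₁ : Z₁ < 0) (hZ₁' : T.T5 * Z₁ > -T.T6 * M.eval 1)
    (O₂ : ℝ) (hO₂ : O₂ < 0) (hO₂' : Q.Q5 + 1 / O₂ * Q.Q7 < 0) :
    ∃ γ : ℝ, 0 < γ ∧
      ∀ f w v : ℝ → ℝ → ℝ,
        ParabolicSOS.MemL2L2 f →
        ParabolicSOS.IsCoupledSolution a b c
          (ParabolicSOS.controller M K₁ K₂ Z₁)
          (ParabolicSOS.observerGain N P₁ P₂ Q O₂) O₂ f w v →
        ParabolicSOS.ZeroInitial w → ParabolicSOS.ZeroInitial v →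
        ParabolicSOS.normL2L2 w ≤ ENNReal.ofReal γ * ParabolicSOS.normL2L2 f := by
  obtain ⟨κe, Ce, hκe, hCe, herr⟩ := ParabolicSOS.error_estimate hα ha hε₁ hδ hN hQdef hQ hQ3 hQ4
    hO₂ hO₂'
  have hO₁ : ContinuousOn (ParabolicSOS.observerGain N P₁ P₂ Q O₂) (Icc 0 1) :=
    (hN.semisepInv_spec hε₁ (v := fun x => -(1 / 2) * (O₂ * Q.Q6.eval x + Q.Q8.eval x))
      (by fun_prop)).1
  obtain ⟨κz, Cz, hκz, hCz, hctr⟩ := ParabolicSOS.control_estimate hα ha hε₁ hδ hM hTdef hT hT3 hT4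
    hZ₁ hZ₁' hO₁ O₂
  obtain ⟨Cp, hCp, hP⟩ := ParabolicSOS.exists_integral_semisepOp_sq_le M K₁ K₂
  obtain ⟨Cs, hCs, hS⟩ := ParabolicSOS.exists_integral_semisepOp_sq_le N P₁ P₂
  -- Chosen so that μκₑ = C_z + κₑ: the weighted error dissipation pays for C_z y² and still leaves
  -- κₑ‖e‖².
  set μ := Cz / κe + 1 with hμ
  have hμ0 : 0 < μ := by positivity
  have hμκ : μ * κe = Cz + κe := by rw [hμ]; field_simp
  set κ := min (κz / (2 * Cp)) (κe / 2) with hκ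
  have hκ0 : 0 < κ := lt_min (by positivity) (by positivity)
  have hC0 : 0 < μ * Ce := by positivity
  refine ⟨(μ * Ce / κ) ^ (1 / 2 : ℝ), by positivity, fun f w v _ hsol hw0 hv0 => ?_⟩
  have hv := hsol.smooth_v.hasC12
  have hw := hsol.smooth_w.hasC12
  have he := hv.sub hw
  -- F is the continuous representative of f dictated by the plant equation. Using it makes all time
  -- slices and time integrands continuous.
  set F : ℝ → ℝ → ℝ := fun x t => ParabolicSOS.pt w x t - ParabolicSOS.genA a b c w x t with hF
  have hFc : ContinuousOn (Function.uncurry F) (Icc 0 1 ×ˢ Ioi 0) := by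
    have hp : ∀ p : Polynomial ℝ, ContinuousOn (fun q : ℝ × ℝ => p.eval q.1) (Icc 0 1 ×ˢ Ioi 0) :=
      fun p => by fun_prop
    exact hw.cont_t.sub ((((hp a).mul hw.cont_xx).add
      ((hp b).mul hsol.smooth_w.cont_x)).add ((hp c).mul hw.cont))
  have hfF : ParabolicSOS.normL2L2 f = ParabolicSOS.normL2L2 F := by
    refine ParabolicSOS.normL2L2_congr_ae ?_
    filter_upwards [hsol.plant] with p hp
    simp only [hF, hp]
    ring
  have mv : ∀ t, 0 < t → MemLp (fun x => v x t) 2 ParabolicSOS.unitMeasure := fun t ht =>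
    ParabolicSOS.memLp_unit_of_continuousOn (ParabolicSOS.continuousOn_slice hv.cont ht)
  have mw : ∀ t, 0 < t → MemLp (fun x => w x t) 2 ParabolicSOS.unitMeasure := fun t ht =>
    ParabolicSOS.memLp_unit_of_continuousOn (ParabolicSOS.continuousOn_slice hw.cont ht)
  have me : ∀ t, 0 < t → MemLp (fun x => v x t - w x t) 2 ParabolicSOS.unitMeasure :=
    fun t ht => (mv t ht).sub (mw t ht)
  set z : ℝ → ℝ → ℝ := fun x t => ParabolicSOS.semisepInv M K₁ K₂ (fun y => v y t) x with hz
  have hzspec : ∀ t, 0 < t → ContinuousOn (fun x => z x t) (Icc 0 1) ∧ ∀ x ∈ Icc (0 : ℝ) 1,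
      ParabolicSOS.semisepOp M K₁ K₂ (fun y => z y t) x = v x t := fun t ht =>
    hM.semisepInv_spec hε₁ (ParabolicSOS.continuousOn_slice hv.cont ht)
  have mz : ∀ t, 0 < t → MemLp (fun x => z x t) 2 ParabolicSOS.unitMeasure := fun t ht =>
    ParabolicSOS.memLp_unit_of_continuousOn (hzspec t ht).1
  have hPz : ∀ t, 0 < t → ∫ x, ParabolicSOS.semisepOp M K₁ K₂ (fun y => z y t) x ^ 2
      ∂ParabolicSOS.unitMeasure = ∫ x, v x t ^ 2 ∂ParabolicSOS.unitMeasure := fun t ht =>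
    ParabolicSOS.integral_unit_congr fun x hx => by rw [(hzspec t ht).2 x hx]
  have hzP : ∀ t, 0 < t → ∫ x, z x t * ParabolicSOS.semisepOp M K₁ K₂ (fun y => z y t) x
      ∂ParabolicSOS.unitMeasure = ∫ x, v x t * z x t ∂ParabolicSOS.unitMeasure := fun t ht =>
    ParabolicSOS.integral_unit_congr fun x hx => by rw [(hzspec t ht).2 x hx, mul_comm]
  set Vz : ℝ → ℝ := fun t => ∫ x, v x t * z x t ∂ParabolicSOS.unitMeasure with hVz
  set Ve : ℝ → ℝ := fun t => ∫ x, (v x t - w x t)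
    * ParabolicSOS.semisepOp N P₁ P₂ (fun y => v y t - w y t) x ∂ParabolicSOS.unitMeasure with hVe
  have hVz0 : ∀ t, 0 < t → 0 ≤ Vz t := fun t ht => by
    have h1 := hM.mul_integral_sq_le hε₁.le (mz t ht)
    rw [hzP t ht] at h1
    exact le_trans (mul_nonneg hε₁.le (integral_nonneg fun x => sq_nonneg _)) h1
  have hVe0 : ∀ t, 0 < t → 0 ≤ Ve t := fun t ht =>
    le_trans (mul_nonneg hε₁.le (integral_nonneg fun x => sq_nonneg _))
      (hN.mul_integral_sq_le hε₁.le (me t ht))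
  have hWd : ∀ t, 0 < t → HasDerivAt (fun t => Vz t + μ * Ve t) _ t := fun t ht =>
    (hM.hasDerivAt_integral_mul_semisepInv hε₁ hv ht).add
      ((hN.hasDerivAt_integral_mul_semisepOp he ht).const_mul μ)
  have hle : ∀ t, 0 < t → 2 * (∫ x, ParabolicSOS.pt v x t * z x t ∂ParabolicSOS.unitMeasure)
      + μ * (2 * ∫ x, (ParabolicSOS.pt v x t - ParabolicSOS.pt w x t)
        * ParabolicSOS.semisepOp N P₁ P₂ (fun y => v y t - w y t) x ∂ParabolicSOS.unitMeasure)
      ≤ -κ * (∫ x, w x t ^ 2 ∂ParabolicSOS.unitMeasure)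
        + μ * Ce * ∫ x, F x t ^ 2 ∂ParabolicSOS.unitMeasure := by
    intro t ht
    set y := ParabolicSOS.px v 1 t - ParabolicSOS.px w 1 t with hy
    have h1 := hctr (fun x => v x t) (fun x => ParabolicSOS.px v x t)
      (fun x => ParabolicSOS.pxx v x t) y (hv.dx t ht) (hv.dxx t ht)
      (ParabolicSOS.continuousOn_slice hv.cont_xx ht) (hsol.observer_left t ht)
      (hsol.observer_right t ht)
    have h2 := herr (fun x => v x t - w x t)
      (fun x => ParabolicSOS.px v x t - ParabolicSOS.px w x t)
      (fun x => ParabolicSOS.pxx v x t - ParabolicSOS.pxx w x t) (fun x => F x t)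
      (he.dx t ht) (he.dxx t ht) (ParabolicSOS.continuousOn_slice he.cont_xx ht)
      (ParabolicSOS.continuousOn_slice hFc ht)
      (by simp only [hsol.observer_left t ht, hsol.plant_left t ht, sub_zero])
      (by simp only [hsol.observer_right t ht, hsol.plant_right t ht]; ring)
    have e1 : ∫ x, ParabolicSOS.pt v x t * z x t ∂ParabolicSOS.unitMeasure
        = ∫ x, (a.eval x * ParabolicSOS.pxx v x t + b.eval x * ParabolicSOS.px v x t
          + c.eval x * v x t + ParabolicSOS.observerGain N P₁ P₂ Q O₂ x * y) * z x t
          ∂ParabolicSOS.unitMeasure :=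
      ParabolicSOS.integral_unit_congr fun x hx => by
        rw [hsol.observer x hx t ht, ParabolicSOS.genA]
    have e2 : ∫ x, (ParabolicSOS.pt v x t - ParabolicSOS.pt w x t)
        * ParabolicSOS.semisepOp N P₁ P₂ (fun y => v y t - w y t) x ∂ParabolicSOS.unitMeasure
        = ∫ x, (a.eval x * (ParabolicSOS.pxx v x t - ParabolicSOS.pxx w x t)
          + b.eval x * (ParabolicSOS.px v x t - ParabolicSOS.px w x t)
          + c.eval x * (v x t - w x t)
          + ParabolicSOS.observerGain N P₁ P₂ Q O₂ x * y - F x t)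
          * ParabolicSOS.semisepOp N P₁ P₂ (fun y => v y t - w y t) x
          ∂ParabolicSOS.unitMeasure :=
      ParabolicSOS.integral_unit_congr fun x hx => by
        rw [hsol.observer x hx t ht]
        simp only [hF, ParabolicSOS.genA]
        ring
    rw [e1, e2]
    have h3 := mul_le_mul_of_nonneg_left h2 hμ0.le
    have h4 := hP _ (mz t ht)
    rw [hPz t ht] at h4
    have h5 := ParabolicSOS.integral_sub_sq_le (mv t ht) (me t ht)
    simp only [sub_sub_cancel] at h5
    set Iz := ∫ x, z x t ^ 2 ∂ParabolicSOS.unitMeasure with hIz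
    set Ie := ∫ x, (v x t - w x t) ^ 2 ∂ParabolicSOS.unitMeasure with hIe
    have hIz0 : 0 ≤ Iz := integral_nonneg fun x => sq_nonneg _
    have hIe0 : 0 ≤ Ie := integral_nonneg fun x => sq_nonneg _
    -- From w = v − e: ‖w‖² ≤ 2‖v‖² + 2‖e‖² ≤ 2C_p‖z‖² + 2‖e‖², which explains both entries of the
    -- minimum defining κ.
    have h6 : κ * (∫ x, w x t ^ 2 ∂ParabolicSOS.unitMeasure) ≤ κz * Iz + κe * Ie := by
      have k1 : κ * (2 * Cp) ≤ κz := by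
        rw [← le_div_iff₀ (by positivity)]; exact min_le_left _ _
      have k2 : κ * 2 ≤ κe := by
        rw [← le_div_iff₀ (by positivity)]; exact min_le_right _ _
      have k3 := mul_le_mul_of_nonneg_right k1 hIz0
      have k4 := mul_le_mul_of_nonneg_right k2 hIe0
      have k5 := mul_le_mul_of_nonneg_left (h5.trans (add_le_add_left
        (mul_le_mul_of_nonneg_left h4 (by norm_num : (0 : ℝ) ≤ 2)) _)) hκ0.le
      linarith
    have h7 : μ * (-κe * (Ie + y ^ 2)
        + Ce * ∫ x, F x t ^ 2 ∂ParabolicSOS.unitMeasure)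
        = -(Cz + κe) * (Ie + y ^ 2)
          + μ * Ce * ∫ x, F x t ^ 2 ∂ParabolicSOS.unitMeasure := by
      rw [← hμκ]; ring
    rw [h7] at h3
    have h8 := mul_nonneg hCz.le hIe0
    have h9 := mul_nonneg hκe.le (sq_nonneg y)
    linarith
  have hW0 : Tendsto (fun t => Vz t + μ * Ve t) (𝓝[>] 0) (𝓝 0) := by
    rw [ParabolicSOS.zeroInitial_iff] at hw0 hv0
    have hub : Tendsto (fun t => (1 + (ε₁⁻¹) ^ 2)
        * (∫ x, v x t ^ 2 ∂ParabolicSOS.unitMeasure) + μ * ((1 + Cs)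
        * (2 * (∫ x, v x t ^ 2 ∂ParabolicSOS.unitMeasure)
          + 2 * ∫ x, w x t ^ 2 ∂ParabolicSOS.unitMeasure))) (𝓝[>] 0) (𝓝 0) := by
      have h := (hv0.const_mul (1 + (ε₁⁻¹) ^ 2)).add
        ((((hv0.const_mul 2).add (hw0.const_mul 2)).const_mul (1 + Cs)).const_mul μ)
      simpa using h
    refine tendsto_of_tendsto_of_tendsto_of_le_of_le' tendsto_const_nhds hub ?_ ?_
    · filter_upwards [self_mem_nhdsWithin] with t ht
      exact add_nonneg (hVz0 t ht) (mul_nonneg hμ0.le (hVe0 t ht))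
    · filter_upwards [self_mem_nhdsWithin] with t ht
      have ht' : 0 < t := ht
      have h1 := ParabolicSOS.two_mul_integral_mul_le (mv t ht) (mz t ht) one_pos
      have h2 := hM.integral_sq_le hε₁ (mz t ht)
      rw [hPz t ht] at h2
      have h3 := ParabolicSOS.two_mul_integral_mul_le (me t ht)
        (ParabolicSOS.memLp_semisepOp N P₁ P₂ (me t ht)) one_pos
      have h4 := hS _ (me t ht)
      have h5 := mul_le_mul_of_nonneg_left (ParabolicSOS.integral_sub_sq_le (mv t ht) (mw t ht))
        (by positivity : 0 ≤ 1 + Cs)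
      have h6 := hVz0 t ht
      have h7 := hVe0 t ht
      simp only [inv_one, one_mul] at h1 h3
      -- Young bounds twice each functional; since the functionals are nonnegative, the spare factor
      -- 2 can be dropped.
      refine add_le_add (by simp only [hVz] at h6 ⊢; linarith)
        (mul_le_mul_of_nonneg_left ?_ hμ0.le)
      simp only [hVe] at h7 ⊢
      linarith
  have hfin := ParabolicSOS.lintegral_le_of_dissipation hκ0 hC0 hWd hle
    (fun t ht => add_nonneg (hVz0 t ht) (mul_nonneg hμ0.le (hVe0 t ht))) hW0
    (ParabolicSOS.continuousOn_integral_sq hw.cont) (ParabolicSOS.continuousOn_integral_sq hFc)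
    (fun t _ => integral_nonneg fun x => sq_nonneg _)
    (fun t _ => integral_nonneg fun x => sq_nonneg _)
  rw [hfF, ParabolicSOS.normL2L2_eq hw.cont, ParabolicSOS.normL2L2_eq hFc,
    ← ENNReal.ofReal_rpow_of_pos (by positivity), ← ENNReal.mul_rpow_of_nonneg _ _ (by norm_num)]
  -- The integrated inequality has constant μCₑ/κ for squared norms; the square root is γ.
  exact ENNReal.rpow_le_rpow hfin (by norm_num)
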